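/- **Proposition 3.1 (analytic KAM step).** *Conventions.* Let $d\ge 1$, $\mathbb T^d=\mathbb R^d/(2\pi\mathbb Z)^d$, $2\mathbb T^d=\mathbb R^d/(4\pi\mathbb Z)^d$. For $m\in\mathbb Z^d$ put $|m|=\sum_i|m_i|$, $\langle m,\alpha\rangle=\sum_i m_i\alpha_i$, and for $x\in\mathbb C$ put $\|x\|_*=\inf_{j\in\mathbb Z}|x-2\pi j|$. For $\kappa,\tau>0$, $\alpha\in\mathrm{DC}_d(\kappa,\tau)$ means $\|\langle m,\alpha\rangle\|_*>\kappa|m|^{-\tau}$ for all $m\in\mathbb Z^d\setminus\{0\}$. For $h>0$, $C^\omega_h(\mathbb T^d,*)$ (respectively $C^\omega_h(2\mathbb T^d,*)$) is the set of bounded analytic complex-matrix-valued functions $F$ on the strip $\{\theta\in\mathbb C^d:|\operatorname{Im}\theta_i|<h\ \forall i\}$, $2\pi$-periodic (respectively $4\pi$-periodic) in each variable and with values in $*$ for real $\theta$; $|F|_h$ is the supremum of $\|F(\theta)\|$ over the strip and $\|F\|_0$ the supremum over real $\theta$, where $\|\cdot\|$ is the Euclidean operator norm. Let $M=\frac1{1+i}\begin{pmatrix}1&-i\\1&i\end{pmatrix}$.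 *Statement.* For every $0<\sigma<\frac16$ there are real numbers $D>\frac2\sigma$ and $\tilde D$, depending only on $\sigma$, and for all $d\ge1$, $\kappa>0$, $\tau>d$ there is $c>0$, depending only on $\kappa,\tau,d,\sigma$, such that the following holds. Let $\alpha\in\mathrm{DC}_d(\kappa,\tau)$, $0<r'<r$, $A\in SL(2,\mathbb R)$ with eigenvalues $e^{i\rho},e^{-i\rho}$ ($\rho\in\mathbb C$), and $f\in C^\omega_r(\mathbb T^d,sl(2,\mathbb R))$, and let $0<\varepsilon<1$ satisfy $$|f|_r\le\varepsilon\le\frac{c}{\|A\|^{\tilde D}}(r-r')^{D\tau}.$$ Then there exist $B\in C^\omega_{r'}(2\mathbb T^d,SL(2,\mathbb R))$, $A_+\in SL(2,\mathbb R)$ and $f_+\in C^\omega_{r'}(\mathbb T^d,sl(2,\mathbb R))$ such that, on the strip of width $r'$, $$B(\theta+\alpha)\,(Ae^{f(\theta)})\,B(\theta)^{-1}=A_+e^{f_+(\theta)}.$$ Moreover, with $N=\frac{2}{r-r'}|\ln\varepsilon|$: * (Non-resonant case) If $\|2\rho-\langle m,\alpha\rangle\|_*\ge\varepsilon^\sigma$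 for all $m\in\mathbb Z^d$ with $0<|m|\le N$, then $|B-\mathrm{Id}|_{r'}\le\varepsilon^{1-8/D}$, $|f_+|_{r'}\le\varepsilon^{2-8/D}$ and $\|A_+-A\|\le2\|A\|\varepsilon$. * (Resonant case) If $m_*\in\mathbb Z^d$ satisfies $0<|m_*|\le N$ and $\|2\rho-\langle m_*,\alpha\rangle\|_*<\varepsilon^\sigma$, then $$|B|_{r'}\le8\Big(\frac{\|A\|}{\kappa}\Big)^{\frac12}\Big(\frac{2}{r-r'}|\ln\varepsilon|\Big)^{\frac\tau2}\varepsilon^{\frac{-r'}{r-r'}},\qquad \|B\|_0\le8\Big(\frac{\|A\|}{\kappa}\Big)^{\frac12}\Big(\frac{2}{r-r'}|\ln\varepsilon|\Big)^{\frac\tau2},$$ and there is $N'>2N^2$ such that $$|f_+|_{r'}\le E:=\frac{2^{5+\tau}\|A\||\ln\varepsilon|^\tau}{\kappa(r-r')^\tau}\,\varepsilon\, e^{-N'(r-r')}(N')^d e^{Nr'},$$ where $E<\varepsilon^{100}$ provided that $r'\le\max\{1,|\ln\varepsilon|\}$. Moreover $A_+=(-1)^j e^{A''}$, where $j\in\mathbb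 Z$ satisfies $|2\rho-\langle m_*,\alpha\rangle-2\pi j|<\varepsilon^\sigma$, $A''\in sl(2,\mathbb R)$, $\|A''\|\le2\varepsilon^\sigma$, and $$MA''M^{-1}=\begin{pmatrix}it&v\\\bar v&-it\end{pmatrix},\quad t\in\mathbb R,\ v\in\mathbb C,\quad |t|\le\varepsilon^\sigma,\quad |v|\le\frac{2^{4+\tau}\|A\||\ln\varepsilon|^\tau}{\kappa(r-r')^\tau}\,\varepsilon\, e^{-|m_*|r}.$$ -/

import Mathlib

open scoped Matrix.Norms.L2Operator

noncomputable section

/-- Real and complex `2 × 2` matrices. Both carry the operator norm of the Euclidean norm on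
`ℝ²`, respectively `ℂ²` (the scoped instance opened above). -/
abbrev RMat : Type := Matrix (Fin 2) (Fin 2) ℝ

abbrev CMat : Type := Matrix (Fin 2) (Fin 2) ℂ

/-- A real matrix seen as a complex one. -/
def RMat.toC (X : RMat) : CMat := X.map (fun x : ℝ => (x : ℂ))

/-- The group `SL(2,ℝ)` as a set of matrices. -/
def SL2R : Set RMat := {X | X.det = 1}

/-- The Lie algebra `sl(2,ℝ)` as a set of matrices. -/
def sl2R : Set RMat := {X | X.trace = 0}

/-- A real point seen as a point of `ℂ^d`. -/
def toCd {d : ℕ} (θ : Fin d → ℝ) : Fin d → ℂ := fun i => (θ i : ℂ)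

/-- The strip `{θ ∈ ℂ^d : |Im θ_i| < h for all i}`. -/
def strip (d : ℕ) (h : ℝ) : Set (Fin d → ℂ) := {θ | ∀ i, |(θ i).im| < h}

/-- `F` is a bounded analytic function on the strip of width `h` that is `L`-periodic in each
variable and takes values in the set `S` of real matrices at real points: this is the space
`C^ω_h(ℝ^d / (L ℤ)^d, S)`. The values of `F` outside the strip play no role. -/
structure IsStripAnalytic {d : ℕ} (h L : ℝ) (S : Set RMat) (F : (Fin d → ℂ) → CMat) : Prop where
  analytic : AnalyticOnNhd ℂ F (strip d h)
  bounded : ∃ K : ℝ, ∀ θ ∈ strip d h, ‖F θ‖ ≤ K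
  periodic : ∀ θ ∈ strip d h, ∀ n : Fin d → ℤ, F (fun i => θ i + (n i : ℂ) * (L : ℂ)) = F θ
  real_valued : ∀ θ : Fin d → ℝ, ∃ X ∈ S, F (toCd θ) = X.toC

/-- The norm `|F|_h`, the supremum of `‖F θ‖` over the strip of width `h`. -/
def stripNorm {d : ℕ} (h : ℝ) (F : (Fin d → ℂ) → CMat) : ℝ :=
  ⨆ θ : strip d h, ‖F θ.1‖

/-- The norm `‖F‖_0`, the supremum of `‖F θ‖` over the real points. -/
def realNorm {d : ℕ} (F : (Fin d → ℂ) → CMat) : ℝ :=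
  ⨆ θ : Fin d → ℝ, ‖F (toCd θ)‖

/-- `|m| = |m_1| + ⋯ + |m_d|`. -/
def l1 {d : ℕ} (m : Fin d → ℤ) : ℝ := ∑ i, |(m i : ℝ)|

/-- `⟨m, α⟩ = m_1 α_1 + ⋯ + m_d α_d`. -/
def pairing {d : ℕ} (m : Fin d → ℤ) (α : Fin d → ℝ) : ℝ := ∑ i, (m i : ℝ) * α i

/-- The distance of a complex number to `2πℤ`. -/
def distTwoPi (x : ℂ) : ℝ := ⨅ j : ℤ, ‖x - 2 * (Real.pi : ℂ) * (j : ℂ)‖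

/-- The Diophantine condition `DC_d(κ, τ)` for frequencies on `ℝ^d / (2πℤ)^d`. -/
def IsDC {d : ℕ} (κ τ : ℝ) (α : Fin d → ℝ) : Prop :=
  ∀ m : Fin d → ℤ, m ≠ 0 → κ / l1 m ^ τ < distTwoPi (pairing m α : ℂ)

/-- The spectrum of `A`, with multiplicity, is `{e^{iρ}, e^{-iρ}}`. -/
def HasEigenvaluePair (A : RMat) (ρ : ℂ) : Prop :=
  A.toC.charpoly.roots = {Complex.exp (Complex.I * ρ), Complex.exp (-(Complex.I * ρ))}

/-- The order of truncation `N = 2 |ln ε| / (r - r')`. -/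
def truncN (r r' ε : ℝ) : ℝ := 2 / (r - r') * |Real.log ε|

/-- The matrix that conjugates `sl(2,ℝ)` to `su(1,1)`. -/
def cayleyM : CMat := (1 / (1 + Complex.I)) • !![1, -Complex.I; 1, Complex.I]

/-- The bound for the new perturbation `f₊` in the resonant case, with `a = ‖A‖`. -/
def resonantBound (d : ℕ) (κ τ r r' ε a N' : ℝ) : ℝ :=
  2 ^ (5 + τ) * a * |Real.log ε| ^ τ / (κ * (r - r') ^ τ) * ε *
    Real.exp (-(N' * (r - r'))) * N' ^ d * Real.exp (truncN r r' ε * r')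

end

/-! Take B = e^Y with Y trace-free. Then e^{Y(θ+α)} A e^f e^{-Y} = A · e^{LY(θ+α)} e^f e^{-Y}, where
L is conjugation X ↦ A⁻¹XA. To first order the last product is 1 + LY(θ+α) − Y + f, so the n-th
Fourier mode of Y is governed by zL − 1 with z = e^{i⟨n,α⟩}. On trace-free matrices its eigenvalues
are z − 1 and z e^{±2iρ} − 1. The Diophantine condition controls the first one, and the distances of
2ρ ± ⟨n,α⟩ to 2πℤ control the other two.

No Newton iteration is needed. `exists_elimination` solves the full nonlinear equation for finitely
many modes at once, by a contraction on Fourier coefficients weighted by e^{-|n|r}. Afterwards the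
removable part of the low modes is exactly absent, and what is left beyond the kept terms is a
Fourier tail on the smaller strip, exponentially small in (order)·(r − r'). Only trace-free parts
have to be treated: the determinant is 1, so the trace follows, and `exists_splitting` factors a
unimodular H whose trace-free part is close to c as (u + c)e^φ with φ small.

Non-resonant case (`nonresonant_step`): all modes 0 < |n| ≤ N are removed. The inverse of zL − 1 is
a polynomial in L divided by the value of a cubic (`adSolve`), so A need not be diagonalised and may
be parabolic. The surviving mean C gives A₊ = A(u + C).

Resonant case (`resonant_step`): a resonance forces ρ to be real and sin ρ to be bounded below, so A
is conjugate to a rotation by a P with ‖P‖² of order ‖A‖N^τ/κ (`exists_elliptic_normal_form`). In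
the Cayley coordinates the divisors decouple. By the Diophantine condition the resonance is isolated
even among modes of size 200N², so everything up to that order is removed except mode 0 on the
diagonal and modes ±m off it (`exists_resonant_normal_form`). Rotating by −⟨m,θ⟩/2 makes these terms
constant and changes the angle ρ to ρ − ⟨m,α⟩/2, which is close to πj (`resonant_conjugation`). A
logarithm of ±A₊ is then small, and its off-diagonal entry inherits the factor e^{-|m|r} of the
Fourier coefficient.

All smallness conditions are measured by the single scale X = ε^{-σ/100}. The hypothesis on ε makes
‖A‖, N^τ and (r − r')^{-τ} bounded by fixed powers of X (`exists_threshold`), and σ < 1/6 gives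
εX^600 ≤ 1. When N < 1 no mode is to be removed: the strip loss is then large, and extracting the
mean of f is enough (`wide_step`). -/

/-! ### Operator norm, complex conjugation and adjugates of 2 × 2 matrices. -/

section MatrixBasics

/-- The squared Euclidean operator norm bound, in coordinates. -/
theorem l2_bound_apply {𝕜 : Type*} [RCLike 𝕜] (X : Matrix (Fin 2) (Fin 2) 𝕜) (a b : 𝕜) :
    ‖X 0 0 * a + X 0 1 * b‖ ^ 2 + ‖X 1 0 * a + X 1 1 * b‖ ^ 2 ≤
      ‖X‖ ^ 2 * (‖a‖ ^ 2 + ‖b‖ ^ 2) := by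
  have h := Matrix.l2_opNorm_mulVec X (!₂[a, b] : EuclideanSpace 𝕜 (Fin 2))
  have h2 := pow_le_pow_left₀ (norm_nonneg _) h 2
  rw [mul_pow, EuclideanSpace.norm_sq_eq, EuclideanSpace.norm_sq_eq] at h2
  simpa [Fin.sum_univ_two, Matrix.mulVec, dotProduct] using h2

theorem l2_norm_le_of_apply {𝕜 : Type*} [RCLike 𝕜] (X : Matrix (Fin 2) (Fin 2) 𝕜) {c : ℝ}
    (hc : 0 ≤ c)
    (h : ∀ a b : 𝕜, ‖X 0 0 * a + X 0 1 * b‖ ^ 2 + ‖X 1 0 * a + X 1 1 * b‖ ^ 2 ≤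
      c ^ 2 * (‖a‖ ^ 2 + ‖b‖ ^ 2)) : ‖X‖ ≤ c := by
  rw [Matrix.cstar_norm_def]
  refine ContinuousLinearMap.opNorm_le_bound _ hc fun v => ?_
  refine le_of_sq_le_sq ?_ (by positivity)
  rw [mul_pow, EuclideanSpace.norm_sq_eq, EuclideanSpace.norm_sq_eq]
  simpa [Fin.sum_univ_two, Matrix.mulVec, dotProduct] using h (v 0) (v 1)

theorem norm_entry_le {𝕜 : Type*} [RCLike 𝕜] (X : Matrix (Fin 2) (Fin 2) 𝕜) (i j : Fin 2) :
    ‖X i j‖ ≤ ‖X‖ := by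
  have h0 := l2_bound_apply X 1 0
  have h1 := l2_bound_apply X 0 1
  simp at h0 h1
  refine le_of_sq_le_sq ?_ (norm_nonneg _)
  fin_cases i <;> fin_cases j <;> simp <;>
  nlinarith [sq_nonneg ‖X 0 0‖, sq_nonneg ‖X 0 1‖, sq_nonneg ‖X 1 0‖, sq_nonneg ‖X 1 1‖]

theorem norm_single_le {𝕜 : Type*} [RCLike 𝕜] (i j : Fin 2) (c : 𝕜) :
    ‖(Matrix.single i j c : Matrix (Fin 2) (Fin 2) 𝕜)‖ ≤ ‖c‖ := by
  refine l2_norm_le_of_apply _ (norm_nonneg _) fun a b => ?_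
  fin_cases i <;> fin_cases j <;> simp [Matrix.single, mul_pow] <;>
  nlinarith [mul_nonneg (sq_nonneg ‖c‖) (sq_nonneg ‖a‖), mul_nonneg (sq_nonneg ‖c‖) (sq_nonneg ‖b‖)]

theorem norm_le_sum_entries {𝕜 : Type*} [RCLike 𝕜] (X : Matrix (Fin 2) (Fin 2) 𝕜) :
    ‖X‖ ≤ ‖X 0 0‖ + ‖X 0 1‖ + ‖X 1 0‖ + ‖X 1 1‖ := by
  have h : X = Matrix.single 0 0 (X 0 0) + Matrix.single 0 1 (X 0 1) + Matrix.single 1 0 (X 1 0)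
      + (Matrix.single 1 1 (X 1 1) : Matrix (Fin 2) (Fin 2) 𝕜) := by
    ext i j; fin_cases i <;> fin_cases j <;> simp [Matrix.single]
  have h1 : ‖X‖ ≤ ‖(Matrix.single 0 0 (X 0 0) : Matrix (Fin 2) (Fin 2) 𝕜)‖ +
      ‖(Matrix.single 0 1 (X 0 1) : Matrix (Fin 2) (Fin 2) 𝕜)‖ +
      ‖(Matrix.single 1 0 (X 1 0) : Matrix (Fin 2) (Fin 2) 𝕜)‖ +
      ‖(Matrix.single 1 1 (X 1 1) : Matrix (Fin 2) (Fin 2) 𝕜)‖ := by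
    conv_lhs => rw [h]
    exact norm_add₄_le
  have := norm_single_le 0 0 (X 0 0)
  have := norm_single_le 0 1 (X 0 1)
  have := norm_single_le 1 0 (X 1 0)
  have := norm_single_le 1 1 (X 1 1)
  linarith

/-- Entrywise complex conjugation. -/
def cj : CMat →+* CMat := (starRingEnd ℂ).mapMatrix

theorem cj_apply (X : CMat) (i j : Fin 2) : cj X i j = starRingEnd ℂ (X i j) := rfl

theorem cj_cj (X : CMat) : cj (cj X) = X := by
  ext i j; simp [cj_apply]

theorem cj_smul (c : ℂ) (X : CMat) : cj (c • X) = starRingEnd ℂ c • cj X := by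
  ext i j; simp [cj_apply]

theorem cj_smul_real (c : ℝ) (X : CMat) : cj (c • X) = c • cj X := by
  ext i j; simp [cj_apply]

theorem norm_cj_le (X : CMat) : ‖cj X‖ ≤ ‖X‖ := by
  refine l2_norm_le_of_apply _ (norm_nonneg _) fun a b => ?_
  have h := l2_bound_apply X (starRingEnd ℂ a) (starRingEnd ℂ b)
  have e : ∀ u v : ℂ, ‖starRingEnd ℂ u * a + starRingEnd ℂ v * b‖ =
      ‖u * starRingEnd ℂ a + v * starRingEnd ℂ b‖ := by
    intro u v
    rw [← Complex.norm_conj]; simp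
  simpa [cj_apply, e] using h

theorem norm_cj (X : CMat) : ‖cj X‖ = ‖X‖ :=
  le_antisymm (norm_cj_le X) (by simpa [cj_cj] using norm_cj_le (cj X))

theorem continuous_cj : Continuous cj := by
  have : LipschitzWith 1 cj := LipschitzWith.of_dist_le_mul fun x y => by
    rw [dist_eq_norm, dist_eq_norm, ← map_sub, norm_cj]; simp
  exact this.continuous

theorem toC_apply (X : RMat) (i j : Fin 2) : X.toC i j = (X i j : ℂ) := rfl

theorem toC_eq (X : RMat) : X.toC = (Complex.ofRealHom).mapMatrix X := rfl

theorem toC_mul (X Y : RMat) : RMat.toC (X * Y) = X.toC * Y.toC := by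
  simp only [toC_eq, map_mul]

theorem toC_add (X Y : RMat) : RMat.toC (X + Y) = X.toC + Y.toC := by
  simp only [toC_eq, map_add]

theorem toC_sub (X Y : RMat) : RMat.toC (X - Y) = X.toC - Y.toC := by
  simp only [toC_eq, map_sub]

theorem toC_one : RMat.toC 1 = 1 := by simp only [toC_eq, map_one]

theorem toC_smul (c : ℝ) (X : RMat) : RMat.toC (c • X) = (c : ℂ) • X.toC := by
  ext i j; simp [toC_apply]

theorem toC_injective : Function.Injective RMat.toC := fun X Y h => by
  ext i j
  have := congrFun (congrFun h i) j
  simpa [toC_apply] using this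

theorem det_toC (X : RMat) : X.toC.det = (X.det : ℂ) := by
  rw [toC_eq, ← RingHom.map_det]; rfl

theorem trace_toC (X : RMat) : X.toC.trace = (X.trace : ℂ) := by
  simp [Matrix.trace, toC_apply]

theorem cj_toC (X : RMat) : cj X.toC = X.toC := by
  ext i j; simp [cj_apply, toC_apply]

/-- A matrix fixed by conjugation is real. -/
theorem exists_toC_of_cj {X : CMat} (h : cj X = X) : ∃ Y : RMat, X = Y.toC := by
  refine ⟨X.map Complex.re, ?_⟩
  ext i j
  have := congrFun (congrFun h i) j
  rw [cj_apply] at this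
  simpa [toC_apply] using (Complex.conj_eq_iff_re.1 this).symm

/-- A real matrix acts separately on real and imaginary parts, whose squared norms add; so
complexifying does not change the operator norm. -/
theorem norm_toC (X : RMat) : ‖X.toC‖ = ‖X‖ := by
  apply le_antisymm
  · refine l2_norm_le_of_apply _ (norm_nonneg _) fun a b => ?_
    have h1 := l2_bound_apply X a.re b.re
    have h2 := l2_bound_apply X a.im b.im
    simp only [toC_apply, Complex.sq_norm, Complex.normSq_apply]
    simp only [Real.norm_eq_abs, sq_abs] at h1 h2
    simp
    nlinarith
  · refine l2_norm_le_of_apply _ (norm_nonneg _) fun a b => ?_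
    have h1 := l2_bound_apply X.toC a b
    simp only [toC_apply, ← Complex.ofReal_mul, ← Complex.ofReal_add, Complex.norm_real] at h1
    exact h1

/-- The rotation by a right angle. -/
def rotJ : CMat := !![0, 1; -1, 0]

theorem norm_rotJ_le : ‖rotJ‖ ≤ 1 := by
  refine l2_norm_le_of_apply _ zero_le_one fun a b => ?_
  simp [rotJ, add_comm]

theorem norm_transpose (X : CMat) : ‖X.transpose‖ = ‖X‖ := by
  have : X.transpose = cj (X.conjTranspose) := by
    ext i j; simp [cj_apply]
  rw [this, norm_cj, Matrix.l2_opNorm_conjTranspose]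

/-- In dimension two the adjugate is a transpose conjugated by an isometry. This makes inversion in
SL(2) norm-nonincreasing and lets the adjugate pass through the exponential. -/
theorem adjugate_eq_conj (X : CMat) : X.adjugate = rotJ * X.transpose * (-rotJ) := by
  rw [Matrix.adjugate_fin_two]
  ext i j; fin_cases i <;> fin_cases j <;> simp [rotJ, Matrix.mul_apply, Matrix.vecMul, dotProduct, Fin.sum_univ_two]

theorem norm_adjugate_le (X : CMat) : ‖X.adjugate‖ ≤ ‖X‖ := by
  rw [adjugate_eq_conj]
  calc _ ≤ ‖rotJ‖ * ‖X.transpose‖ * ‖-rotJ‖ :=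
        (norm_mul_le _ _).trans (mul_le_mul_of_nonneg_right (norm_mul_le _ _) (norm_nonneg _))
    _ ≤ 1 * ‖X‖ * 1 := by
        rw [norm_transpose, norm_neg]
        have := norm_rotJ_le
        gcongr
    _ = _ := by ring

theorem inv_eq_adjugate {X : CMat} (h : X.det = 1) : X⁻¹ = X.adjugate := by
  rw [Matrix.inv_def, h]; simp

theorem norm_inv_le_of_det {X : CMat} (h : X.det = 1) : ‖X⁻¹‖ ≤ ‖X‖ := by
  rw [inv_eq_adjugate h]; exact norm_adjugate_le X

theorem isUnit_det_of_det {X : CMat} (h : X.det = 1) : IsUnit X.det := by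
  rw [h]; exact isUnit_one

theorem one_le_norm_of_det {X : CMat} (h : X.det = 1) : 1 ≤ ‖X‖ := by
  have h1 : X * X⁻¹ = 1 := Matrix.mul_nonsing_inv _ (isUnit_det_of_det h)
  have h2 : ‖(1 : CMat)‖ = 1 := norm_one
  have h3 := norm_mul_le X X⁻¹
  rw [h1, h2] at h3
  have := norm_inv_le_of_det h
  nlinarith [norm_nonneg X]

theorem norm_trace_le (X : CMat) : ‖X.trace‖ ≤ 2 * ‖X‖ := by
  rw [Matrix.trace_fin_two]
  have := norm_entry_le X 0 0
  have := norm_entry_le X 1 1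
  linarith [norm_add_le (X 0 0) (X 1 1)]

theorem adjugate_of_trace_zero {X : CMat} (h : X.trace = 0) : X.adjugate = -X := by
  rw [Matrix.trace_fin_two] at h
  rw [Matrix.adjugate_fin_two]
  ext i j; fin_cases i <;> fin_cases j <;> simp <;> linear_combination h

end MatrixBasics

/-! ### Determinant and reality of the matrix exponential. -/

section Exponential

open NormedSpace

theorem exp_adjugate (X : CMat) : exp X.adjugate = (exp X).adjugate := by
  have hJ : (-rotJ) * rotJ = 1 := by
    ext i j; fin_cases i <;> fin_cases j <;> simp [rotJ, Matrix.mul_apply]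
  have hJ' : (rotJ)⁻¹ = -rotJ := Matrix.inv_eq_left_inv hJ
  have hU : IsUnit rotJ := by
    rw [Matrix.isUnit_iff_isUnit_det]; simp [rotJ, Matrix.det_fin_two]
  rw [adjugate_eq_conj, adjugate_eq_conj, ← hJ', Matrix.exp_conj _ _ hU, Matrix.exp_transpose]

/-- For trace-free X the adjugate is −X, so the adjugate of e^X is e^{-X} and the product e^X ·
adj(e^X) = det(e^X)·1 equals 1. -/
theorem det_exp_of_trace_zero {X : CMat} (h : X.trace = 0) : (exp X).det = 1 := by
  have h1 : exp X * (exp X).adjugate = 1 := by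
    rw [← exp_adjugate, adjugate_of_trace_zero h, Matrix.exp_neg]
    exact Matrix.mul_nonsing_inv _ ((Matrix.isUnit_iff_isUnit_det _).1 (Matrix.isUnit_exp X))
  rw [Matrix.mul_adjugate] at h1
  simpa using congrFun (congrFun h1 0) 0

theorem exp_smul_one (c : ℂ) : exp (c • (1 : CMat)) = Complex.exp c • 1 := by
  have := algebraMap_exp_comm (𝕂 := ℂ) (𝔸 := CMat) c
  rw [Algebra.algebraMap_eq_smul_one, Algebra.algebraMap_eq_smul_one] at this
  rw [← this, Complex.exp_eq_exp_ℂ]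

theorem det_exp_eq (X : CMat) : (exp X).det = Complex.exp X.trace := by
  have hX : X = (X.trace / 2) • (1 : CMat) + (X - (X.trace / 2) • (1 : CMat)) := by abel
  have htr : (X - (X.trace / 2) • (1 : CMat)).trace = 0 := by
    simp [Matrix.trace_sub, Matrix.trace_smul]
  have hc : Commute ((X.trace / 2) • (1 : CMat)) (X - (X.trace / 2) • (1 : CMat)) :=
    (Commute.one_left _).smul_left _
  rw [hX, Matrix.exp_add_of_commute _ _ hc, Matrix.det_mul, det_exp_of_trace_zero htr, ← hX,
    exp_smul_one, Matrix.det_smul, Matrix.det_one]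
  simp [← Complex.exp_nat_mul]
  ring_nf

theorem cj_exp (X : CMat) : cj (exp X) = exp (cj X) :=
  letI : NormedAlgebra ℚ CMat := NormedAlgebra.restrictScalars ℚ ℂ CMat
  map_exp cj continuous_cj X

theorem toC_exp (X : RMat) : RMat.toC (exp X) = exp X.toC :=
  letI : NormedAlgebra ℚ CMat := NormedAlgebra.restrictScalars ℚ ℂ CMat
  letI : NormedAlgebra ℚ RMat := NormedAlgebra.restrictScalars ℚ ℝ RMat
  map_exp (Complex.ofRealHom.mapMatrix (m := Fin 2)) (by
    have : LipschitzWith 1 (Complex.ofRealHom.mapMatrix (m := Fin 2)) :=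
      LipschitzWith.of_dist_le_mul fun x y => by
        rw [dist_eq_norm, dist_eq_norm, ← map_sub, ← toC_eq, norm_toC]; simp
    exact this.continuous) X

end Exponential

/-! ### Lipschitz estimates for the exponential and a local logarithm. -/

section ExpEstimates

open NormedSpace

theorem hasSum_real_exp (R : ℝ) : HasSum (fun n : ℕ => R ^ n / n.factorial) (Real.exp R) := by
  rw [Real.exp_eq_exp_ℝ]; exact expSeries_div_hasSum_exp R

theorem norm_pow_sub_pow_le {E : Type*} [NormedRing E] {x y : E} {R : ℝ} (hx : ‖x‖ ≤ R) (hy : ‖y‖ ≤ R) (n : ℕ) :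
    ‖x ^ (n + 1) - y ^ (n + 1)‖ ≤ (n + 1) * R ^ n * ‖x - y‖ := by
  have hR : 0 ≤ R := (norm_nonneg x).trans hx
  induction n with
  | zero => simp
  | succ n ih =>
    have e : x ^ (n + 1 + 1) - y ^ (n + 1 + 1) =
        x * (x ^ (n + 1) - y ^ (n + 1)) + (x - y) * y ^ (n + 1) := by
      rw [pow_succ' x (n + 1), pow_succ' y (n + 1)]; noncomm_ring
    rw [e]
    have h1 : ‖y ^ (n + 1)‖ ≤ R ^ (n + 1) :=
      (norm_pow_le' y n.succ_pos).trans (pow_le_pow_left₀ (norm_nonneg _) hy _)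
    calc _ ≤ ‖x‖ * ‖x ^ (n + 1) - y ^ (n + 1)‖ + ‖x - y‖ * ‖y ^ (n + 1)‖ :=
          (norm_add_le _ _).trans (add_le_add (norm_mul_le _ _) (norm_mul_le _ _))
      _ ≤ R * ((n + 1) * R ^ n * ‖x - y‖) + ‖x - y‖ * R ^ (n + 1) := by gcongr
      _ = _ := by push_cast; ring

variable {E : Type*} [NormedRing E] [NormedAlgebra ℂ E] [CompleteSpace E]

/-- The exponential differs from the identity by a map of small Lipschitz constant. -/
theorem norm_exp_sub_exp_sub_le {x y : E} {R : ℝ} (hx : ‖x‖ ≤ R) (hy : ‖y‖ ≤ R) :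
    ‖exp x - exp y - (x - y)‖ ≤ (Real.exp R - 1) * ‖x - y‖ := by
  have hR : 0 ≤ R := (norm_nonneg x).trans hx
  have hs : HasSum (fun n : ℕ => ((n.factorial : ℂ)⁻¹) • (x ^ n - y ^ n)) (exp x - exp y) := by
    simpa only [smul_sub] using (exp_series_hasSum_exp' (𝕂 := ℂ) x).sub
      (exp_series_hasSum_exp' (𝕂 := ℂ) y)
  -- The term of order 0 cancels and the term of order 1 is x − y, which is subtracted on the left;
  -- the remaining terms are compared with the series of e^R − 1.
  have hs2 := (hasSum_nat_add_iff' 2).2 hs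
  simp [Finset.sum_range_succ] at hs2
  have hr := (hasSum_nat_add_iff' 1).2 (hasSum_real_exp R)
  simp at hr
  rw [← hs2.tsum_eq]
  refine tsum_of_norm_bounded (hr.mul_right ‖x - y‖) fun n => ?_
  rw [norm_smul]
  have := norm_pow_sub_pow_le hx hy (n + 1)
  calc _ ≤ ‖(((n + 2).factorial : ℂ)⁻¹)‖ * ((n + 1 + 1) * R ^ (n + 1) * ‖x - y‖) := by
        refine mul_le_mul_of_nonneg_left ?_ (norm_nonneg _); exact_mod_cast this
    _ = _ := by
        rw [norm_inv, Complex.norm_natCast, Nat.factorial_succ (n + 1)]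
        push_cast
        field_simp

theorem norm_exp_sub_one_le (x : E) : ‖exp x - 1‖ ≤ Real.exp ‖x‖ - 1 := by
  have hs := (hasSum_nat_add_iff' 1).2 (exp_series_hasSum_exp' (𝕂 := ℂ) x)
  simp at hs
  have hr := (hasSum_nat_add_iff' 1).2 (hasSum_real_exp ‖x‖)
  simp at hr
  rw [← hs.tsum_eq]
  refine tsum_of_norm_bounded hr fun n => ?_
  rw [norm_smul, norm_inv, Complex.norm_natCast, div_eq_inv_mul]
  gcongr
  exact norm_pow_le' _ n.succ_pos

theorem norm_exp_sub_one_sub_le (x : E) :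
    ‖exp x - 1 - x‖ ≤ (Real.exp ‖x‖ - 1) * ‖x‖ := by
  simpa using norm_exp_sub_exp_sub_le (x := x) (y := 0) le_rfl (by simp)

theorem norm_exp_sub_exp_le {x y : E} {R : ℝ} (hx : ‖x‖ ≤ R) (hy : ‖y‖ ≤ R) :
    ‖exp x - exp y‖ ≤ Real.exp R * ‖x - y‖ := by
  have h := norm_exp_sub_exp_sub_le hx hy
  calc ‖exp x - exp y‖ = ‖(exp x - exp y - (x - y)) + (x - y)‖ := by rw [sub_add_cancel]
    _ ≤ _ := norm_add_le _ _
    _ ≤ _ := by linarith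

theorem norm_exp_le' [NormOneClass E] (x : E) : ‖exp x‖ ≤ Real.exp ‖x‖ := by
  have h := norm_exp_sub_one_le x
  calc ‖exp x‖ = ‖(exp x - 1) + 1‖ := by rw [sub_add_cancel]
    _ ≤ ‖exp x - 1‖ + ‖(1 : E)‖ := norm_add_le _ _
    _ ≤ _ := by rw [norm_one]; linarith

theorem real_exp_sub_one_le {x : ℝ} (h0 : 0 ≤ x) (h1 : x ≤ 1) : Real.exp x - 1 ≤ 2 * x := by
  have := Real.abs_exp_sub_one_le (x := x) (by rw [abs_of_nonneg h0]; exact h1)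
  rw [abs_of_nonneg h0] at this
  exact (le_abs_self _).trans this

/-- On the ball of radius 1/4 the exponential is the identity plus a map of Lipschitz constant at
most 1/2. Injectivity is used to show that logarithms of real matrices are real. -/
theorem exp_injOn_small {x y : E} (hx : ‖x‖ ≤ 1 / 4) (hy : ‖y‖ ≤ 1 / 4) (h : exp x = exp y) :
    x = y := by
  have h1 := norm_exp_sub_exp_sub_le hx hy
  rw [h, sub_self, zero_sub, norm_neg] at h1
  have h2 := real_exp_sub_one_le (x := 1 / 4) (by norm_num) (by norm_num)
  have h3 : ‖x - y‖ ≤ 0 := by nlinarith [norm_nonneg (x - y)]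
  exact sub_eq_zero.1 (norm_le_zero_iff.1 h3)

/-- A local logarithm, analytic near `1`. -/
theorem exists_local_log (E : Type*) [NormedRing E] [NormedAlgebra ℂ E] [CompleteSpace E] :
    ∃ δ : ℝ, 0 < δ ∧ δ ≤ 1 / 8 ∧ ∃ ℓ : E → E, AnalyticOnNhd ℂ ℓ (Metric.ball 1 δ) ∧
      ∀ G ∈ Metric.ball (1 : E) δ, exp (ℓ G) = G ∧ ‖ℓ G‖ ≤ 2 * ‖G - 1‖ := by
  have hd : HasStrictFDerivAt (exp : E → E) ((ContinuousLinearEquiv.refl ℂ E : E ≃L[ℂ] E) : E →L[ℂ] E) 0 :=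
    hasStrictFDerivAt_exp_zero (𝕂 := ℂ)
  set e := hd.toOpenPartialHomeomorph exp with he
  have hcoe : (e : E → E) = exp := hd.toOpenPartialHomeomorph_coe
  have h0 : (0 : E) ∈ e.source := hd.mem_toOpenPartialHomeomorph_source
  have h1 : (1 : E) ∈ e.target := by
    have := hd.image_mem_toOpenPartialHomeomorph_target
    simpa using this
  have hs1 : e.symm 1 = 0 := by
    have := e.left_inv h0
    rw [hcoe] at this
    simpa using this
  have han : AnalyticAt ℂ e.symm 1 := by
    refine e.analyticAt_symm (i := ContinuousLinearEquiv.refl ℂ E) h1 ?_ ?_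
    · rw [hcoe]; exact exp_analytic _
    · rw [hcoe, hs1]; exact hd.hasFDerivAt.fderiv
  have hcont : ContinuousAt e.symm 1 := han.continuousAt
  have hev1 : ∀ᶠ G in nhds (1 : E), AnalyticAt ℂ e.symm G := han.eventually_analyticAt
  have hev2 : ∀ᶠ G in nhds (1 : E), G ∈ e.target := e.open_target.mem_nhds h1
  have hev3 : ∀ᶠ G in nhds (1 : E), ‖e.symm G‖ < 1 / 4 := by
    have : Filter.Tendsto (fun G => ‖e.symm G‖) (nhds 1) (nhds 0) := by
      have := hcont.norm
      rw [ContinuousAt, hs1, norm_zero] at this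
      exact this
    exact this.eventually (gt_mem_nhds (by norm_num))
  obtain ⟨δ, hδ, hball⟩ := Metric.eventually_nhds_iff_ball.1 (hev1.and (hev2.and hev3))
  refine ⟨min δ (1 / 8), by positivity, min_le_right _ _, e.symm, ?_, ?_⟩
  · intro G hG
    exact (hball G (Metric.ball_subset_ball (min_le_left _ _) hG)).1
  · intro G hG
    obtain ⟨-, h2, h3⟩ := hball G (Metric.ball_subset_ball (min_le_left _ _) hG)
    have hr := e.right_inv h2
    rw [hcoe] at hr
    refine ⟨hr, ?_⟩
    -- With l = ℓ G and ‖l‖ < 1/4, the error e^l − 1 − l is at most 2‖l‖² ≤ ‖l‖/2, which is absorbed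
    -- to give the factor 2.
    have h4 := norm_exp_sub_one_sub_le (e.symm G)
    rw [hr] at h4
    have h5 := real_exp_sub_one_le (norm_nonneg (e.symm G)) (by linarith)
    have h6 : ‖e.symm G‖ ≤ ‖G - 1‖ + ‖G - 1 - e.symm G‖ := by
      calc ‖e.symm G‖ = ‖(G - 1) - (G - 1 - e.symm G)‖ := by rw [sub_sub_cancel]
        _ ≤ _ := norm_sub_le _ _
    nlinarith [norm_nonneg (e.symm G)]

end ExpEstimates

/-! ### Characters e^{i⟨n,θ⟩} and the geometry of strips. -/

section Characters

variable {d : ℕ}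

/-- The character `θ ↦ e^{i⟨n, θ⟩}`. -/
noncomputable def expo (n : Fin d → ℤ) (θ : Fin d → ℂ) : ℂ :=
  Complex.exp (Complex.I * ∑ i, (n i : ℂ) * θ i)

theorem expo_add_right (n : Fin d → ℤ) (θ η : Fin d → ℂ) :
    expo n (θ + η) = expo n θ * expo n η := by
  simp only [expo, ← Complex.exp_add, Pi.add_apply, mul_add, Finset.sum_add_distrib]

theorem expo_add_left (m n : Fin d → ℤ) (θ : Fin d → ℂ) :
    expo (m + n) θ = expo m θ * expo n θ := by
  simp only [expo, ← Complex.exp_add, Pi.add_apply, ← mul_add, ← Finset.sum_add_distrib]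
  congr 2
  refine Finset.sum_congr rfl fun i _ => ?_
  push_cast; ring

theorem expo_zero_left (θ : Fin d → ℂ) : expo 0 θ = 1 := by simp [expo]

theorem expo_zero_right (n : Fin d → ℤ) : expo n 0 = 1 := by simp [expo]

theorem expo_neg_mul (n : Fin d → ℤ) (θ : Fin d → ℂ) : expo (-n) θ * expo n θ = 1 := by
  rw [← expo_add_left, neg_add_cancel, expo_zero_left]

theorem norm_expo (n : Fin d → ℤ) (θ : Fin d → ℂ) :
    ‖expo n θ‖ = Real.exp (-∑ i, (n i : ℝ) * (θ i).im) := by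
  rw [expo, Complex.norm_exp]
  congr 1
  simp

theorem l1_nonneg (n : Fin d → ℤ) : 0 ≤ l1 n := Finset.sum_nonneg fun _ _ => abs_nonneg _

theorem l1_neg (n : Fin d → ℤ) : l1 (-n) = l1 n := by simp [l1]

theorem l1_add_le (m n : Fin d → ℤ) : l1 (m + n) ≤ l1 m + l1 n := by
  simp only [l1, ← Finset.sum_add_distrib]
  refine Finset.sum_le_sum fun i _ => ?_
  simpa using abs_add_le (m i : ℝ) (n i)

theorem l1_sub_le (m n : Fin d → ℤ) : l1 (m - n) ≤ l1 m + l1 n := by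
  rw [sub_eq_add_neg, ← l1_neg n]; exact l1_add_le _ _

theorem one_le_l1 {n : Fin d → ℤ} (h : n ≠ 0) : 1 ≤ l1 n := by
  obtain ⟨i, hi⟩ := Function.ne_iff.1 h
  have h1 : |(n i : ℝ)| ≤ l1 n :=
    Finset.single_le_sum (f := fun i => |(n i : ℝ)|) (fun _ _ => abs_nonneg _) (Finset.mem_univ i)
  have h2 : (1 : ℝ) ≤ |(n i : ℝ)| := by exact_mod_cast Int.one_le_abs hi
  exact h2.trans h1

theorem norm_expo_le (n : Fin d → ℤ) {θ : Fin d → ℂ} {r : ℝ} (hθ : ∀ i, |(θ i).im| ≤ r) :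
    ‖expo n θ‖ ≤ Real.exp (l1 n * r) := by
  rw [norm_expo, Real.exp_le_exp, l1, Finset.sum_mul, ← Finset.sum_neg_distrib]
  refine Finset.sum_le_sum fun i _ => ?_
  rw [← neg_mul]
  calc _ ≤ |-(n i : ℝ) * (θ i).im| := le_abs_self _
    _ = |(n i : ℝ)| * |(θ i).im| := by rw [abs_mul, abs_neg]
    _ ≤ _ := mul_le_mul_of_nonneg_left (hθ i) (abs_nonneg _)

theorem expo_periodic (n : Fin d → ℤ) (θ : Fin d → ℂ) (k : Fin d → ℤ) :
    expo n (fun i => θ i + (k i : ℂ) * ((2 * Real.pi : ℝ) : ℂ)) = expo n θ := by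
  have : (fun i => θ i + (k i : ℂ) * ((2 * Real.pi : ℝ) : ℂ)) =
      θ + fun i => (k i : ℂ) * ((2 * Real.pi : ℝ) : ℂ) := rfl
  rw [this, expo_add_right]
  have h : expo n (fun i => (k i : ℂ) * ((2 * Real.pi : ℝ) : ℂ)) = 1 := by
    rw [expo, Complex.exp_eq_one_iff]
    refine ⟨∑ i, n i * k i, ?_⟩
    push_cast
    rw [Finset.mul_sum, Finset.sum_mul]
    refine Finset.sum_congr rfl fun i _ => ?_
    ring
  rw [h, mul_one]

theorem conj_expo_real (n : Fin d → ℤ) (θ : Fin d → ℝ) :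
    starRingEnd ℂ (expo n (toCd θ)) = expo (-n) (toCd θ) := by
  simp only [expo, ← Complex.exp_conj, map_mul, Complex.conj_I, map_sum]
  congr 1
  simp [toCd]

theorem analyticAt_expo (n : Fin d → ℤ) (θ : Fin d → ℂ) : AnalyticAt ℂ (expo n) θ := by
  unfold expo
  refine AnalyticAt.cexp' ?_
  refine analyticAt_const.mul ?_
  refine Finset.analyticAt_fun_sum _ fun i _ => analyticAt_const.mul ?_
  exact (ContinuousLinearMap.proj (R := ℂ) (φ := fun _ : Fin d => ℂ) i).analyticAt θ

theorem isOpen_strip (r : ℝ) : IsOpen (strip d r) := by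
  simp only [strip, Set.ofPred_forall]
  exact isOpen_iInter_of_finite fun i => isOpen_lt (by fun_prop) continuous_const

theorem convex_strip (r : ℝ) : Convex ℝ (strip d r) := by
  intro x hx y hy a b ha hb hab i
  simp only [Pi.add_apply, Pi.smul_apply, Complex.add_im, Complex.real_smul, Complex.mul_im,
    Complex.ofReal_re, Complex.ofReal_im, zero_mul, add_zero]
  have h1 := abs_lt.1 (hx i)
  have h2 := abs_lt.1 (hy i)
  rw [abs_lt]
  rcases ha.eq_or_lt with rfl | ha
  · simp at hab; subst hab; simpa using h2
  · constructor <;> nlinarith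

theorem toCd_mem_strip {r : ℝ} (hr : 0 < r) (θ : Fin d → ℝ) : toCd θ ∈ strip d r := by
  intro i; simpa [toCd] using hr

theorem strip_mono {r r' : ℝ} (h : r' ≤ r) : strip d r' ⊆ strip d r := fun _ hθ i =>
  (hθ i).trans_le h

theorem add_real_mem_strip {r : ℝ} {θ : Fin d → ℂ} (hθ : θ ∈ strip d r) (ξ : Fin d → ℝ) :
    θ + toCd ξ ∈ strip d r := by
  intro i; simpa [toCd] using hθ i

end Characters

/-! ### Closure properties of bounded periodic analytic functions on a strip. -/

section StripFunctions

variable {d : ℕ} {E : Type*} [NormedAddCommGroup E] [NormedSpace ℂ E]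

/-- Bounded analytic functions on a strip that are `2π`-periodic in each variable. -/
structure StripPer (r : ℝ) (F : (Fin d → ℂ) → E) : Prop where
  analytic : AnalyticOnNhd ℂ F (strip d r)
  periodic : ∀ θ ∈ strip d r, ∀ n : Fin d → ℤ,
    F (fun i => θ i + (n i : ℂ) * ((2 * Real.pi : ℝ) : ℂ)) = F θ
  bounded : ∃ K : ℝ, ∀ θ ∈ strip d r, ‖F θ‖ ≤ K

namespace StripPer

theorem add {r : ℝ} {F G : (Fin d → ℂ) → E} (hF : StripPer r F) (hG : StripPer r G) :
    StripPer r (fun θ => F θ + G θ) where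
  analytic := hF.analytic.add hG.analytic
  periodic θ hθ n := by rw [hF.periodic θ hθ n, hG.periodic θ hθ n]
  bounded := by
    obtain ⟨K, hK⟩ := hF.bounded
    obtain ⟨K', hK'⟩ := hG.bounded
    exact ⟨K + K', fun θ hθ => norm_add_le_of_le (hK θ hθ) (hK' θ hθ)⟩

theorem clm_comp {E' : Type*} [NormedAddCommGroup E'] [NormedSpace ℂ E'] {r : ℝ}
    {F : (Fin d → ℂ) → E} (hF : StripPer r F) (T : E →L[ℂ] E') :
    StripPer r (fun θ => T (F θ)) where
  analytic := fun θ hθ => (T.analyticAt _).comp (hF.analytic θ hθ)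
  periodic θ hθ n := by rw [hF.periodic θ hθ n]
  bounded := by
    obtain ⟨K, hK⟩ := hF.bounded
    exact ⟨‖T‖ * K, fun θ hθ => (T.le_opNorm _).trans
      (mul_le_mul_of_nonneg_left (hK θ hθ) (norm_nonneg _))⟩

theorem neg {r : ℝ} {F : (Fin d → ℂ) → E} (hF : StripPer r F) :
    StripPer r (fun θ => -F θ) := by
  simpa using hF.clm_comp (-(ContinuousLinearMap.id ℂ E))

theorem sub {r : ℝ} {F G : (Fin d → ℂ) → E} (hF : StripPer r F) (hG : StripPer r G) :
    StripPer r (fun θ => F θ - G θ) := by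
  simpa [sub_eq_add_neg] using hF.add hG.neg

theorem const (r : ℝ) (X : E) : StripPer (d := d) r (fun _ => X) where
  analytic := analyticOnNhd_const
  periodic _ _ _ := rfl
  bounded := ⟨‖X‖, fun _ _ => le_rfl⟩

theorem smul {r : ℝ} {c : (Fin d → ℂ) → ℂ} {F : (Fin d → ℂ) → E} (hc : StripPer r c)
    (hF : StripPer r F) : StripPer r (fun θ => c θ • F θ) where
  analytic := hc.analytic.smul hF.analytic
  periodic θ hθ n := by rw [hF.periodic θ hθ n, hc.periodic θ hθ n]
  bounded := by
    obtain ⟨K, hK⟩ := hc.bounded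
    obtain ⟨K', hK'⟩ := hF.bounded
    refine ⟨K * K', fun θ hθ => ?_⟩
    rw [norm_smul]
    exact mul_le_mul (hK θ hθ) (hK' θ hθ) (norm_nonneg _) ((norm_nonneg _).trans (hK θ hθ))

theorem mul {A : Type*} [NormedRing A] [NormedAlgebra ℂ A] {r : ℝ}
    {F G : (Fin d → ℂ) → A} (hF : StripPer r F)
    (hG : StripPer r G) : StripPer r (fun θ => F θ * G θ) where
  analytic := hF.analytic.mul hG.analytic
  periodic θ hθ n := by rw [hF.periodic θ hθ n, hG.periodic θ hθ n]
  bounded := by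
    obtain ⟨K, hK⟩ := hF.bounded
    obtain ⟨K', hK'⟩ := hG.bounded
    refine ⟨K * K', fun θ hθ => (norm_mul_le _ _).trans ?_⟩
    exact mul_le_mul (hK θ hθ) (hK' θ hθ) (norm_nonneg _) ((norm_nonneg _).trans (hK θ hθ))

theorem expo (r : ℝ) (n : Fin d → ℤ) : StripPer r (_root_.expo n) where
  analytic θ _ := analyticAt_expo n θ
  periodic θ _ k := expo_periodic n θ k
  bounded := ⟨Real.exp (l1 n * r), fun _ hθ => norm_expo_le n fun i => (hθ i).le⟩

theorem sum {ι : Type*} (s : Finset ι) {r : ℝ} {F : ι → (Fin d → ℂ) → E}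
    (hF : ∀ i ∈ s, StripPer r (F i)) : StripPer r (fun θ => ∑ i ∈ s, F i θ) := by
  classical
  induction s using Finset.induction_on with
  | empty => simpa using const r (0 : E)
  | insert a s ha ih =>
    simp only [Finset.sum_insert ha]
    exact (hF a (by simp)).add (ih fun i hi => hF i (by simp [hi]))

theorem translate {r : ℝ} {F : (Fin d → ℂ) → E} (hF : StripPer r F) (ξ : Fin d → ℝ) :
    StripPer r (fun θ => F (θ + toCd ξ)) where
  analytic θ hθ := by
    have h := hF.analytic _ (add_real_mem_strip hθ ξ)
    exact h.comp (f := fun θ => θ + toCd ξ) (analyticAt_id.add analyticAt_const)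
  periodic θ hθ n := by
    rw [← hF.periodic _ (add_real_mem_strip hθ ξ) n]
    congr 1
    funext i; simp; ring
  bounded := by
    obtain ⟨K, hK⟩ := hF.bounded
    exact ⟨K, fun θ hθ => hK _ (add_real_mem_strip hθ ξ)⟩

theorem exp {A : Type*} [NormedRing A] [NormedAlgebra ℂ A] [CompleteSpace A] [NormOneClass A]
    {r : ℝ} {F : (Fin d → ℂ) → A}
    (hF : StripPer r F) : StripPer r (fun θ => NormedSpace.exp (F θ)) where
  analytic θ hθ := (NormedSpace.exp_analytic (𝕂 := ℂ) (F θ)).comp (hF.analytic θ hθ)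
  periodic θ hθ n := by rw [hF.periodic θ hθ n]
  bounded := by
    obtain ⟨K, hK⟩ := hF.bounded
    exact ⟨Real.exp K, fun θ hθ => (norm_exp_le' _).trans (Real.exp_le_exp.2 (hK θ hθ))⟩

theorem mono {r r' : ℝ} (h : r' ≤ r) {F : (Fin d → ℂ) → E} (hF : StripPer r F) :
    StripPer r' F where
  analytic θ hθ := hF.analytic θ (strip_mono h hθ)
  periodic θ hθ := hF.periodic θ (strip_mono h hθ)
  bounded := hF.bounded.imp fun _ hK θ hθ => hK θ (strip_mono h hθ)

end StripPer

end StripFunctions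

/-! ### Means over real tori and their independence of the imaginary shift. -/

section TorusIntegral

open MeasureTheory

variable {d : ℕ}

/-- The quotient map `ℝ^d → (ℝ/ℤ)^d`. -/
def torusMk (d : ℕ) (y : Fin d → ℝ) : UnitAddTorus (Fin d) := fun i => (y i : UnitAddCircle)

theorem torusMk_surjective : Function.Surjective (torusMk d) := fun x => by
  choose y hy using fun i => QuotientAddGroup.mk_surjective (x i)
  exact ⟨y, funext hy⟩

theorem exists_of_torusMk_eq {y z : Fin d → ℝ} (h : torusMk d y = torusMk d z) :
    ∃ n : Fin d → ℤ, z = fun i => y i + n i := by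
  have : ∀ i, ∃ k : ℤ, z i = y i + k := fun i => by
    have hi := congrFun h i
    obtain ⟨k, hk⟩ := AddSubgroup.mem_zmultiples_iff.1 (QuotientAddGroup.eq.1 hi)
    refine ⟨k, ?_⟩
    simp at hk
    linarith
  choose n hn using this
  exact ⟨n, funext hn⟩

theorem isOpenQuotientMap_torusMk : IsOpenQuotientMap (torusMk d) :=
  IsOpenQuotientMap.piMap fun _ => QuotientAddGroup.isOpenQuotientMap_mk

/-- The normalised Haar measure of the torus. -/
noncomputable def torusHaar (d : ℕ) : Measure (UnitAddTorus (Fin d)) :=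
  Measure.pi fun _ => AddCircle.haarAddCircle

instance : IsProbabilityMeasure (torusHaar d) := by unfold torusHaar; infer_instance
instance : (torusHaar d).IsAddRightInvariant := by unfold torusHaar; infer_instance

section Lift

variable {E : Type*}

/-- A function on `ℝ^d` read off on a fundamental domain of the torus. -/
noncomputable def torusLift (g : (Fin d → ℝ) → E) (x : UnitAddTorus (Fin d)) : E :=
  g (Function.surjInv torusMk_surjective x)

theorem torusLift_mk {g : (Fin d → ℝ) → E}
    (hg : ∀ (y : Fin d → ℝ) (n : Fin d → ℤ), g (fun i => y i + n i) = g y) (y : Fin d → ℝ) :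
    torusLift g (torusMk d y) = g y := by
  obtain ⟨n, hn⟩ := exists_of_torusMk_eq (Function.surjInv_eq torusMk_surjective (torusMk d y))
  rw [torusLift]
  conv_rhs => rw [hn]
  rw [hg]

/-- The lift uses an arbitrary choice of representatives, which periodicity makes harmless;
continuity descends because the projection is an open quotient map. -/
theorem continuous_torusLift [TopologicalSpace E] {g : (Fin d → ℝ) → E}
    (hg : ∀ (y : Fin d → ℝ) (n : Fin d → ℤ), g (fun i => y i + n i) = g y) (hc : Continuous g) :
    Continuous (torusLift g) := by
  rw [isOpenQuotientMap_torusMk.isQuotientMap.continuous_iff]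
  convert hc using 1
  funext y; exact torusLift_mk hg y

end Lift

variable {E : Type*} [NormedAddCommGroup E] [NormedSpace ℂ E]

/-- The function `y ↦ G (2π y + ζ)`. -/
noncomputable def slice (G : (Fin d → ℂ) → E) (ζ : Fin d → ℂ) (y : Fin d → ℝ) : E :=
  G (ζ + toCd fun i => 2 * Real.pi * y i)

namespace StripPer

variable {r : ℝ} {G : (Fin d → ℂ) → E}

theorem slice_periodic (hG : StripPer r G) {ζ : Fin d → ℂ} (hζ : ζ ∈ strip d r)
    (y : Fin d → ℝ) (n : Fin d → ℤ) : slice G ζ (fun i => y i + n i) = slice G ζ y := by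
  rw [slice, slice, ← hG.periodic _ (add_real_mem_strip hζ fun i => 2 * Real.pi * y i) n]
  congr 1
  funext i
  simp [toCd]; ring

theorem continuous_slice (hG : StripPer r G) {ζ : Fin d → ℂ} (hζ : ζ ∈ strip d r) :
    Continuous (slice G ζ) := by
  rw [continuous_iff_continuousAt]
  intro y
  have h := (hG.analytic _ (add_real_mem_strip hζ fun i => 2 * Real.pi * y i)).continuousAt
  refine ContinuousAt.comp (f := fun y : Fin d → ℝ => ζ + toCd fun i => 2 * Real.pi * y i) h ?_
  refine (continuous_const.add (continuous_pi fun i => ?_)).continuousAt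
  exact Complex.continuous_ofReal.comp (by fun_prop)

theorem continuous_lift (hG : StripPer r G) {ζ : Fin d → ℂ} (hζ : ζ ∈ strip d r) :
    Continuous (torusLift (slice G ζ)) :=
  continuous_torusLift (hG.slice_periodic hζ) (hG.continuous_slice hζ)

theorem integrable_lift (hG : StripPer r G) {ζ : Fin d → ℂ} (hζ : ζ ∈ strip d r) :
    Integrable (torusLift (slice G ζ)) (torusHaar d) :=
  (hG.continuous_lift hζ).integrable_of_hasCompactSupport (HasCompactSupport.of_compactSpace _)

end StripPer

/-- The mean of `G` over the real torus through `ζ`. -/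
noncomputable def torusMean (G : (Fin d → ℂ) → E) (ζ : Fin d → ℂ) : E :=
  ∫ x, torusLift (slice G ζ) x ∂(torusHaar d)

namespace StripPer

variable {r : ℝ} {G : (Fin d → ℂ) → E}

/-- A real translation of the base point is a translation of the torus, under which Haar measure is
invariant. -/
theorem torusMean_add_real (hG : StripPer r G) {ζ : Fin d → ℂ} (hζ : ζ ∈ strip d r)
    (ξ : Fin d → ℝ) : torusMean G (ζ + toCd ξ) = torusMean G ζ := by
  rw [torusMean, torusMean, ← integral_add_right_eq_self (torusLift (slice G ζ))
    (torusMk d fun i => ξ i / (2 * Real.pi))]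
  refine integral_congr_ae (Filter.Eventually.of_forall fun x => ?_)
  obtain ⟨y, rfl⟩ := torusMk_surjective x
  have e : torusMk d y + torusMk d (fun i => ξ i / (2 * Real.pi)) =
      torusMk d (fun i => y i + ξ i / (2 * Real.pi)) := rfl
  simp only [e]
  rw [torusLift_mk (hG.slice_periodic (add_real_mem_strip hζ ξ)),
    torusLift_mk (hG.slice_periodic hζ), slice, slice]
  congr 1
  funext i
  have : (Real.pi : ℂ) ≠ 0 := by exact_mod_cast Real.pi_ne_zero
  simp [toCd]; field_simp; ring

/-- Differentiation under the integral sign along a complex line; the Cauchy estimate on discs of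
radius δ/2 turns the uniform bound K into a dominating constant for the derivative. -/
theorem hasDerivAt_torusMean (hG : StripPer r G) [CompleteSpace E] {η : Fin d → ℂ} {z₀ : ℂ}
    (hz : z₀ • η ∈ strip d r) :
    DifferentiableAt ℂ (fun z : ℂ => torusMean G (z • η)) z₀ := by
  obtain ⟨K, hK⟩ := hG.bounded
  have hopen : IsOpen {z : ℂ | z • η ∈ strip d r} :=
    (isOpen_strip r).preimage (by fun_prop)
  obtain ⟨δ, hδ, hball⟩ := Metric.isOpen_iff.1 hopen z₀ hz
  set F : ℂ → UnitAddTorus (Fin d) → E := fun z => torusLift (slice G (z • η)) with hF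
  have hdiff : ∀ x, ∀ z ∈ Metric.ball z₀ δ, DifferentiableAt ℂ (fun z => F z x) z := by
    intro x z hz
    set ξ := toCd fun i => 2 * Real.pi * (Function.surjInv torusMk_surjective x) i
    have h := (hG.analytic _ (add_real_mem_strip (hball hz)
      fun i => 2 * Real.pi * (Function.surjInv torusMk_surjective x) i)).differentiableAt
    exact DifferentiableAt.comp (f := fun z : ℂ => z • η + ξ) (g := G) z h (by fun_prop)
  have hbd : ∀ x, ∀ z ∈ Metric.ball z₀ δ, ‖F z x‖ ≤ K := fun x z hz =>
    hK _ (add_real_mem_strip (hball hz) _)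
  -- The derivative is a pointwise limit of difference quotients along a sequence tending to 0, and
  -- each quotient is continuous on the torus.
  have hderiv_meas : AEStronglyMeasurable (fun x => deriv (fun z => F z x) z₀) (torusHaar d) := by
    set u : ℕ → ℂ := fun n => ((δ / 2 / (n + 1) : ℝ) : ℂ) with hu
    have hu0 : ∀ n, u n ≠ 0 := fun n => by
      simp only [hu]; norm_cast; positivity
    have hub : ∀ n, z₀ + u n ∈ Metric.ball z₀ δ := fun n => by
      rw [mem_ball_iff_norm, add_sub_cancel_left]
      simp only [hu]
      rw [Complex.norm_real, Real.norm_of_nonneg (by positivity)]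
      calc δ / 2 / (n + 1) ≤ δ / 2 := div_le_self (by positivity) (by linarith [n.cast_nonneg (α := ℝ)])
        _ < δ := by linarith
    have hut : Filter.Tendsto u Filter.atTop (nhdsWithin 0 {0}ᶜ) := by
      rw [tendsto_nhdsWithin_iff]
      refine ⟨?_, Filter.Eventually.of_forall hu0⟩
      have : Filter.Tendsto (fun n : ℕ => (δ / 2 / (n + 1) : ℝ)) Filter.atTop (nhds 0) := by
        have := (tendsto_one_div_add_atTop_nhds_zero_nat (𝕜 := ℝ)).const_mul (δ / 2)
        simpa [div_eq_mul_inv] using this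
      exact (Complex.continuous_ofReal.tendsto' 0 0 Complex.ofReal_zero).comp this
    refine aestronglyMeasurable_of_tendsto_ae Filter.atTop
      (f := fun n x => (u n)⁻¹ • (F (z₀ + u n) x - F z₀ x)) (fun n => ?_) ?_
    · have h1 := (hG.continuous_lift (hball (hub n))).aestronglyMeasurable (μ := torusHaar d)
      have h2 := (hG.continuous_lift hz).aestronglyMeasurable (μ := torusHaar d)
      exact (h1.sub h2).const_smul _
    · refine Filter.Eventually.of_forall fun x => ?_
      have := (hdiff x z₀ (Metric.mem_ball_self hδ)).hasDerivAt.tendsto_slope_zero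
      exact this.comp hut
  have key := hasDerivAt_integral_of_dominated_loc_of_deriv_le (μ := torusHaar d) (𝕜 := ℂ)
    (F := F) (x₀ := z₀) (s := Metric.ball z₀ (δ / 2)) (bound := fun _ => K / (δ / 2))
    (F' := fun z x => deriv (fun z => F z x) z) (Metric.ball_mem_nhds _ (by positivity)) ?_
    (hG.integrable_lift hz) hderiv_meas ?_ (integrable_const _) ?_
  · exact key.2.differentiableAt
  · filter_upwards [Metric.ball_mem_nhds z₀ hδ] with z hz
    exact (hG.continuous_lift (hball hz)).aestronglyMeasurable
  · refine Filter.Eventually.of_forall fun x z hz => ?_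
    have hsub : Metric.closedBall z (δ / 2) ⊆ Metric.ball z₀ δ := by
      intro w hw
      rw [Metric.mem_ball] at hz ⊢
      rw [Metric.mem_closedBall] at hw
      linarith [dist_triangle w z z₀]
    refine Complex.norm_deriv_le_of_forall_mem_sphere_norm_le (by positivity) ?_ ?_
    · apply DifferentiableOn.diffContOnCl
      rw [closure_ball _ (by positivity)]
      exact fun w hw => (hdiff x w (hsub hw)).differentiableWithinAt
    · exact fun w hw => hbd x w (hsub (Metric.sphere_subset_closedBall hw))
  · refine Filter.Eventually.of_forall fun x z hz => ?_
    exact (hdiff x z (Metric.ball_subset_ball (by linarith) hz)).hasDerivAt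

/-- The mean over the torus does not depend on the imaginary shift. -/
theorem torusMean_eq (hG : StripPer r G) [CompleteSpace E] (hr : 0 < r) {ζ : Fin d → ℂ}
    (hζ : ζ ∈ strip d r) : torusMean G ζ = torusMean G 0 := by
  -- After removing Re ζ by translation invariance, ζ is the point z = i on the complex line z ↦ zη,
  -- with η real.
  set η : Fin d → ℂ := toCd fun i => (ζ i).im with hη
  have hζ' : ζ = Complex.I • η + toCd fun i => (ζ i).re := by
    funext i
    apply Complex.ext <;> simp [hη, toCd]
  have hI : Complex.I • η ∈ strip d r := fun i => by
    have := hζ i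
    simpa [hη, toCd] using this
  rw [hζ', hG.torusMean_add_real hI]
  set U : Set ℂ := {z : ℂ | z • η ∈ strip d r} with hU
  have hopen : IsOpen U := (isOpen_strip r).preimage (by fun_prop)
  have hconv : Convex ℝ U := by
    have := (convex_strip (d := d) r).linear_preimage
      ((LinearMap.toSpanSingleton ℂ (Fin d → ℂ) η).restrictScalars ℝ)
    exact this
  have hreal : ∀ t : ℝ, torusMean G ((t : ℂ) • η) = torusMean G 0 := fun t => by
    have := hG.torusMean_add_real (ζ := 0) (by intro i; simpa using hr) (fun i => t * (ζ i).im)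
    rw [← this, zero_add]
    congr 1
    funext i; simp [hη, toCd]
  have hdo : DifferentiableOn ℂ (fun z : ℂ => torusMean G (z • η)) U := fun z hz =>
    (hG.hasDerivAt_torusMean hz).differentiableWithinAt
  have h0 : (0 : ℂ) ∈ U := by
    intro i; simpa using hr
  -- The mean is holomorphic in z and constant for real z, hence constant on the convex set of
  -- admissible z by the identity theorem.
  have := AnalyticOnNhd.eqOn_of_preconnected_of_frequently_eq (hdo.analyticOnNhd hopen)
    (analyticOnNhd_const (v := torusMean G 0)) hconv.isPreconnected h0 ?_
  · exact this hI
  · have ht : Filter.Tendsto (fun n : ℕ => (((1 / ((n : ℝ) + 1) : ℝ)) : ℂ)) Filter.atTop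
        (nhdsWithin 0 {0}ᶜ) := by
      rw [tendsto_nhdsWithin_iff]
      refine ⟨?_, Filter.Eventually.of_forall fun n => ?_⟩
      · exact (Complex.continuous_ofReal.tendsto' 0 0 Complex.ofReal_zero).comp
          (tendsto_one_div_add_atTop_nhds_zero_nat (𝕜 := ℝ))
      · have : (1 / ((n : ℝ) + 1) : ℝ) ≠ 0 := by positivity
        exact Complex.ofReal_ne_zero.2 this
    exact ht.frequently (Filter.Frequently.of_forall fun n => hreal _)

end StripPer

end TorusIntegral

/-! ### Fourier coefficients: decay, lattice sums, convergence and truncation. -/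

section FourierCoefficients

open MeasureTheory

variable {d : ℕ} {E : Type*} [NormedAddCommGroup E] [NormedSpace ℂ E]

theorem norm_torusMean_le {G : (Fin d → ℂ) → E} {ζ : Fin d → ℂ} {K : ℝ}
    (h : ∀ ξ : Fin d → ℝ, ‖G (ζ + toCd ξ)‖ ≤ K) : ‖torusMean G ζ‖ ≤ K := by
  have := norm_integral_le_of_norm_le_const (μ := torusHaar d) (f := torusLift (slice G ζ))
    (C := K) (Filter.Eventually.of_forall fun x => h _)
  simpa [torusMean] using this

/-- The Fourier coefficients of a periodic function. -/
noncomputable def fcoef (F : (Fin d → ℂ) → E) (n : Fin d → ℤ) : E :=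
  torusMean (fun θ => expo (-n) θ • F θ) 0

namespace StripPer

variable {r : ℝ} {F G : (Fin d → ℂ) → E}

theorem zero_mem (hr : 0 < r) : (0 : Fin d → ℂ) ∈ strip d r := fun i => by simpa using hr

theorem fcoef_add (hF : StripPer r F) (hG : StripPer r G) (hr : 0 < r) (n : Fin d → ℤ) :
    fcoef (fun θ => F θ + G θ) n = fcoef F n + fcoef G n := by
  rw [fcoef, fcoef, fcoef, torusMean, torusMean, torusMean,
    ← integral_add (((StripPer.expo r (-n)).smul hF).integrable_lift (zero_mem hr))
      (((StripPer.expo r (-n)).smul hG).integrable_lift (zero_mem hr))]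
  congr 1
  funext x
  simp [torusLift, slice]

theorem fcoef_clm {E' : Type*} [NormedAddCommGroup E'] [NormedSpace ℂ E'] [CompleteSpace E]
    [CompleteSpace E'] (hF : StripPer r F) (hr : 0 < r) (T : E →L[ℂ] E') (n : Fin d → ℤ) :
    fcoef (fun θ => T (F θ)) n = T (fcoef F n) := by
  rw [fcoef, fcoef, torusMean, torusMean, ← T.integral_comp_comm
    (((StripPer.expo r (-n)).smul hF).integrable_lift (zero_mem hr))]
  congr 1
  funext x
  simp [torusLift, slice]

theorem fcoef_neg [CompleteSpace E] (hF : StripPer r F) (hr : 0 < r) (n : Fin d → ℤ) :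
    fcoef (fun θ => -F θ) n = -fcoef F n := by
  simpa using hF.fcoef_clm hr (-(ContinuousLinearMap.id ℂ E)) n

theorem fcoef_sub [CompleteSpace E] (hF : StripPer r F) (hG : StripPer r G) (hr : 0 < r)
    (n : Fin d → ℤ) : fcoef (fun θ => F θ - G θ) n = fcoef F n - fcoef G n := by
  simpa [sub_eq_add_neg, hG.fcoef_neg hr] using hF.fcoef_add hG.neg hr n

theorem fcoef_sum {ι : Type*} (s : Finset ι) {F : ι → (Fin d → ℂ) → E}
    (hF : ∀ i ∈ s, StripPer r (F i)) (hr : 0 < r) (n : Fin d → ℤ) :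
    fcoef (fun θ => ∑ i ∈ s, F i θ) n = ∑ i ∈ s, fcoef (F i) n := by
  classical
  induction s using Finset.induction_on with
  | empty => simp [fcoef, torusMean, torusLift, slice]
  | insert a s ha ih =>
    simp only [Finset.sum_insert ha]
    rw [← ih fun i hi => hF i (by simp [hi])]
    exact (hF a (by simp)).fcoef_add (StripPer.sum s fun i hi => hF i (by simp [hi])) hr n

/-- Translating by π/m_i in a coordinate with m_i ≠ 0 changes the sign of the character but not its
mean. -/
theorem torusMean_expo {m : Fin d → ℤ} (hm : m ≠ 0) : torusMean (_root_.expo m) 0 = 0 := by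
  obtain ⟨i, hi⟩ := Function.ne_iff.1 hm
  set ξ : Fin d → ℝ := Pi.single i (Real.pi / m i) with hξ
  have h := (StripPer.expo 1 m).torusMean_add_real (zero_mem one_pos) ξ
  have hv : _root_.expo m (toCd ξ) = -1 := by
    rw [_root_.expo]
    have : ∑ j, (m j : ℂ) * toCd ξ j = Real.pi := by
      rw [Finset.sum_eq_single i]
      · have : (m i : ℂ) ≠ 0 := by exact_mod_cast hi
        simp [toCd, hξ]; field_simp
      · intro j _ hj
        simp [toCd, hξ, Pi.single_eq_of_ne hj]
      · simp
    rw [this, mul_comm, Complex.exp_pi_mul_I]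
  have h2 : torusMean (_root_.expo m) (0 + toCd ξ) = -torusMean (_root_.expo m) 0 := by
    rw [torusMean, torusMean, ← integral_neg]
    congr 1
    funext x
    simp only [torusLift, slice]
    rw [add_right_comm, expo_add_right, hv]
    ring
  rw [h2] at h
  have : (2 : ℂ) * torusMean (_root_.expo m) 0 = 0 := by linear_combination -h
  simpa using this

theorem fcoef_expo_smul [CompleteSpace E] (m n : Fin d → ℤ) (X : E) :
    fcoef (fun θ => _root_.expo m θ • X) n = if n = m then X else 0 := by
  have e : fcoef (fun θ => _root_.expo m θ • X) n = torusMean (_root_.expo (m - n)) 0 • X := by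
    rw [fcoef, torusMean, torusMean, ← integral_smul_const]
    congr 1
    funext x
    simp only [torusLift, slice]
    rw [smul_smul, ← expo_add_left]
    congr 2
    abel
  rw [e]
  split_ifs with h
  · subst h
    have : torusMean (_root_.expo (n - n)) 0 = 1 := by
      have h1 : (_root_.expo (n - n)) = fun _ : Fin d → ℂ => (1 : ℂ) := by
        funext θ; rw [sub_self, expo_zero_left]
      rw [h1, torusMean]
      simp [torusLift, slice]
    rw [this, one_smul]
  · rw [torusMean_expo (sub_ne_zero.2 (Ne.symm h)), zero_smul]

/-- The contour is shifted by height t < r in the direction in which e^{-i⟨n,θ⟩} decays, which gains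
e^{-|n|t}; then t tends to r, where the strip is open. -/
theorem norm_fcoef_le [CompleteSpace E] (hF : StripPer r F) (hr : 0 < r) {b : ℝ}
    (hb : ∀ θ ∈ strip d r, ‖F θ‖ ≤ b) (n : Fin d → ℤ) :
    ‖fcoef F n‖ ≤ b * Real.exp (-(l1 n * r)) := by
  have hb0 : 0 ≤ b := (norm_nonneg _).trans (hb 0 (zero_mem hr))
  have key : ∀ t ∈ Set.Ioo 0 r, ‖fcoef F n‖ ≤ b * Real.exp (-(l1 n * t)) := by
    intro t ht
    set ζ : Fin d → ℂ := fun i => -(t * (SignType.sign (n i) : ℤ) : ℝ) * Complex.I with hζ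
    have hs : ∀ i, |((SignType.sign (n i) : ℤ) : ℝ)| ≤ 1 := fun i => by
      rcases lt_trichotomy (n i) 0 with h | h | h <;> simp [h]
    have him : ∀ i, (ζ i).im = -(t * (SignType.sign (n i) : ℤ) : ℝ) := fun i => by
      simp [hζ]
    have hmem : ζ ∈ strip d r := fun i => by
      rw [him, abs_neg, abs_mul, abs_of_pos ht.1]
      nlinarith [hs i, ht.1, ht.2, abs_nonneg ((SignType.sign (n i) : ℤ) : ℝ)]
    have hG := (StripPer.expo r (-n)).smul hF
    rw [fcoef, ← hG.torusMean_eq hr hmem]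
    refine norm_torusMean_le fun ξ => ?_
    rw [norm_smul, mul_comm]
    refine mul_le_mul (hb _ (add_real_mem_strip hmem ξ)) ?_ (norm_nonneg _) hb0
    rw [norm_expo, Real.exp_le_exp, neg_le_neg_iff, l1, Finset.sum_mul]
    refine Finset.sum_le_sum fun i _ => ?_
    have : ((ζ + toCd ξ) i).im = -(t * (SignType.sign (n i) : ℤ) : ℝ) := by
      rw [← him i]; simp [toCd]
    rw [this]
    have hsn : |(n i : ℝ)| = (n i : ℝ) * (SignType.sign (n i) : ℤ) := by
      rcases lt_trichotomy (n i) 0 with h | h | h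
      · have : (n i : ℝ) < 0 := by exact_mod_cast h
        simp [h, abs_of_neg this]
      · simp [h]
      · have : (0 : ℝ) < n i := by exact_mod_cast h
        simp [h, abs_of_pos this]
    rw [hsn]
    simp
    exact le_of_eq (by ring)
  have hcont : Filter.Tendsto (fun t => b * Real.exp (-(l1 n * t))) (nhdsWithin r (Set.Iio r))
      (nhds (b * Real.exp (-(l1 n * r)))) := by
    have : Continuous fun t => b * Real.exp (-(l1 n * t)) := by fun_prop
    exact (this.tendsto r).mono_left nhdsWithin_le_nhds
  refine ge_of_tendsto hcont ?_
  filter_upwards [Ioo_mem_nhdsLT hr] with t ht using key t ht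

end StripPer

theorem mFourier_torusMk (n : Fin d → ℤ) (y : Fin d → ℝ) :
    UnitAddTorus.mFourier n (torusMk d y) = expo n (toCd fun i => 2 * Real.pi * y i) := by
  simp only [UnitAddTorus.mFourier, ContinuousMap.coe_mk, torusMk, fourier_coe_apply, expo,
    ← Complex.exp_sum]
  congr 1
  rw [Finset.mul_sum]
  refine Finset.sum_congr rfl fun i _ => ?_
  simp [toCd]; ring

section Sums

theorem sum_exp_int_le {δ : ℝ} (hδ : 0 < δ) (t : Finset ℤ) :
    ∑ k ∈ t, Real.exp (-(|(k : ℝ)| * δ)) ≤ 2 + 2 / δ := by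
  set q := Real.exp (-δ) with hq
  have hq0 : 0 < q := Real.exp_pos _
  have hq1 : q < 1 := Real.exp_lt_one_iff.2 (by linarith)
  have hs : ∀ s : Finset ℕ, ∑ k ∈ s, q ^ k ≤ 1 + 1 / δ := fun s => by
    have h1 : (1 - q)⁻¹ ≤ 1 + 1 / δ := by
      have h2 : 1 + δ ≤ Real.exp δ := by linarith [Real.add_one_le_exp δ]
      have h3 : q ≤ 1 / (1 + δ) := by
        rw [hq, Real.exp_neg, ← one_div]; exact one_div_le_one_div_of_le (by linarith) h2
      have h4 : δ / (1 + δ) ≤ 1 - q := by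
        have : δ / (1 + δ) = 1 - 1 / (1 + δ) := by field_simp; ring
        linarith
      calc (1 - q)⁻¹ ≤ (δ / (1 + δ))⁻¹ := inv_anti₀ (by positivity) h4
        _ = _ := by field_simp; ring
    exact ((summable_geometric_of_lt_one hq0.le hq1).sum_le_tsum s fun _ _ => by positivity).trans
      ((tsum_geometric_of_lt_one hq0.le hq1).le.trans h1)
  have hterm : ∀ k : ℤ, Real.exp (-(|(k : ℝ)| * δ)) = q ^ k.natAbs := fun k => by
    rw [hq, ← Real.exp_nat_mul, Nat.cast_natAbs]
    congr 1; push_cast; ring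
  simp only [hterm]
  calc ∑ k ∈ t, q ^ k.natAbs
      = ∑ k ∈ t with 0 ≤ k, q ^ k.natAbs + ∑ k ∈ t with ¬ 0 ≤ k, q ^ k.natAbs :=
        (Finset.sum_filter_add_sum_filter_not _ _ _).symm
    _ = ∑ j ∈ (t.filter (0 ≤ ·)).image Int.natAbs, q ^ j +
        ∑ j ∈ (t.filter (¬ 0 ≤ ·)).image Int.natAbs, q ^ j := by
        -- The absolute value is injective on each of the two half-lines, so each half is a partial
        -- geometric sum.
        rw [Finset.sum_image, Finset.sum_image]
        · intro a ha b hb hab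
          simp at ha hb hab; omega
        · intro a ha b hb hab
          simp at ha hb hab; omega
    _ ≤ (1 + 1 / δ) + (1 + 1 / δ) := add_le_add (hs _) (hs _)
    _ = _ := by ring

/-- A finite set of lattice points sits in a cube, where the ℓ¹ weight factors and the sum becomes a
product of d one-dimensional sums. -/
theorem sum_exp_l1_le {δ : ℝ} (hδ : 0 < δ) (s : Finset (Fin d → ℤ)) :
    ∑ n ∈ s, Real.exp (-(l1 n * δ)) ≤ (2 + 2 / δ) ^ d := by
  classical
  set t : Finset ℤ := s.biUnion fun n => Finset.univ.image n with ht
  have hsub : s ⊆ Fintype.piFinset fun _ => t := fun n hn => by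
    rw [Fintype.mem_piFinset]
    intro i
    rw [ht, Finset.mem_biUnion]
    exact ⟨n, hn, Finset.mem_image_of_mem _ (Finset.mem_univ i)⟩
  calc _ ≤ ∑ n ∈ Fintype.piFinset fun _ => t, Real.exp (-(l1 n * δ)) :=
        Finset.sum_le_sum_of_subset_of_nonneg hsub fun _ _ _ => (Real.exp_pos _).le
    _ = ∑ n ∈ Fintype.piFinset fun _ => t, ∏ i, Real.exp (-(|(n i : ℝ)| * δ)) := by
        refine Finset.sum_congr rfl fun n _ => ?_
        rw [← Real.exp_sum, l1, Finset.sum_mul, Finset.sum_neg_distrib]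
    _ = ∏ _i : Fin d, ∑ k ∈ t, Real.exp (-(|(k : ℝ)| * δ)) :=
        (Finset.prod_univ_sum (fun _ : Fin d => t)
          (fun _ k => Real.exp (-(|(k : ℝ)| * δ)))).symm
    _ ≤ ∏ _i : Fin d, (2 + 2 / δ) := by
        refine Finset.prod_le_prod (fun _ _ => Finset.sum_nonneg fun _ _ => (Real.exp_pos _).le)
          fun _ _ => sum_exp_int_le hδ t
    _ = _ := by simp

theorem summable_exp_l1 {δ : ℝ} (hδ : 0 < δ) :
    Summable fun n : Fin d → ℤ => Real.exp (-(l1 n * δ)) :=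
  summable_of_sum_le (fun _ => (Real.exp_pos _).le) (sum_exp_l1_le hδ)

theorem tsum_exp_l1_le {δ : ℝ} (hδ : 0 < δ) :
    ∑' n : Fin d → ℤ, Real.exp (-(l1 n * δ)) ≤ (2 + 2 / δ) ^ d :=
  (summable_exp_l1 hδ).tsum_le_of_sum_le (sum_exp_l1_le hδ)

/-- The lattice points of `ℓ¹` norm at most `N`. -/
noncomputable def modes (d : ℕ) (N : ℝ) : Finset (Fin d → ℤ) :=
  (Fintype.piFinset fun _ => Finset.Icc (-⌊N⌋) ⌊N⌋).filter fun n => l1 n ≤ N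

theorem mem_modes {N : ℝ} {n : Fin d → ℤ} : n ∈ modes d N ↔ l1 n ≤ N := by
  rw [modes, Finset.mem_filter, Fintype.mem_piFinset]
  refine ⟨fun h => h.2, fun h => ⟨fun i => ?_, h⟩⟩
  have h1 : |(n i : ℝ)| ≤ l1 n :=
    Finset.single_le_sum (f := fun i => |(n i : ℝ)|) (fun _ _ => abs_nonneg _) (Finset.mem_univ i)
  have h2 := abs_le.1 (h1.trans h)
  rw [Finset.mem_Icc]
  refine ⟨?_, Int.le_floor.2 h2.2⟩
  have : -n i ≤ ⌊N⌋ := Int.le_floor.2 (by push_cast; linarith)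
  linarith

theorem card_modes_le {N : ℝ} (hN : 1 ≤ N) : ((modes d N).card : ℝ) ≤ (3 * N) ^ d := by
  have h1 : (modes d N).card ≤ (2 * ⌊N⌋ + 1).toNat ^ d := by
    refine (Finset.card_filter_le _ _).trans ?_
    rw [Fintype.card_piFinset]
    simp
    refine le_of_eq ?_
    congr 2; ring
  have h2 : (((2 * ⌊N⌋ + 1).toNat : ℕ) : ℝ) ≤ 3 * N := by
    have h3 : 0 ≤ ⌊N⌋ := Int.floor_nonneg.2 (by linarith)
    have h4 : (((2 * ⌊N⌋ + 1).toNat : ℕ) : ℝ) = 2 * (⌊N⌋ : ℝ) + 1 := by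
      have : (((2 * ⌊N⌋ + 1).toNat : ℕ) : ℤ) = 2 * ⌊N⌋ + 1 := Int.toNat_of_nonneg (by omega)
      exact_mod_cast this
    rw [h4]
    linarith [Int.floor_le N]
  calc ((modes d N).card : ℝ) ≤ (((2 * ⌊N⌋ + 1).toNat : ℕ) : ℝ) ^ d := by exact_mod_cast h1
    _ ≤ _ := pow_le_pow_left₀ (Nat.cast_nonneg _) h2 d

end Sums

namespace StripPer

variable {r : ℝ}

theorem norm_expo_smul_fcoef_le [CompleteSpace E] {F : (Fin d → ℂ) → E} (hF : StripPer r F)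
    (hr : 0 < r) {b : ℝ} (hb : ∀ θ ∈ strip d r, ‖F θ‖ ≤ b) {r' : ℝ} {θ : Fin d → ℂ}
    (hθ : ∀ i, |(θ i).im| ≤ r') (n : Fin d → ℤ) :
    ‖_root_.expo n θ • fcoef F n‖ ≤ b * Real.exp (-(l1 n * (r - r'))) := by
  have hb0 : 0 ≤ b := (norm_nonneg _).trans (hb 0 (zero_mem hr))
  rw [norm_smul]
  calc _ ≤ Real.exp (l1 n * r') * (b * Real.exp (-(l1 n * r))) :=
        mul_le_mul (norm_expo_le n hθ) (hF.norm_fcoef_le hr hb n) (norm_nonneg _)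
          (Real.exp_pos _).le
    _ = b * (Real.exp (l1 n * r') * Real.exp (-(l1 n * r))) := by ring
    _ = _ := by rw [← Real.exp_add]; ring_nf

/-- The Fourier series represents the function on the strip. -/
theorem hasSum_fcoef_scalar {F : (Fin d → ℂ) → ℂ} (hF : StripPer r F) (hr : 0 < r)
    {θ : Fin d → ℂ} (hθ : θ ∈ strip d r) :
    HasSum (fun n => _root_.expo n θ • fcoef F n) (F θ) := by
  obtain ⟨b, hb⟩ := hF.bounded
  set φ : C(UnitAddTorus (Fin d), ℂ) := ⟨torusLift (slice F θ), hF.continuous_lift hθ⟩ with hφ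
  -- Shift invariance of the mean identifies the coefficients of the restriction to the real torus
  -- through θ with those at the origin times e^{i⟨n,θ⟩}.
  have hco : ∀ n, UnitAddTorus.mFourierCoeff φ n = _root_.expo n θ • fcoef F n := fun n => by
    have hG := (StripPer.expo r (-n)).smul hF
    rw [fcoef, ← hG.torusMean_eq hr hθ, torusMean, ← integral_smul]
    change ∫ t, _ ∂(torusHaar d) = _
    refine integral_congr_ae (Filter.Eventually.of_forall fun x => ?_)
    obtain ⟨y, rfl⟩ := torusMk_surjective x
    simp only [hφ, ContinuousMap.coe_mk]
    rw [torusLift_mk (hG.slice_periodic hθ), torusLift_mk (hF.slice_periodic hθ),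
      mFourier_torusMk]
    simp only [slice, expo_add_right, smul_eq_mul]
    have := expo_neg_mul n θ
    linear_combination (-(_root_.expo (-n) (toCd fun i => 2 * Real.pi * y i)) *
      F (θ + toCd fun i => 2 * Real.pi * y i)) * this
  -- Finitely many coordinates leave a margin r − r' > 0, which makes the series absolutely
  -- summable; in dimension zero there is no maximum to take.
  obtain ⟨r', hr', hlt⟩ : ∃ r', (∀ i, |(θ i).im| ≤ r') ∧ r' < r := by
    rcases Nat.eq_zero_or_pos d with rfl | hd
    · exact ⟨0, fun i => i.elim0, hr⟩
    · have : Nonempty (Fin d) := ⟨⟨0, hd⟩⟩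
      obtain ⟨i, hi⟩ := Finite.exists_max fun i => |(θ i).im|
      exact ⟨_, hi, hθ i⟩
  have hsum : Summable (UnitAddTorus.mFourierCoeff φ) := by
    refine Summable.of_norm_bounded ((summable_exp_l1 (d := d) (sub_pos.2 hlt)).mul_left b)
      fun n => ?_
    rw [hco]
    exact hF.norm_expo_smul_fcoef_le hr hb hr' n
  have := UnitAddTorus.hasSum_mFourier_series_apply_of_summable hsum (torusMk d 0)
  have e0 : (toCd fun i => 2 * Real.pi * (0 : Fin d → ℝ) i) = 0 := by
    funext i; simp [toCd]
  simp only [hco, mFourier_torusMk, e0, expo_zero_right, smul_eq_mul, mul_one] at this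
  have hv : φ (torusMk d 0) = F θ := by
    rw [hφ, ContinuousMap.coe_mk, torusLift_mk (hF.slice_periodic hθ), slice, e0, add_zero]
  rw [← hv]
  exact this

/-- A matrix entry as a continuous linear functional. -/
noncomputable def _root_.entryL (i j : Fin 2) : CMat →L[ℂ] ℂ :=
  (Matrix.entryLinearMap ℂ ℂ i j).toContinuousLinearMap

theorem hasSum_fcoef {F : (Fin d → ℂ) → CMat} (hF : StripPer r F) (hr : 0 < r)
    {θ : Fin d → ℂ} (hθ : θ ∈ strip d r) :
    HasSum (fun n => _root_.expo n θ • fcoef F n) (F θ) := by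
  have h : ∀ i j, HasSum (fun n => (_root_.expo n θ • fcoef F n) i j) (F θ i j) := fun i j => by
    have := (hF.clm_comp (entryL i j)).hasSum_fcoef_scalar hr hθ
    simp only [hF.fcoef_clm hr] at this
    exact this
  exact Pi.hasSum.2 fun i => Pi.hasSum.2 fun j => h i j

/-- Truncation of the Fourier series. -/
theorem norm_sub_truncation_le {F : (Fin d → ℂ) → CMat} (hF : StripPer r F) (hr : 0 < r)
    {b : ℝ} (hb : ∀ θ ∈ strip d r, ‖F θ‖ ≤ b) {r' N δ : ℝ} (hr' : r' < r)
    (hδ : 0 < δ) (hδ' : δ ≤ r - r') {θ : Fin d → ℂ} (hθ : θ ∈ strip d r') :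
    ‖F θ - ∑ n ∈ modes d N, _root_.expo n θ • fcoef F n‖ ≤
      b * (Real.exp (-(N * (r - r' - δ))) * (2 + 2 / δ) ^ d) := by
  classical
  have hb0 : 0 ≤ b := (norm_nonneg _).trans (hb 0 (zero_mem hr))
  have h := hF.hasSum_fcoef hr (strip_mono hr'.le hθ)
  have h2 : HasSum (fun n : {n // n ∉ modes d N} => _root_.expo n.1 θ • fcoef F n.1)
      (F θ - ∑ n ∈ modes d N, _root_.expo n θ • fcoef F n) := by
    rw [(modes d N).hasSum_compl_iff (f := fun n => _root_.expo n θ • fcoef F n), sub_add_cancel]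
    exact h
  rw [← h2.tsum_eq]
  have hsm := (summable_exp_l1 (d := d) hδ).mul_left (b * Real.exp (-(N * (r - r' - δ))))
  refine (tsum_of_norm_bounded (hsm.subtype _).hasSum fun n => ?_).trans
    ((hsm.tsum_subtype_le _ _ fun n => by positivity).trans ?_)
  · refine (hF.norm_expo_smul_fcoef_le hr hb (fun i => (hθ i).le) n).trans ?_
    simp only [Function.comp]
    rw [mul_assoc, ← Real.exp_add]
    -- The decay rate r − r' is split: the part δ is kept to sum the series, and the rest is
    -- evaluated at |n| > N to give the small factor.
    refine mul_le_mul_of_nonneg_left (Real.exp_le_exp.2 ?_) hb0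
    have hn : N < l1 (n : Fin d → ℤ) := by
      have := n.2
      rw [mem_modes, not_le] at this
      exact this
    nlinarith
  · rw [tsum_mul_left, mul_assoc]
    exact mul_le_mul_of_nonneg_left (mul_le_mul_of_nonneg_left (tsum_exp_l1_le hδ)
      (Real.exp_pos _).le) hb0

/-- Entrywise conjugation as a real linear map. -/
noncomputable def _root_.cjL : CMat →L[ℝ] CMat :=
  LinearMap.mkContinuous ⟨⟨cj, map_add cj⟩, fun c X => cj_smul_real c X⟩ 1 fun X => by
    simpa using norm_cj_le X

theorem _root_.cjL_apply (X : CMat) : cjL X = cj X := rfl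

/-- Only real points enter a Fourier coefficient, where conjugation turns e^{-i⟨n,θ⟩} into
e^{i⟨n,θ⟩}. With G = F this is the symmetry of coefficients of real functions. -/
theorem fcoef_conj {F G : (Fin d → ℂ) → CMat} (hF : StripPer r F) (hr : 0 < r)
    (h : ∀ θ : Fin d → ℝ, G (toCd θ) = cj (F (toCd θ))) (n : Fin d → ℤ) :
    fcoef G n = cj (fcoef F (-n)) := by
  rw [fcoef, fcoef, torusMean, torusMean, ← cjL_apply, ← cjL.integral_comp_comm
    (((StripPer.expo r (- -n)).smul hF).integrable_lift (zero_mem hr))]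
  congr 1
  funext x
  simp only [torusLift, slice, zero_add, cjL_apply, cj_smul, conj_expo_real, h, neg_neg]

end StripPer

end FourierCoefficients

/-! ### The nonlinear part of a product of three exponentials. -/

section ProductEstimate

open NormedSpace

variable {E : Type*} [NormedRing E] [NormedAlgebra ℂ E] [CompleteSpace E]

theorem norm_exp_mul_exp_sub_one_le [NormOneClass E] {x y : E} {R₁ R₂ : ℝ} (hx : ‖x‖ ≤ R₁)
    (hy : ‖y‖ ≤ R₂)
    (h : R₁ + R₂ ≤ 1) : ‖exp x * exp y - 1‖ ≤ 2 * (R₁ + R₂) := by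
  have h1 := (norm_exp_sub_one_le x).trans (sub_le_sub_right (Real.exp_le_exp.2 hx) 1)
  have h2 := (norm_exp_sub_one_le y).trans (sub_le_sub_right (Real.exp_le_exp.2 hy) 1)
  have h3 := (norm_exp_le' y).trans (Real.exp_le_exp.2 hy)
  have h4 := real_exp_sub_one_le (x := R₁ + R₂)
    (add_nonneg ((norm_nonneg x).trans hx) ((norm_nonneg y).trans hy)) h
  rw [Real.exp_add] at h4
  have e : exp x * exp y - 1 = (exp x - 1) * exp y + (exp y - 1) := by noncomm_ring
  rw [e]
  refine (norm_add_le _ _).trans ?_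
  have h5 := norm_mul_le (exp x - 1) (exp y)
  have h6 : ‖exp x - 1‖ * ‖exp y‖ ≤ (Real.exp R₁ - 1) * Real.exp R₂ :=
    mul_le_mul h1 h3 (norm_nonneg _) ((norm_nonneg _).trans h1)
  linarith

/-- The nonlinear part of `(u, v) ↦ e^u e^f e^v` has a small Lipschitz constant. -/
theorem norm_exp_triple_sub_le [NormOneClass E] {u u' v v' f : E} {R e : ℝ} (hu : ‖u‖ ≤ R)
    (hu' : ‖u'‖ ≤ R)
    (hv : ‖v‖ ≤ R) (hv' : ‖v'‖ ≤ R) (hf : ‖f‖ ≤ e) (hRe : R + e ≤ 1 / 2) :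
    ‖(exp u * exp f * exp v - u - v) - (exp u' * exp f * exp v' - u' - v')‖ ≤
      6 * (R + e) * (‖u - u'‖ + ‖v - v'‖) := by
  have hR : 0 ≤ R := (norm_nonneg u).trans hu
  have he : 0 ≤ e := (norm_nonneg f).trans hf
  have hG := norm_exp_mul_exp_sub_one_le hf hv (by linarith)
  have hG' := norm_exp_mul_exp_sub_one_le hu' hf (by linarith)
  have e1 := norm_exp_sub_exp_sub_le hu hu'
  have e2 := norm_exp_sub_exp_sub_le hv hv'
  have e3 := real_exp_sub_one_le hR (by linarith)
  -- First u is changed, then v, and the linear parts are peeled off; each of the four terms is a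
  -- difference multiplied by a factor of size R + e.
  have id1 : (exp u * exp f * exp v - u - v) - (exp u' * exp f * exp v' - u' - v') =
      (exp u - exp u' - (u - u')) * (exp f * exp v) + (u - u') * (exp f * exp v - 1) +
      (exp u' * exp f) * (exp v - exp v' - (v - v')) + (exp u' * exp f - 1) * (v - v') := by
    noncomm_ring
  have n1 : ‖exp f * exp v‖ ≤ 1 + 2 * (e + R) := by
    calc _ = ‖(exp f * exp v - 1) + 1‖ := by rw [sub_add_cancel]
      _ ≤ _ := (norm_add_le _ _).trans (by rw [norm_one]; linarith)
  have n2 : ‖exp u' * exp f‖ ≤ 1 + 2 * (R + e) := by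
    calc _ = ‖(exp u' * exp f - 1) + 1‖ := by rw [sub_add_cancel]
      _ ≤ _ := (norm_add_le _ _).trans (by rw [norm_one]; linarith)
  rw [id1]
  have a0 := norm_nonneg (u - u')
  have b0 := norm_nonneg (v - v')
  have t1 : ‖(exp u - exp u' - (u - u')) * (exp f * exp v)‖ ≤
      (2 * R * ‖u - u'‖) * (1 + 2 * (e + R)) :=
    (norm_mul_le _ _).trans (mul_le_mul (e1.trans (mul_le_mul_of_nonneg_right e3 a0)) n1
      (norm_nonneg _) (by positivity))
  have t2 : ‖(u - u') * (exp f * exp v - 1)‖ ≤ ‖u - u'‖ * (2 * (e + R)) :=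
    (norm_mul_le _ _).trans (mul_le_mul_of_nonneg_left hG a0)
  have t3 : ‖(exp u' * exp f) * (exp v - exp v' - (v - v'))‖ ≤
      (1 + 2 * (R + e)) * (2 * R * ‖v - v'‖) :=
    (norm_mul_le _ _).trans (mul_le_mul n2 (e2.trans (mul_le_mul_of_nonneg_right e3 b0))
      (norm_nonneg _) (by positivity))
  have t4 : ‖(exp u' * exp f - 1) * (v - v')‖ ≤ (2 * (R + e)) * ‖v - v'‖ :=
    (norm_mul_le _ _).trans (mul_le_mul_of_nonneg_right hG' b0)
  refine (norm_add₄_le).trans ?_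
  have k1 : (2 * R) * (1 + 2 * (R + e)) + 2 * (R + e) ≤ 6 * (R + e) := by nlinarith
  have k2 := mul_le_mul_of_nonneg_right k1 a0
  have k3 := mul_le_mul_of_nonneg_right k1 b0
  nlinarith

end ProductEstimate

/-! ### Trigonometric polynomials. -/

section TrigPolynomials

variable {d : ℕ}

/-- The trigonometric polynomial with coefficients `Y` and frequencies of `ℓ¹` norm `≤ N`. -/
noncomputable def trig (N : ℝ) (Y : (Fin d → ℤ) → CMat) (θ : Fin d → ℂ) : CMat :=
  ∑ n ∈ modes d N, expo n θ • Y n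

theorem stripPer_trig (r N : ℝ) (Y : (Fin d → ℤ) → CMat) : StripPer r (trig N Y) :=
  StripPer.sum _ fun n _ => (StripPer.expo r n).smul (StripPer.const r (Y n))

theorem trig_sub (N : ℝ) (Y Y' : (Fin d → ℤ) → CMat) (θ : Fin d → ℂ) :
    trig N (fun n => Y n - Y' n) θ = trig N Y θ - trig N Y' θ := by
  simp [trig, smul_sub]

theorem trig_translate (N : ℝ) (Y : (Fin d → ℤ) → CMat) (θ : Fin d → ℂ) (α : Fin d → ℝ) :
    trig N Y (θ + toCd α) = trig N (fun n => expo n (toCd α) • Y n) θ := by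
  simp [trig, expo_add_right, smul_smul]

theorem trig_clm (N : ℝ) (Y : (Fin d → ℤ) → CMat) (θ : Fin d → ℂ) (T : CMat →L[ℂ] CMat) :
    T (trig N Y θ) = trig N (fun n => T (Y n)) θ := by
  simp [trig]

theorem fcoef_trig (N : ℝ) (Y : (Fin d → ℤ) → CMat) (n : Fin d → ℤ) :
    fcoef (trig N Y) n = if n ∈ modes d N then Y n else 0 := by
  have := StripPer.fcoef_sum (r := 1) (modes d N) (F := fun m θ => expo m θ • Y m)
    (fun m _ => (StripPer.expo 1 m).smul (StripPer.const 1 (Y m))) one_pos n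
  unfold trig
  rw [this]
  simp [StripPer.fcoef_expo_smul]

theorem norm_trig_le {r N b : ℝ} {Y : (Fin d → ℤ) → CMat}
    (hY : ∀ n ∈ modes d N, ‖Y n‖ ≤ b * Real.exp (-(l1 n * r))) {θ : Fin d → ℂ}
    (hθ : θ ∈ strip d r) : ‖trig N Y θ‖ ≤ (modes d N).card * b := by
  rw [← nsmul_eq_mul]
  refine norm_sum_le_of_le _ (fun n hn => ?_) |>.trans (le_of_eq (Finset.sum_const _))
  rw [norm_smul]
  calc _ ≤ Real.exp (l1 n * r) * (b * Real.exp (-(l1 n * r))) :=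
        mul_le_mul (norm_expo_le n fun i => (hθ i).le) (hY n hn) (norm_nonneg _) (Real.exp_pos _).le
    _ = b * (Real.exp (l1 n * r) * Real.exp (-(l1 n * r))) := by ring
    _ = b := by rw [← Real.exp_add]; simp

theorem neg_mem_modes {N : ℝ} {n : Fin d → ℤ} : -n ∈ modes d N ↔ n ∈ modes d N := by
  rw [mem_modes, mem_modes, l1_neg]

theorem cj_trig_real (N : ℝ) (Y : (Fin d → ℤ) → CMat) (θ : Fin d → ℝ) :
    cj (trig N Y (toCd θ)) = trig N (fun n => cj (Y (-n))) (toCd θ) := by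
  rw [trig, trig, map_sum]
  refine Finset.sum_equiv (Equiv.neg _) (fun n => by simp [neg_mem_modes]) fun n _ => ?_
  rw [cj_smul, conj_expo_real]
  simp

theorem trace_trig {N : ℝ} {Y : (Fin d → ℤ) → CMat} (hY : ∀ n, (Y n).trace = 0)
    (θ : Fin d → ℂ) : (trig N Y θ).trace = 0 := by
  rw [trig, Matrix.trace_sum]
  exact Finset.sum_eq_zero fun n _ => by rw [Matrix.trace_smul, hY, smul_zero]

end TrigPolynomials

/-! ### Removal of finitely many Fourier modes by a contraction. -/

section Elimination

open NormedSpace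

variable {d : ℕ}

/-- Finitely many Fourier coefficients, rescaled by the weights `e^{-|n| r}` and extended by zero. -/
noncomputable def unweight (r N : ℝ) (y : modes d N → CMat) (n : Fin d → ℤ) : CMat :=
  if h : n ∈ modes d N then ((Real.exp (-(l1 n * r)) : ℝ) : ℂ) • y ⟨n, h⟩ else 0

theorem unweight_sub (r N : ℝ) (y y' : modes d N → CMat) (n : Fin d → ℤ) :
    unweight r N (y - y') n = unweight r N y n - unweight r N y' n := by
  unfold unweight
  split_ifs <;> simp [smul_sub]

theorem norm_unweight_le (r N : ℝ) (y : modes d N → CMat) {n : Fin d → ℤ} (hn : n ∈ modes d N) :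
    ‖unweight r N y n‖ ≤ ‖y‖ * Real.exp (-(l1 n * r)) := by
  rw [unweight, dif_pos hn, norm_smul, Complex.norm_real, Real.norm_of_nonneg (Real.exp_pos _).le,
    mul_comm]
  exact mul_le_mul_of_nonneg_right (norm_le_pi_norm y _) (Real.exp_pos _).le

/-- The nonlinear part of the conjugation by `e^{trig Y}`. -/
noncomputable def conjDefect (L : CMat →L[ℂ] CMat) (α : Fin d → ℝ) (f : (Fin d → ℂ) → CMat)
    (N : ℝ) (Y : (Fin d → ℤ) → CMat) (θ : Fin d → ℂ) : CMat :=
  exp (L (trig N Y (θ + toCd α))) * exp (f θ) * exp (-trig N Y θ) - 1 -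
    L (trig N Y (θ + toCd α)) + trig N Y θ

theorem stripPer_conjugation {r : ℝ} {f : (Fin d → ℂ) → CMat} (hf : StripPer r f)
    (L : CMat →L[ℂ] CMat) (α : Fin d → ℝ) (N : ℝ) (Y : (Fin d → ℤ) → CMat) :
    StripPer r (fun θ =>
      exp (L (trig N Y (θ + toCd α))) * exp (f θ) * exp (-trig N Y θ) - 1) :=
  (((((stripPer_trig r N Y).translate α).clm_comp L).exp.mul hf.exp).mul
    (stripPer_trig r N Y).neg.exp).sub (StripPer.const r 1)

theorem stripPer_conjDefect {r : ℝ} {f : (Fin d → ℂ) → CMat} (hf : StripPer r f)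
    (L : CMat →L[ℂ] CMat) (α : Fin d → ℝ) (N : ℝ) (Y : (Fin d → ℤ) → CMat) :
    StripPer r (conjDefect L α f N Y) :=
  ((stripPer_conjugation hf L α N Y).sub
    (((stripPer_trig r N Y).translate α).clm_comp L)).add (stripPer_trig r N Y)

/-- The defect commutes with the symmetry Y_n ↦ conj(Y_{-n}). The conjugate of a fixed point is
therefore a fixed point, and uniqueness makes the solution real. -/
theorem cj_conjDefect {f : (Fin d → ℂ) → CMat} (hf : ∀ θ : Fin d → ℝ, cj (f (toCd θ)) = f (toCd θ))
    {L : CMat →L[ℂ] CMat} (hL : ∀ X, cj (L X) = L (cj X)) (α : Fin d → ℝ) (N : ℝ)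
    (Y : (Fin d → ℤ) → CMat) (θ : Fin d → ℝ) :
    conjDefect L α f N (fun n => cj (Y (-n))) (toCd θ) = cj (conjDefect L α f N Y (toCd θ)) := by
  have h1 : toCd θ + toCd α = toCd (θ + α) := by funext i; simp [toCd]
  simp only [conjDefect, map_add, map_sub, map_mul, map_one, cj_exp, map_neg, hL, hf, h1,
    cj_trig_real]

/-- Elimination of the Fourier modes in the range of `z L S - S` by a conjugation close to the
identity. -/
theorem exists_elimination {r : ℝ} (hr : 0 < r) {N : ℝ} (α : Fin d → ℝ)
    {f : (Fin d → ℂ) → CMat} (hf : StripPer r f)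
    (hfr : ∀ θ : Fin d → ℝ, cj (f (toCd θ)) = f (toCd θ))
    {L : CMat →L[ℂ] CMat} (hL : ∀ X, cj (L X) = L (cj X))
    {S : (Fin d → ℤ) → CMat →L[ℂ] CMat} (hS : ∀ n X, cj (S n X) = S (-n) (cj X))
    (hStr : ∀ n X, (S n X).trace = 0)
    {a q s e : ℝ} (ha : 1 ≤ a) (hq : ((modes d N).card : ℝ) ≤ q) (hq1 : 1 ≤ q) (hs : 1 ≤ s)
    (he : 0 < e) (hLa : ∀ X, ‖L X‖ ≤ a * ‖X‖)
    (hSs : ∀ n ∈ modes d N, ∀ X, ‖S n X‖ ≤ s * ‖X‖)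
    (hfe : ∀ θ ∈ strip d r, ‖f θ‖ ≤ e) (hsmall : 108 * (a * q * s) ^ 2 * e ≤ 1) :
    ∃ Y W : (Fin d → ℤ) → CMat,
      (∀ n, (Y n).trace = 0) ∧ (∀ n, cj (Y (-n)) = Y n) ∧
      (∀ θ ∈ strip d r, ‖trig N Y θ‖ ≤ 2 * q * s * e) ∧
      (∀ θ ∈ strip d r, ‖exp (L (trig N Y (θ + toCd α))) * exp (f θ) * exp (-trig N Y θ) - 1‖ ≤
        6 * (a * q * s) * e) ∧
      (∀ n, ‖W n - fcoef f n‖ ≤ 108 * (a * q * s) ^ 2 * e ^ 2 * Real.exp (-(l1 n * r))) ∧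
      ∀ n ∈ modes d N,
        fcoef (fun θ => exp (L (trig N Y (θ + toCd α))) * exp (f θ) * exp (-trig N Y θ) - 1) n =
          W n + (expo n (toCd α) • L (-S n (W n)) + S n (W n)) := by
  set k := a * q * s with hk
  have haq : 1 ≤ a * q := by nlinarith
  have hk1 : 1 ≤ k := by nlinarith
  have hke : 108 * k * (k * e) ≤ 1 := by nlinarith
  have hke' : k * e ≤ 1 / 108 := by nlinarith [mul_pos (lt_of_lt_of_le one_pos hk1) he]
  have hqsk : q * s ≤ k := by
    rw [hk, mul_assoc]; nlinarith [mul_le_mul hq1 hs zero_le_one (by linarith)]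
  have hqs0 : 0 < q * s := by positivity
  -- pointwise bounds
  have hY : ∀ y : modes d N → CMat, ∀ θ ∈ strip d r, ‖trig N (unweight r N y) θ‖ ≤ q * ‖y‖ :=
    fun y θ hθ => (norm_trig_le (fun n hn => norm_unweight_le r N y hn) hθ).trans
      (mul_le_mul_of_nonneg_right hq (norm_nonneg _))
  have hZ : ∀ y : modes d N → CMat, ∀ θ ∈ strip d r,
      ‖L (trig N (unweight r N y) (θ + toCd α))‖ ≤ a * (q * ‖y‖) := fun y θ hθ =>
    (hLa _).trans (mul_le_mul_of_nonneg_left (hY y _ (add_real_mem_strip hθ α)) (by linarith))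
  -- The defect has size at most 2e on the ball, and solving for Y costs a factor s; this radius
  -- makes the ball invariant.
  set ρ := 2 * s * e with hρ
  have hball : ∀ y : modes d N → CMat, ‖y‖ ≤ ρ → ∀ θ ∈ strip d r,
      ‖L (trig N (unweight r N y) (θ + toCd α))‖ ≤ 2 * k * e ∧
      ‖-trig N (unweight r N y) θ‖ ≤ 2 * k * e := fun y hy θ hθ => by
    constructor
    · refine (hZ y θ hθ).trans ?_
      calc a * (q * ‖y‖) ≤ a * (q * (2 * s * e)) := by gcongr
        _ = _ := by rw [hk]; ring
    · rw [norm_neg]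
      refine (hY y θ hθ).trans ?_
      calc q * ‖y‖ ≤ q * (2 * s * e) := by gcongr
        _ = 2 * (q * s) * e := by ring
        _ ≤ _ := by gcongr
  have hω : 2 * k * e + e ≤ 3 * (k * e) := by nlinarith
  have hω' : 2 * k * e + e ≤ 1 / 2 := by linarith
  -- Lipschitz estimate for the defect
  have hlip : ∀ y y' : modes d N → CMat, ‖y‖ ≤ ρ → ‖y'‖ ≤ ρ → ∀ θ ∈ strip d r,
      ‖conjDefect L α f N (unweight r N y) θ - conjDefect L α f N (unweight r N y') θ‖ ≤
        36 * (k * e) * (a * q) * ‖y - y'‖ := fun y y' hy hy' θ hθ => by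
    obtain ⟨h1, h2⟩ := hball y hy θ hθ
    obtain ⟨h3, h4⟩ := hball y' hy' θ hθ
    have h5 := norm_exp_triple_sub_le h1 h3 h2 h4 (hfe θ hθ) hω'
    have hd : ∀ θ, trig N (unweight r N (y - y')) θ =
        trig N (unweight r N y) θ - trig N (unweight r N y') θ := fun θ => by
      rw [← trig_sub]; congr 1; funext n; exact unweight_sub r N y y' n
    have h6 := hZ (y - y') θ hθ
    have h7 := hY (y - y') θ hθ
    rw [hd, map_sub] at h6
    rw [hd, ← norm_neg, neg_sub] at h7
    have e1 : conjDefect L α f N (unweight r N y) θ - conjDefect L α f N (unweight r N y') θ =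
        (exp (L (trig N (unweight r N y) (θ + toCd α))) * exp (f θ) *
          exp (-trig N (unweight r N y) θ) - L (trig N (unweight r N y) (θ + toCd α)) -
          -trig N (unweight r N y) θ) -
        (exp (L (trig N (unweight r N y') (θ + toCd α))) * exp (f θ) *
          exp (-trig N (unweight r N y') θ) - L (trig N (unweight r N y') (θ + toCd α)) -
          -trig N (unweight r N y') θ) := by
      simp only [conjDefect]; abel
    rw [e1]
    refine h5.trans ?_
    have h8 : ‖-trig N (unweight r N y) θ - -trig N (unweight r N y') θ‖ ≤
        a * (q * ‖y - y'‖) := by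
      rw [neg_sub_neg]
      exact h7.trans (le_mul_of_one_le_left (by positivity) ha)
    calc _ ≤ 6 * (3 * (k * e)) * (a * (q * ‖y - y'‖) + a * (q * ‖y - y'‖)) := by gcongr
      _ = _ := by ring
  have hquad : ∀ y : modes d N → CMat, ‖y‖ ≤ ρ → ∀ θ ∈ strip d r,
      ‖conjDefect L α f N (unweight r N y) θ - f θ‖ ≤ 108 * k ^ 2 * e ^ 2 := fun y hy θ hθ => by
    obtain ⟨h1, h2⟩ := hball y hy θ hθ
    have hpos : 0 ≤ 2 * k * e := by positivity
    -- Comparison with u' = v' = 0 isolates e^f, whose own nonlinear part is quadratic in e.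
    have h5 := norm_exp_triple_sub_le h1 (u' := 0) (by simpa using hpos) h2 (v' := 0)
      (by simpa using hpos) (hfe θ hθ) hω'
    have h6 := norm_exp_sub_one_sub_le (f θ)
    have h7 := real_exp_sub_one_le (norm_nonneg (f θ)) ((hfe θ hθ).trans (by linarith))
    have h8 : ‖exp (f θ) - 1 - f θ‖ ≤ 2 * e * e :=
      h6.trans (mul_le_mul (h7.trans (by linarith [hfe θ hθ])) (hfe θ hθ) (norm_nonneg _)
        (by positivity))
    simp only [exp_zero, one_mul, mul_one, sub_zero] at h5
    have e1 : conjDefect L α f N (unweight r N y) θ - f θ =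
        (exp (L (trig N (unweight r N y) (θ + toCd α))) * exp (f θ) *
          exp (-trig N (unweight r N y) θ) - L (trig N (unweight r N y) (θ + toCd α)) -
          -trig N (unweight r N y) θ - exp (f θ)) + (exp (f θ) - 1 - f θ) := by
      simp only [conjDefect]; abel
    rw [e1]
    refine (norm_add_le_of_le h5 h8).trans ?_
    calc _ ≤ 6 * (2 * k * e + e) * (2 * k * e + 2 * k * e) + 2 * e * e := by gcongr
      _ ≤ 12 * (3 * (k * e)) * (3 * (k * e)) := by nlinarith [mul_pos he he]
      _ = _ := by ring
  have hdef : ∀ y : modes d N → CMat, ‖y‖ ≤ ρ → ∀ θ ∈ strip d r,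
      ‖conjDefect L α f N (unweight r N y) θ‖ ≤ 2 * e := fun y hy θ hθ => by
    have h1 := hquad y hy θ hθ
    calc _ = ‖(conjDefect L α f N (unweight r N y) θ - f θ) + f θ‖ := by rw [sub_add_cancel]
      _ ≤ 108 * k ^ 2 * e ^ 2 + e := norm_add_le_of_le h1 (hfe θ hθ)
      _ ≤ 2 * e := by nlinarith
  -- the fixed point map
  set T : (modes d N → CMat) → (modes d N → CMat) := fun y n =>
    -(((Real.exp (l1 n.1 * r) : ℝ) : ℂ) • S n.1 (fcoef (conjDefect L α f N (unweight r N y)) n.1))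
    with hT
  have hTn : ∀ (n : modes d N) (X : CMat) (b : ℝ), ‖X‖ ≤ b * Real.exp (-(l1 n.1 * r)) →
      ‖((Real.exp (l1 n.1 * r) : ℝ) : ℂ) • S n.1 X‖ ≤ s * b := fun n X b hX => by
    rw [norm_smul, Complex.norm_real, Real.norm_of_nonneg (Real.exp_pos _).le]
    calc _ ≤ Real.exp (l1 n.1 * r) * (s * (b * Real.exp (-(l1 n.1 * r)))) := by
          refine mul_le_mul_of_nonneg_left ((hSs n.1 n.2 X).trans ?_) (Real.exp_pos _).le
          exact mul_le_mul_of_nonneg_left hX (by linarith)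
      _ = s * b * (Real.exp (l1 n.1 * r) * Real.exp (-(l1 n.1 * r))) := by ring
      _ = s * b := by rw [← Real.exp_add]; simp
  have hmaps : ∀ y, ‖y‖ ≤ ρ → ‖T y‖ ≤ ρ := fun y hy => by
    refine (pi_norm_le_iff_of_nonneg (by positivity)).2 fun n => ?_
    simp only [hT, norm_neg]
    refine (hTn n _ (2 * e) ((stripPer_conjDefect hf L α N _).norm_fcoef_le hr
      (hdef y hy) n.1)).trans (le_of_eq ?_)
    rw [hρ]; ring
  have hcontr : ∀ y y', ‖y‖ ≤ ρ → ‖y'‖ ≤ ρ → ‖T y - T y'‖ ≤ 1 / 2 * ‖y - y'‖ :=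
    fun y y' hy hy' => by
    refine (pi_norm_le_iff_of_nonneg (by positivity)).2 fun n => ?_
    have h1 := ((stripPer_conjDefect hf L α N (unweight r N y)).sub
      (stripPer_conjDefect hf L α N (unweight r N y'))).norm_fcoef_le hr (hlip y y' hy hy') n.1
    rw [(stripPer_conjDefect hf L α N _).fcoef_sub (stripPer_conjDefect hf L α N _) hr] at h1
    have h2 := hTn n _ _ h1
    have e1 : (T y - T y') n = -(((Real.exp (l1 n.1 * r) : ℝ) : ℂ) •
        S n.1 (fcoef (conjDefect L α f N (unweight r N y)) n.1 -
          fcoef (conjDefect L α f N (unweight r N y')) n.1)) := by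
      simp only [hT, Pi.sub_apply, map_sub, smul_sub]; abel
    rw [e1, norm_neg]
    refine h2.trans ?_
    -- With 108k²e ≤ 1 the contraction factor 36k²e is at most 1/3.
    have h3 : s * (36 * (k * e) * (a * q) * ‖y - y'‖) = 36 * k * (k * e) * ‖y - y'‖ := by
      rw [hk]; ring
    rw [h3]
    exact mul_le_mul_of_nonneg_right (by linarith) (norm_nonneg _)
  -- existence of the fixed point
  have hmapsTo : Set.MapsTo T (Metric.closedBall 0 ρ) (Metric.closedBall 0 ρ) := fun y hy => by
    rw [mem_closedBall_zero_iff] at hy ⊢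
    exact hmaps y hy
  have hcw : ContractingWith (1 / 2 : NNReal) (hmapsTo.restrict T _ _) := by
    refine ⟨by norm_num, LipschitzWith.of_dist_le_mul fun y y' => ?_⟩
    have hy := mem_closedBall_zero_iff.1 y.2
    have hy' := mem_closedBall_zero_iff.1 y'.2
    have := hcontr y.1 y'.1 hy hy'
    rw [Subtype.dist_eq, Subtype.dist_eq, dist_eq_norm, dist_eq_norm]
    simpa using this
  obtain ⟨y, hyb, hyfix, -⟩ := hcw.exists_fixedPoint' (Metric.isClosed_closedBall.isComplete) hmapsTo
    (x := 0) (Metric.mem_closedBall_self (by positivity)) (edist_ne_top _ _)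
  rw [mem_closedBall_zero_iff] at hyb
  have hfix : T y = y := hyfix
  -- reality of the fixed point
  set y' : modes d N → CMat := fun n => cj (y ⟨-n.1, neg_mem_modes.2 n.2⟩) with hy'
  have hun : unweight r N y' = fun n => cj (unweight r N y (-n)) := by
    funext n
    unfold unweight
    by_cases h : n ∈ modes d N
    · rw [dif_pos h, dif_pos (neg_mem_modes.2 h), cj_smul, Complex.conj_ofReal, l1_neg]
    · rw [dif_neg h, dif_neg (fun h' => h (neg_mem_modes.1 h')), map_zero]
  have hy'b : ‖y'‖ ≤ ρ := (pi_norm_le_iff_of_nonneg (by positivity)).2 fun n => by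
    rw [hy', norm_cj]
    exact (norm_le_pi_norm y _).trans hyb
  have hfix' : T y' = y' := by
    funext n
    have h1 := (stripPer_conjDefect hf L α N (unweight r N y)).fcoef_conj hr
      (cj_conjDefect hfr hL α N (unweight r N y)) n.1
    have h2 := congrFun hfix ⟨-n.1, neg_mem_modes.2 n.2⟩
    simp only [hT] at h2
    simp only [hT, hun, h1]
    change _ = cj (y ⟨-n.1, neg_mem_modes.2 n.2⟩)
    rw [← h2, map_neg, cj_smul, hS, Complex.conj_ofReal, neg_neg, l1_neg]
  -- Two fixed points in the same ball on which the map contracts coincide.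
  have hyy' : y' = y := by
    have h1 := hcontr y' y hy'b hyb
    rw [hfix, hfix'] at h1
    have h2 : ‖y' - y‖ ≤ 0 := by linarith
    exact sub_eq_zero.1 (norm_le_zero_iff.1 h2)
  -- conclusion
  set Y := unweight r N y with hYdef
  set W : (Fin d → ℤ) → CMat := fcoef (conjDefect L α f N Y) with hW
  have hYW : ∀ n ∈ modes d N, Y n = -S n (W n) := fun n hn => by
    have h2 := congrFun hfix ⟨n, hn⟩
    simp only [hT] at h2
    rw [hYdef, unweight, dif_pos hn, ← h2, smul_neg, smul_smul, ← Complex.ofReal_mul,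
      ← Real.exp_add]
    simp [hW, hYdef]
  refine ⟨Y, W, fun n => ?_, fun n => ?_, fun θ hθ => ?_, fun θ hθ => ?_, fun n => ?_,
    fun n hn => ?_⟩
  · by_cases h : n ∈ modes d N
    · rw [hYW n h, Matrix.trace_neg, hStr, neg_zero]
    · simp [hYdef, unweight, h]
  · have := congrFun hun n
    rw [hyy'] at this
    exact this.symm
  · refine (hY y θ hθ).trans ?_
    calc q * ‖y‖ ≤ q * (2 * s * e) := by gcongr
      _ = _ := by ring
  · obtain ⟨h1, h2⟩ := hball y hyb θ hθ
    rw [norm_neg] at h2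
    have h3 := hdef y hyb θ hθ
    have e1 : exp (L (trig N Y (θ + toCd α))) * exp (f θ) * exp (-trig N Y θ) - 1 =
        conjDefect L α f N Y θ + L (trig N Y (θ + toCd α)) - trig N Y θ := by
      simp only [conjDefect]; abel
    rw [e1]
    refine (norm_sub_le_of_le (norm_add_le_of_le h3 h1) h2).trans ?_
    nlinarith
  · have h1 := ((stripPer_conjDefect hf L α N Y).sub hf).norm_fcoef_le hr (hquad y hyb) n
    rwa [(stripPer_conjDefect hf L α N _).fcoef_sub hf hr] at h1
  -- The linear part is added back to the defect: mode n becomes W_n + zLY_n − Y_n, and the fixed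
  -- point equation says Y_n = −S_n W_n.
  · have e1 : (fun θ => exp (L (trig N Y (θ + toCd α))) * exp (f θ) * exp (-trig N Y θ) - 1) =
        fun θ => conjDefect L α f N Y θ +
          (trig N (fun n => L (expo n (toCd α) • Y n)) θ - trig N Y θ) := by
      funext θ
      rw [← trig_clm, ← trig_translate]
      simp only [conjDefect]; abel
    rw [e1, (stripPer_conjDefect hf L α N Y).fcoef_add
      ((stripPer_trig r N _).sub (stripPer_trig r N _)) hr,
      (stripPer_trig r N _).fcoef_sub (stripPer_trig r N _) hr, fcoef_trig, fcoef_trig,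
      if_pos hn, if_pos hn, hYW n hn, map_smul, sub_neg_eq_add]

end Elimination

/-! ### Factorisation of unimodular functions near the identity. -/

section Splitting

open NormedSpace

theorem mul_self_of_trace_zero {X : CMat} (h : X.trace = 0) : X * X = (-X.det) • 1 := by
  have := Matrix.mul_adjugate X
  rw [adjugate_of_trace_zero h] at this
  rw [neg_smul, ← this]; simp

theorem det_smul_one_add {X : CMat} (h : X.trace = 0) (w : ℂ) :
    (w • 1 + X).det = w ^ 2 + X.det := by
  rw [Matrix.trace_fin_two] at h
  simp [Matrix.det_fin_two]
  linear_combination w * h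

/-- On trace-free matrices det X = −tr(X²)/2 is a quadratic form, so the difference is given by its
polarisation. -/
theorem norm_det_sub_det_le {X Y : CMat} (hX : X.trace = 0) (hY : Y.trace = 0) :
    ‖X.det - (X + Y).det‖ ≤ (2 * ‖X‖ + ‖Y‖) * ‖Y‖ := by
  have e : X.det - (X + Y).det = (X * Y + Y * X + Y * Y).trace / 2 := by
    rw [Matrix.trace_fin_two] at hX hY
    simp [Matrix.det_fin_two, Matrix.trace_fin_two, Matrix.mul_apply, Fin.sum_univ_two]
    linear_combination (-(Y 0 0 + Y 1 1)) * hX - (Y 0 0 + Y 1 1) / 2 * hY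
  rw [e, norm_div, Complex.norm_ofNat, div_le_iff₀ two_pos]
  refine (norm_trace_le _).trans ?_
  have h1 := norm_mul_le X Y
  have h2 := norm_mul_le Y X
  have h3 := norm_mul_le Y Y
  have h4 := norm_add₃_le (a := X * Y) (b := Y * X) (c := Y * Y)
  nlinarith

theorem norm_det_le_of_trace_zero {X : CMat} (hX : X.trace = 0) : ‖X.det‖ ≤ ‖X‖ ^ 2 := by
  have := norm_det_sub_det_le (X := 0) (Y := X) (by simp) hX
  simpa [sq] using this

theorem exists_sqrt_one_sub {Δ : ℝ} (h : |Δ| ≤ 1 / 2) :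
    ∃ u : ℝ, u ^ 2 = 1 - Δ ∧ |u - 1| ≤ |Δ| ∧ 0 < u := by
  have h1 := abs_le.1 h
  have hu : Real.sqrt (1 - Δ) ^ 2 = 1 - Δ := Real.sq_sqrt (by linarith)
  have hu0 : 0 < Real.sqrt (1 - Δ) := Real.sqrt_pos.2 (by linarith)
  refine ⟨Real.sqrt (1 - Δ), hu, ?_, hu0⟩
  have e : (Real.sqrt (1 - Δ) - 1) * (Real.sqrt (1 - Δ) + 1) = -Δ := by linear_combination hu
  have e2 := congrArg abs e
  rw [abs_mul, abs_neg] at e2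
  rw [← e2]
  refine le_mul_of_one_le_right (abs_nonneg _) ?_
  rw [abs_of_pos (by linarith)]; linarith

/-- The trace-free part of a matrix. -/
noncomputable def traceFree : CMat →L[ℂ] CMat :=
  LinearMap.toContinuousLinearMap
    (LinearMap.id - (LinearMap.toSpanSingleton ℂ CMat ((1 / 2 : ℂ) • (1 : CMat))).comp
      (Matrix.traceLinearMap (Fin 2) ℂ ℂ))

theorem traceFree_apply (X : CMat) : traceFree X = X - (X.trace / 2) • (1 : CMat) := by
  simp [traceFree, LinearMap.toSpanSingleton, smul_smul, div_eq_mul_inv]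

theorem trace_traceFree (X : CMat) : (traceFree X).trace = 0 := by
  simp [traceFree_apply, Matrix.trace_sub, Matrix.trace_smul]

theorem traceFree_of_trace_zero {X : CMat} (h : X.trace = 0) : traceFree X = X := by
  simp [traceFree_apply, h]

theorem norm_traceFree_le (X : CMat) : ‖traceFree X‖ ≤ 2 * ‖X‖ := by
  rw [traceFree_apply]
  refine (norm_sub_le _ _).trans ?_
  rw [norm_smul, norm_div, Complex.norm_ofNat, norm_one]
  linarith [norm_trace_le X]

theorem trace_cj (X : CMat) : (cj X).trace = starRingEnd ℂ X.trace := by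
  simp [Matrix.trace_fin_two, cj_apply]

theorem cj_traceFree (X : CMat) : cj (traceFree X) = traceFree (cj X) := by
  rw [traceFree_apply, traceFree_apply, map_sub, cj_smul, trace_cj, map_one, map_div₀,
    Complex.conj_ofNat]

/-- The trace lies in 2πiℤ and has modulus at most 1/2. -/
theorem trace_eq_zero_of_exp {X : CMat} (h : (exp X).det = 1) (hX : ‖X‖ ≤ 1 / 4) :
    X.trace = 0 := by
  rw [det_exp_eq, Complex.exp_eq_one_iff] at h
  obtain ⟨n, hn⟩ := h
  have h1 := norm_trace_le X
  rw [hn] at h1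
  have h2 : ‖(n : ℂ) * (2 * Real.pi * Complex.I)‖ = |(n : ℝ)| * (2 * Real.pi) := by
    simp [abs_of_pos Real.pi_pos]
  rw [h2] at h1
  have h3 : n = 0 := by
    by_contra h0
    have : (1 : ℝ) ≤ |(n : ℝ)| := by exact_mod_cast Int.one_le_abs h0
    nlinarith [Real.pi_gt_three]
  rw [hn, h3]; simp

/-- Near the identity, a cocycle whose trace-free part is close to a function `c` of constant
determinant factors as `(u + c) e^φ` with small `φ`. -/
theorem exists_splitting : ∃ δ : ℝ, 0 < δ ∧ δ ≤ 1 / 16 ∧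
    ∀ (d : ℕ) (r γ Δ : ℝ) (H c : (Fin d → ℂ) → CMat), StripPer r H → StripPer r c →
    (∀ θ : Fin d → ℝ, cj (H (toCd θ)) = H (toCd θ)) →
    (∀ θ : Fin d → ℝ, cj (c (toCd θ)) = c (toCd θ)) →
    (∀ θ ∈ strip d r, (H θ).det = 1) → (∀ θ ∈ strip d r, (c θ).trace = 0) →
    (∀ θ ∈ strip d r, (c θ).det = (Δ : ℂ)) → |Δ| ≤ 1 / 10 →
    (∀ θ ∈ strip d r, ‖c θ‖ ≤ 1 / 10) → (∀ θ ∈ strip d r, ‖H θ - 1‖ ≤ 1 / 10) →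
    (∀ θ ∈ strip d r, ‖traceFree (H θ) - c θ‖ ≤ γ) → γ < δ → 0 < r →
    ∃ (u : ℝ) (φ : (Fin d → ℂ) → CMat), u ^ 2 = 1 - Δ ∧ |u - 1| ≤ |Δ| ∧ StripPer r φ ∧
      (∀ θ : Fin d → ℝ, cj (φ (toCd θ)) = φ (toCd θ)) ∧
      (∀ θ ∈ strip d r, (φ θ).trace = 0) ∧
      (∀ θ ∈ strip d r, ((u : ℂ) • 1 + c θ) * exp (φ θ) = H θ) ∧
      ∀ θ ∈ strip d r, ‖φ θ‖ ≤ 4 * γ := by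
  obtain ⟨δ₀, hδ₀, hδ₀', ℓ, hℓan, hℓ⟩ := exists_local_log CMat
  refine ⟨δ₀ / 2, by positivity, by linarith, ?_⟩
  intro d r γ Δ H c hH hc hHr hcr hdet hctr hcdet hΔ hcn hHn hg hγ hr
  obtain ⟨u, hu, hu1, hu0⟩ := exists_sqrt_one_sub (Δ := Δ) (by linarith)
  have hub := abs_le.1 (hu1.trans hΔ)
  -- By Cayley–Hamilton c² = −Δ, so u − c is the inverse of u + c as soon as u² = 1 − Δ. Thus P
  -- should be e^φ.
  set P : (Fin d → ℂ) → CMat := fun θ => ((u : ℂ) • 1 - c θ) * H θ with hP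
  have hPper : StripPer r P := ((StripPer.const r _).sub hc).mul hH
  have huC : (u : ℂ) ^ 2 = 1 - (Δ : ℂ) := by exact_mod_cast hu
  have hinv : ∀ θ ∈ strip d r, ((u : ℂ) • 1 - c θ) * ((u : ℂ) • 1 + c θ) = 1 ∧
      ((u : ℂ) • 1 + c θ) * ((u : ℂ) • 1 - c θ) = 1 := fun θ hθ => by
    have h1 := mul_self_of_trace_zero (hctr θ hθ)
    rw [hcdet θ hθ] at h1
    have h2 : ((u : ℂ) ^ 2) • (1 : CMat) - c θ * c θ = 1 := by
      rw [h1, huC, ← sub_smul]; simp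
    constructor
    · refine Eq.trans ?_ h2
      simp only [sub_mul, mul_add, smul_mul_assoc, mul_smul_comm, one_mul, mul_one, sq, smul_smul, smul_sub]
      abel
    · refine Eq.trans ?_ h2
      simp only [add_mul, mul_sub, smul_mul_assoc, mul_smul_comm, one_mul, mul_one, sq, smul_smul, smul_add]
      abel
  have hP1 : ∀ θ ∈ strip d r, ‖P θ - 1‖ ≤ 2 * γ := fun θ hθ => by
    set g := traceFree (H θ) - c θ with hgdef
    set w := (H θ).trace / 2 with hw
    have hγ0 : 0 ≤ γ := (norm_nonneg _).trans (hg θ hθ)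
    have hgtr : g.trace = 0 := by
      rw [hgdef, Matrix.trace_sub, trace_traceFree, hctr θ hθ, sub_zero]
    have hHd : H θ = w • 1 + (c θ + g) := by
      rw [hgdef, traceFree_apply]; abel
    have hd := hdet θ hθ
    rw [hHd, det_smul_one_add (by rw [Matrix.trace_add, hctr θ hθ, hgtr, add_zero])] at hd
    -- Both w² and u² are 1 minus the determinant of a trace-free matrix, and these matrices differ
    -- by g. Since w + u stays away from zero, the scalar parts differ by O(γ) too.
    have hww : (w - u) * (w + u) = (c θ).det - (c θ + g).det := by
      rw [hcdet θ hθ]; linear_combination hd - huC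
    have hw1 : ‖w - 1‖ ≤ 1 / 10 := by
      have h1 := norm_trace_le (H θ - 1)
      have h2 : w - 1 = (H θ - 1).trace / 2 := by
        rw [Matrix.trace_sub, Matrix.trace_one, hw]; simp; ring
      rw [h2, norm_div, Complex.norm_ofNat]
      linarith [hHn θ hθ]
    have hwu : 1 ≤ ‖w + u‖ := by
      have h1 : (9 / 10 : ℝ) ≤ w.re := by
        have := (Complex.abs_re_le_norm (w - 1)).trans hw1
        have := abs_le.1 this
        simp at this; linarith
      have h2 : (w + u).re ≤ ‖w + u‖ := Complex.re_le_norm _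
      simp at h2; linarith
    have h3 := norm_det_sub_det_le (hctr θ hθ) hgtr
    rw [← hww, norm_mul] at h3
    have hgγ := hg θ hθ
    have hwu2 : ‖w - u‖ ≤ γ / 2 := by
      have h4 : ‖w - u‖ ≤ ‖w - u‖ * ‖w + u‖ := le_mul_of_one_le_right (norm_nonneg _) hwu
      have h5 : (2 * ‖c θ‖ + ‖g‖) * ‖g‖ ≤ (2 * (1 / 10) + 1 / 10) * γ := by
        have := hcn θ hθ
        have : ‖g‖ ≤ 1 / 10 := by linarith
        gcongr
      linarith
    have hE : P θ - 1 = ((u : ℂ) • 1 - c θ) * ((w - u) • 1 + g) := by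
      have : P θ - 1 = ((u : ℂ) • 1 - c θ) * (H θ - ((u : ℂ) • 1 + c θ)) := by
        rw [mul_sub, (hinv θ hθ).1]
      rw [this, hHd, sub_smul]
      congr 1; abel
    have huc : ‖(u : ℂ) • (1 : CMat) - c θ‖ ≤ 6 / 5 := by
      refine (norm_sub_le _ _).trans ?_
      rw [norm_smul, norm_one, Complex.norm_real, Real.norm_of_nonneg hu0.le]
      linarith [hcn θ hθ]
    have hwg : ‖(w - u) • (1 : CMat) + g‖ ≤ 3 / 2 * γ := by
      refine (norm_add_le _ _).trans ?_
      rw [norm_smul, norm_one]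
      linarith
    rw [hE]
    calc _ ≤ 6 / 5 * (3 / 2 * γ) := (norm_mul_le _ _).trans (mul_le_mul huc hwg (norm_nonneg _)
          (by norm_num))
      _ ≤ 2 * γ := by linarith
  have hPball : ∀ θ ∈ strip d r, P θ ∈ Metric.ball (1 : CMat) δ₀ := fun θ hθ => by
    rw [mem_ball_iff_norm]
    linarith [hP1 θ hθ]
  have hexp : ∀ θ ∈ strip d r, exp (ℓ (P θ)) = P θ := fun θ hθ => (hℓ _ (hPball θ hθ)).1
  have hφn : ∀ θ ∈ strip d r, ‖ℓ (P θ)‖ ≤ 4 * γ := fun θ hθ =>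
    (hℓ _ (hPball θ hθ)).2.trans (by linarith [hP1 θ hθ])
  refine ⟨u, fun θ => ℓ (P θ), hu, hu1, ⟨?_, ?_, 4 * γ, hφn⟩, ?_, ?_, ?_, hφn⟩
  · intro θ hθ
    exact (hℓan _ (hPball θ hθ)).comp (hPper.analytic θ hθ)
  · intro θ hθ n
    simp only [hPper.periodic θ hθ n]
  · intro θ
    have hθ := toCd_mem_strip hr θ
    have h1 := hφn _ hθ
    have h2 : cj (P (toCd θ)) = P (toCd θ) := by
      simp only [hP, map_mul, map_sub, cj_smul, map_one, hcr, hHr, Complex.conj_ofReal]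
    refine exp_injOn_small ?_ ?_ ?_
    · rw [norm_cj]; linarith
    · linarith
    · rw [← cj_exp, hexp _ hθ, h2]
  · intro θ hθ
    refine trace_eq_zero_of_exp ?_ (by linarith [hφn θ hθ])
    rw [hexp θ hθ, hP, Matrix.det_mul, hdet θ hθ, mul_one, sub_eq_add_neg,
      det_smul_one_add (by rw [Matrix.trace_neg, hctr θ hθ, neg_zero]), huC, Matrix.det_neg,
      hcdet θ hθ]
    simp
  · intro θ hθ
    rw [hexp θ hθ, hP, ← mul_assoc, (hinv θ hθ).2, one_mul]

end Splitting

/-! ### Distance to 2πℤ and lower bounds for divisors. -/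

section SmallDivisors

theorem bddBelow_distTwoPi (x : ℂ) :
    BddBelow (Set.range fun j : ℤ => ‖x - 2 * (Real.pi : ℂ) * (j : ℂ)‖) :=
  ⟨0, by rintro _ ⟨j, rfl⟩; exact norm_nonneg _⟩

theorem distTwoPi_le (x : ℂ) (j : ℤ) : distTwoPi x ≤ ‖x - 2 * (Real.pi : ℂ) * (j : ℂ)‖ :=
  ciInf_le (bddBelow_distTwoPi x) j

theorem distTwoPi_nonneg (x : ℂ) : 0 ≤ distTwoPi x := Real.iInf_nonneg fun _ => norm_nonneg _

theorem distTwoPi_neg (x : ℂ) : distTwoPi (-x) = distTwoPi x := by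
  rw [distTwoPi, distTwoPi, ← (Equiv.neg ℤ).iInf_comp]
  congr 1
  funext j
  rw [← norm_neg]
  congr 1
  simp; ring

theorem exists_lt_of_distTwoPi_lt {x : ℂ} {c : ℝ} (h : distTwoPi x < c) :
    ∃ j : ℤ, ‖x - 2 * (Real.pi : ℂ) * (j : ℂ)‖ < c := exists_lt_of_ciInf_lt h

theorem distTwoPi_add_le (x y : ℂ) : distTwoPi (x + y) ≤ distTwoPi x + distTwoPi y := by
  refine le_of_forall_pos_lt_add fun ε hε => ?_
  obtain ⟨i, hi⟩ := exists_lt_of_distTwoPi_lt (lt_add_of_pos_right (distTwoPi x) (half_pos hε))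
  obtain ⟨j, hj⟩ := exists_lt_of_distTwoPi_lt (lt_add_of_pos_right (distTwoPi y) (half_pos hε))
  have h1 := distTwoPi_le (x + y) (i + j)
  have e : x + y - 2 * (Real.pi : ℂ) * ((i + j : ℤ) : ℂ) =
      (x - 2 * Real.pi * i) + (y - 2 * Real.pi * j) := by push_cast; ring
  rw [e] at h1
  linarith [norm_add_le (x - 2 * Real.pi * i) (y - 2 * Real.pi * j)]

theorem distTwoPi_sub_le (x y : ℂ) : distTwoPi (x - y) ≤ distTwoPi x + distTwoPi y := by
  rw [sub_eq_add_neg, ← distTwoPi_neg y]; exact distTwoPi_add_le _ _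

/-- Passing to the real part decreases the distance to `2πℤ`. -/
theorem distTwoPi_re_le (x : ℂ) : distTwoPi (x.re : ℂ) ≤ distTwoPi x := by
  refine ciInf_mono (bddBelow_distTwoPi _) fun j => ?_
  have e : (x.re : ℂ) - 2 * (Real.pi : ℂ) * (j : ℂ) =
      (((x - 2 * (Real.pi : ℂ) * (j : ℂ)).re : ℝ) : ℂ) := by simp
  rw [e, Complex.norm_real]
  exact Complex.abs_re_le_norm _

/-- With w = x + iy one has |e^w − 1|² = (e^x − 1)² + 4e^x sin²(y/2); convexity bounds the first
square and Jordan's inequality the second. -/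
theorem norm_exp_sub_one_lower {w : ℂ} (h0 : 0 ≤ w.re) (hπ : |w.im| ≤ Real.pi) :
    ‖w‖ / 2 ≤ ‖Complex.exp w - 1‖ := by
  have h1 : ‖Complex.exp w - 1‖ ^ 2 = (Real.exp w.re - 1) ^ 2 +
      4 * Real.exp w.re * Real.sin (w.im / 2) ^ 2 := by
    rw [Complex.sq_norm, Complex.normSq_apply]
    simp only [Complex.sub_re, Complex.sub_im, Complex.exp_re, Complex.exp_im, Complex.one_re,
      Complex.one_im, sub_zero]
    have h2 : Real.cos w.im = 1 - 2 * Real.sin (w.im / 2) ^ 2 := by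
      have := Real.cos_sq' (w.im / 2)
      have h3 := Real.cos_two_mul (w.im / 2)
      rw [mul_div_cancel₀ _ (two_ne_zero)] at h3
      linarith
    have h4 := Real.sin_sq_add_cos_sq w.im
    have h5 : Real.exp w.re ^ 2 * (Real.sin w.im ^ 2 + Real.cos w.im ^ 2) = Real.exp w.re ^ 2 := by
      rw [h4, mul_one]
    linear_combination h5 - 2 * Real.exp w.re * h2
  have h2 : w.re ≤ Real.exp w.re - 1 := by linarith [Real.add_one_le_exp w.re]
  have h3 : 1 ≤ Real.exp w.re := by linarith
  have h4 : (2 / Real.pi * (|w.im| / 2)) ≤ |Real.sin (w.im / 2)| := by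
    have := Real.mul_abs_le_abs_sin (x := w.im / 2) (by rw [abs_div, abs_two]; linarith)
    rwa [abs_div, abs_two] at this
  have h5 : |w.im| / 4 ≤ |Real.sin (w.im / 2)| := by
    refine le_trans ?_ h4
    have : 1 / 2 ≤ 2 / Real.pi := by
      rw [div_le_div_iff₀ two_pos Real.pi_pos]; linarith [Real.pi_le_four]
    nlinarith [abs_nonneg w.im]
  have h6 : (|w.im| / 4) ^ 2 ≤ Real.sin (w.im / 2) ^ 2 := by
    rw [← sq_abs (Real.sin _)]; exact pow_le_pow_left₀ (by positivity) h5 2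
  rw [div_pow, sq_abs] at h6
  have h7 : ‖w‖ ^ 2 = w.re ^ 2 + w.im ^ 2 := by
    rw [Complex.sq_norm, Complex.normSq_apply]; ring
  refine le_of_sq_le_sq ?_ (norm_nonneg _)
  rw [div_pow, h7, h1]
  nlinarith [sq_nonneg (Real.sin (w.im / 2))]

/-- After subtracting the nearest multiple of 2π, the previous bound applies to whichever of e^{iy}
− 1 and e^{-iy} − 1 has exponent of nonnegative real part. Switching between them costs a factor
e^{-Im x}. -/
theorem norm_exp_I_mul_sub_one_lower (x : ℂ) :
    1 / 2 * min 1 (Real.exp (-x.im)) * distTwoPi x ≤ ‖Complex.exp (Complex.I * x) - 1‖ := by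
  set j := round (x.re / (2 * Real.pi)) with hj
  set y := x - 2 * (Real.pi : ℂ) * (j : ℂ) with hy
  have hre : |y.re| ≤ Real.pi := by
    have h1 := abs_sub_round (x.re / (2 * Real.pi))
    have h2 : y.re = 2 * Real.pi * (x.re / (2 * Real.pi) - j) := by
      have := Real.pi_ne_zero
      simp [hy]; field_simp
    rw [h2, abs_mul, abs_of_pos Real.two_pi_pos]
    nlinarith [Real.pi_pos]
  have him : y.im = x.im := by simp [hy]
  have hexp : Complex.exp (Complex.I * x) = Complex.exp (Complex.I * y) := by
    rw [Complex.exp_eq_exp_iff_exists_int]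
    exact ⟨j, by rw [hy]; ring⟩
  have hd : distTwoPi x ≤ ‖y‖ := distTwoPi_le x j
  have hny : ‖Complex.I * y‖ = ‖y‖ := by simp
  rw [hexp]
  have hm : 0 ≤ min 1 (Real.exp (-x.im)) := le_min zero_le_one (Real.exp_pos _).le
  rcases le_total 0 (Complex.I * y).re with h | h
  · have h1 := norm_exp_sub_one_lower h (by simpa using hre)
    rw [hny] at h1
    have h2 := min_le_left 1 (Real.exp (-x.im))
    nlinarith [distTwoPi_nonneg x]
  · have h1 := norm_exp_sub_one_lower (w := -(Complex.I * y)) (by simpa using h)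
      (by simpa using hre)
    rw [norm_neg, hny] at h1
    have h3 : Complex.exp (Complex.I * y) - 1 =
        -(Complex.exp (Complex.I * y) * (Complex.exp (-(Complex.I * y)) - 1)) := by
      generalize Complex.I * y = v
      rw [mul_sub, ← Complex.exp_add]; simp
    have h4 : ‖Complex.exp (Complex.I * y)‖ = Real.exp (-x.im) := by
      rw [Complex.norm_exp]; simp [him]
    rw [h3, norm_neg, norm_mul, h4]
    have h2 := min_le_right 1 (Real.exp (-x.im))
    have h5 : min 1 (Real.exp (-x.im)) * distTwoPi x ≤ Real.exp (-x.im) * ‖y‖ :=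
      mul_le_mul h2 hd (distTwoPi_nonneg x) (Real.exp_pos _).le
    nlinarith [Real.exp_pos (-x.im)]

variable {d : ℕ}

theorem expo_toCd (n : Fin d → ℤ) (α : Fin d → ℝ) :
    expo n (toCd α) = Complex.exp (Complex.I * (pairing n α : ℂ)) := by
  simp [expo, pairing, toCd]

theorem pairing_neg (n : Fin d → ℤ) (α : Fin d → ℝ) : pairing (-n) α = -pairing n α := by
  simp [pairing]

theorem pairing_add (m n : Fin d → ℤ) (α : Fin d → ℝ) :
    pairing (m + n) α = pairing m α + pairing n α := by
  simp [pairing, add_mul, Finset.sum_add_distrib]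

theorem IsDC.lower {κ τ N : ℝ} {α : Fin d → ℝ} (h : IsDC κ τ α) (hκ : 0 < κ) (hτ : 0 < τ)
    {n : Fin d → ℤ} (hn : n ≠ 0) (hN : l1 n ≤ N) : κ / N ^ τ < distTwoPi (pairing n α : ℂ) := by
  have h1 := one_le_l1 hn
  refine lt_of_le_of_lt ?_ (h n hn)
  exact div_le_div_of_nonneg_left hκ.le (by positivity)
    (Real.rpow_le_rpow (by linarith) hN hτ.le)

theorem trace_of_hasEigenvaluePair {A : RMat} {ρ : ℂ} (h : HasEigenvaluePair A ρ) :
    A.toC.trace = Complex.exp (Complex.I * ρ) + Complex.exp (-(Complex.I * ρ)) := by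
  rw [Matrix.trace_eq_sum_roots_charpoly, h]; simp

theorem norm_exp_le_of_trace {t w : ℂ} (h : t = Complex.exp w + Complex.exp (-w)) :
    ‖Complex.exp w‖ ≤ ‖t‖ + 1 := by
  rcases le_total ‖Complex.exp w‖ 1 with h1 | h1
  · linarith [norm_nonneg t]
  · have h2 : ‖Complex.exp (-w)‖ ≤ 1 := by
      rw [Complex.exp_neg, norm_inv]; exact inv_le_one_of_one_le₀ h1
    have h3 : Complex.exp w = t - Complex.exp (-w) := by rw [h]; ring
    calc ‖Complex.exp w‖ = ‖t - Complex.exp (-w)‖ := by rw [← h3]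
      _ ≤ _ := (norm_sub_le _ _).trans (by linarith)

/-- A lower bound for `e^{i(±2ρ + y)} - 1` with real `y`, where `2 cos ρ` is the trace. -/
theorem norm_exp_two_mul_sub_one_lower {t ρ : ℂ} {a : ℝ} (ha : 1 ≤ a) (ht : ‖t‖ ≤ 2 * a)
    (h : t = Complex.exp (Complex.I * ρ) + Complex.exp (-(Complex.I * ρ))) (y : ℝ) :
    1 / (18 * a ^ 2) * distTwoPi (2 * ρ + y) ≤ ‖Complex.exp (Complex.I * (2 * ρ + y)) - 1‖ := by
  have h1 : ‖Complex.exp (-(Complex.I * ρ))‖ ≤ 3 * a := by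
    refine (norm_exp_le_of_trace (t := t) (w := -(Complex.I * ρ)) ?_).trans (by linarith)
    rw [h, neg_neg, add_comm]
  -- The trace bounds the eigenvalues, hence Im ρ. The constant 18a² below is 2·(3a)².
  have h2 : Real.exp ρ.im ≤ 3 * a := by
    rw [Complex.norm_exp] at h1
    simpa using h1
  have h3 : (2 * ρ + y).im = 2 * ρ.im := by simp
  have h4 : 1 / (9 * a ^ 2) ≤ min 1 (Real.exp (-(2 * ρ + y).im)) := by
    refine le_min ?_ ?_
    · rw [div_le_one (by positivity)]; nlinarith
    · rw [h3, Real.exp_neg, ← one_div]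
      refine one_div_le_one_div_of_le (Real.exp_pos _) ?_
      rw [two_mul, Real.exp_add]
      nlinarith [Real.exp_pos ρ.im]
  refine le_trans ?_ (norm_exp_I_mul_sub_one_lower _)
  refine mul_le_mul_of_nonneg_right ?_ (distTwoPi_nonneg _)
  calc 1 / (18 * a ^ 2) = 1 / 2 * (1 / (9 * a ^ 2)) := by field_simp; norm_num
    _ ≤ _ := by linarith

end SmallDivisors

/-! ### The resolvent of the adjoint action on trace-free matrices. -/

section Resolvent

/-- Conjugation `X ↦ A⁻¹ X A`. -/
noncomputable def conjL (A : CMat) : CMat →L[ℂ] CMat :=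
  ContinuousLinearMap.mulLeftRight ℂ CMat A⁻¹ A

theorem conjL_apply (A X : CMat) : conjL A X = A⁻¹ * X * A := by
  simp [conjL]

theorem norm_conjL_le {A : CMat} (hA : A.det = 1) (X : CMat) : ‖conjL A X‖ ≤ ‖A‖ ^ 2 * ‖X‖ := by
  rw [conjL_apply]
  calc _ ≤ ‖A⁻¹‖ * ‖X‖ * ‖A‖ :=
        (norm_mul_le _ _).trans (mul_le_mul_of_nonneg_right (norm_mul_le _ _) (norm_nonneg _))
    _ ≤ ‖A‖ * ‖X‖ * ‖A‖ := by
        have := norm_inv_le_of_det hA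
        gcongr
    _ = _ := by ring

theorem trace_conjL {A : CMat} (hA : A.det = 1) (X : CMat) : (conjL A X).trace = X.trace := by
  rw [conjL_apply, Matrix.trace_mul_comm, ← mul_assoc,
    Matrix.mul_nonsing_inv _ (isUnit_det_of_det hA), one_mul]

/-- This is Cayley–Hamilton for AX with one X cancelled: AXA = tr(AX)A − det(A)·adj X, and adj X =
−X. -/
theorem mul_mul_self_of_trace_zero {A X : CMat} (hA : A.det = 1) (hX : X.trace = 0) :
    A * X * A = (A * X).trace • A + X := by
  rw [Matrix.trace_fin_two] at hX
  rw [Matrix.det_fin_two] at hA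
  have h11 : X 1 1 = -X 0 0 := by linear_combination hX
  ext i j
  fin_cases i <;> fin_cases j <;>
    simp [Matrix.trace_fin_two, Matrix.mul_apply, Fin.sum_univ_two, h11]
  · linear_combination (X 0 0) * hA
  · linear_combination (X 0 1) * hA
  · linear_combination (X 1 0) * hA
  · linear_combination (-X 0 0) * hA

/-- Conjugation by A has eigenvalues 1 and the squares of the two eigenvalues of A, whose sum is p =
(tr A)² − 2. Its characteristic equation is verified directly, so diagonalisability is not needed.
-/
theorem conjL_cubic {A X : CMat} (hA : A.det = 1) (hX : X.trace = 0) {p : ℂ}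
    (hp : p = A.trace ^ 2 - 2) :
    conjL A (conjL A (conjL A X)) - (1 + p) • conjL A (conjL A X) + (1 + p) • conjL A X - X = 0 := by
  have hA' : A⁻¹.det = 1 := by rw [inv_eq_adjugate hA, Matrix.det_adjugate, hA]; simp
  have h1 := mul_mul_self_of_trace_zero hA hX
  have h2 := mul_mul_self_of_trace_zero hA' hX
  have hi : A * A⁻¹ = 1 := Matrix.mul_nonsing_inv _ (isUnit_det_of_det hA)
  have hi' : A⁻¹ * A = 1 := Matrix.nonsing_inv_mul _ (isUnit_det_of_det hA)
  set t := A.trace with ht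
  have h3 : A + A⁻¹ = t • 1 := by
    rw [inv_eq_adjugate hA, Matrix.adjugate_fin_two, ht, Matrix.trace_fin_two]
    ext i j; fin_cases i <;> fin_cases j <;> simp [add_comm]
  set c₁ := (A * X).trace
  set c₂ := (A⁻¹ * X).trace
  set B := A⁻¹
  have hBB : B * B = t • B - 1 := by
    have : (A + B) * B = t • B := by rw [h3]; simp
    rw [add_mul, hi] at this
    rw [← this]; abel
  have hAA : A * A = t • A - 1 := by
    have : (A + B) * A = t • A := by rw [h3]; simp
    rw [add_mul, hi'] at this
    rw [← this]; abel
  have e1 : t • (B * X) = B * X * A + B * X * B := by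
    rw [← mul_add, h3]; simp
  have e2 : t • (X * A) = A * X * A + B * X * A := by
    rw [← add_mul, ← add_mul, h3]; simp
  -- The quadratic factor of the cubic sends X into the span of A and A⁻¹, which conjugation by A
  -- fixes; the factor L − 1 then kills it.
  have hZ : B * (B * X * A) * A - p • (B * X * A) + X = -(c₁ • A + c₂ • B) := by
    have e3 : B * (B * X * A) * A = (B * B) * X * (A * A) := by noncomm_ring
    rw [e3, hBB, hAA]
    have e4 : (t • B - 1) * X * (t • A - 1) =
        (t ^ 2) • (B * X * A) - t • (B * X) - t • (X * A) + X := by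
      simp only [sub_mul, mul_sub, smul_mul_assoc, mul_smul_comm, one_mul, mul_one, smul_smul, sq,
        smul_sub]
      abel
    rw [e4, e1, e2, h1, h2, hp, sub_smul, two_smul]
    abel
  simp only [conjL_apply]
  have hfin : B * (B * (B * X * A) * A - p • (B * X * A) + X) * A =
      B * (B * X * A) * A - p • (B * X * A) + X := by
    rw [hZ]
    simp only [mul_neg, neg_mul, mul_add, add_mul, smul_mul_assoc, mul_smul_comm]
    rw [hi', one_mul, mul_assoc B B A, hi', mul_one]
  have e5 : B * (B * (B * X * A) * A - p • (B * X * A) + X) * A =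
      B * (B * (B * X * A) * A) * A - p • (B * (B * X * A) * A) + B * X * A := by
    simp only [mul_sub, sub_mul, mul_add, add_mul, smul_mul_assoc, mul_smul_comm]
  rw [e5] at hfin
  rw [add_smul, add_smul, one_smul, one_smul]
  rw [← sub_eq_zero] at hfin
  rw [← hfin]; abel

/-- The characteristic polynomial of the adjoint action on trace-free matrices. -/
def adPoly (p w : ℂ) : ℂ := w ^ 3 - (1 + p) * w ^ 2 + (1 + p) * w - 1

/-- The solution operator of `w⁻¹ A⁻¹ Y A - Y = X` on trace-free matrices. -/
noncomputable def adSolve (A : CMat) (p w : ℂ) : CMat →L[ℂ] CMat :=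
  (-(w / adPoly p w)) • (conjL A ∘L conjL A + (w - 1 - p) • conjL A +
    (w ^ 2 - (1 + p) * w + (1 + p)) • ContinuousLinearMap.id ℂ CMat) ∘L traceFree

theorem adSolve_apply (A : CMat) (p w : ℂ) (X : CMat) :
    adSolve A p w X = (-(w / adPoly p w)) • (conjL A (conjL A (traceFree X)) +
      (w - 1 - p) • conjL A (traceFree X) + (w ^ 2 - (1 + p) * w + (1 + p)) • traceFree X) := by
  simp [adSolve]

/-- Let χ be the characteristic polynomial of L and w = z⁻¹. Since χ(L) = 0, dividing χ(L) − χ(w) by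
L − w gives (L − w)⁻¹ = −Q(L)/χ(w) with Q quadratic, and zL − 1 = z(L − w). -/
theorem adSolve_spec {A : CMat} (hA : A.det = 1) {p w z : ℂ} (hp : p = A.trace ^ 2 - 2)
    (hzw : z * w = 1) (hP : adPoly p w ≠ 0) (X : CMat) :
    z • conjL A (adSolve A p w X) - adSolve A p w X = traceFree X := by
  have hc := conjL_cubic hA (trace_traceFree X) hp
  rw [adSolve_apply, map_smul]
  simp only [map_add, map_smul]
  set X₀ := traceFree X
  set X₁ := conjL A X₀
  set X₂ := conjL A X₁
  set X₃ := conjL A X₂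
  have h3 : X₃ = (1 + p) • X₂ - (1 + p) • X₁ + X₀ := by
    rw [← sub_eq_zero, ← hc]; abel
  rw [h3]
  have hz : z = w⁻¹ := eq_inv_of_mul_eq_one_left hzw
  have hw : w ≠ 0 := right_ne_zero_of_mul_eq_one hzw
  subst hz
  match_scalars <;> field_simp <;> unfold adPoly <;> ring

theorem trace_adSolve {A : CMat} (hA : A.det = 1) (p w : ℂ) (X : CMat) :
    (adSolve A p w X).trace = 0 := by
  rw [adSolve_apply]
  simp [Matrix.trace_smul, Matrix.trace_add, trace_conjL hA, trace_traceFree]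

theorem cj_conjL {A : CMat} (hA : A.det = 1) (hAr : cj A = A) (X : CMat) :
    cj (conjL A X) = conjL A (cj X) := by
  have h : cj A⁻¹ = A⁻¹ := by
    symm
    refine Matrix.inv_eq_left_inv ?_
    calc cj A⁻¹ * A = cj A⁻¹ * cj A := by rw [hAr]
      _ = 1 := by rw [← map_mul, Matrix.nonsing_inv_mul _ (isUnit_det_of_det hA), map_one]
  rw [conjL_apply, conjL_apply, map_mul, map_mul, hAr, h]

theorem cj_adSolve {A : CMat} (hA : A.det = 1) (hAr : cj A = A) {p : ℂ}
    (hp : starRingEnd ℂ p = p) (w : ℂ) (X : CMat) :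
    cj (adSolve A p w X) = adSolve A p (starRingEnd ℂ w) (cj X) := by
  simp only [adSolve_apply, cj_smul, map_add, cj_conjL hA hAr, cj_traceFree, map_neg, map_div₀,
    map_sub, map_mul, map_pow, map_one, hp, adPoly]

theorem norm_adSolve_le {A : CMat} (hA : A.det = 1) {p w : ℂ} {a : ℝ} (ha : 1 ≤ a) (hAa : ‖A‖ ≤ a)
    (hp : ‖p‖ ≤ 6 * a ^ 2) (hw : ‖w‖ = 1) (X : CMat) :
    ‖adSolve A p w X‖ ≤ 48 * a ^ 4 / ‖adPoly p w‖ * ‖X‖ := by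
  have h0 := norm_traceFree_le X
  have hL : ∀ Y, ‖conjL A Y‖ ≤ a ^ 2 * ‖Y‖ := fun Y => (norm_conjL_le hA Y).trans (by gcongr)
  have h1 := hL (traceFree X)
  have h2 := (hL (conjL A (traceFree X))).trans (mul_le_mul_of_nonneg_left h1 (by positivity))
  have c1 : ‖w - 1 - p‖ ≤ 8 * a ^ 2 := by
    refine (norm_sub_le_of_le (norm_sub_le_of_le hw.le norm_one.le) hp).trans ?_
    nlinarith
  have c2 : ‖w ^ 2 - (1 + p) * w + (1 + p)‖ ≤ 15 * a ^ 2 := by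
    have h3 : ‖1 + p‖ ≤ 1 + 6 * a ^ 2 := norm_add_le_of_le norm_one.le hp
    have h4 : ‖(1 + p) * w‖ ≤ 1 + 6 * a ^ 2 := by rw [norm_mul, hw, mul_one]; exact h3
    have h5 : ‖w ^ 2‖ ≤ 1 := by rw [norm_pow, hw]; norm_num
    refine (norm_add_le_of_le (norm_sub_le_of_le h5 h4) h3).trans ?_
    nlinarith
  rw [adSolve_apply, norm_smul, norm_neg, norm_div, hw]
  have h6 : ‖conjL A (conjL A (traceFree X)) + (w - 1 - p) • conjL A (traceFree X) +
      (w ^ 2 - (1 + p) * w + (1 + p)) • traceFree X‖ ≤ 48 * a ^ 4 * ‖X‖ := by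
    refine norm_add₃_le.trans ?_
    rw [norm_smul, norm_smul]
    have k1 : ‖w - 1 - p‖ * ‖conjL A (traceFree X)‖ ≤ (8 * a ^ 2) * (a ^ 2 * (2 * ‖X‖)) :=
      mul_le_mul c1 (h1.trans (by gcongr)) (norm_nonneg _) (by positivity)
    have k2 : ‖w ^ 2 - (1 + p) * w + (1 + p)‖ * ‖traceFree X‖ ≤ (15 * a ^ 2) * (2 * ‖X‖) :=
      mul_le_mul c2 h0 (norm_nonneg _) (by positivity)
    have k3 : ‖conjL A (conjL A (traceFree X))‖ ≤ a ^ 2 * (a ^ 2 * (2 * ‖X‖)) :=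
      h2.trans (by gcongr)
    have k4 : a ^ 2 ≤ a ^ 4 := pow_le_pow_right₀ ha (by norm_num)
    nlinarith [norm_nonneg X, mul_le_mul_of_nonneg_right k4 (norm_nonneg X)]
  calc _ ≤ 1 / ‖adPoly p w‖ * (48 * a ^ 4 * ‖X‖) := by gcongr
    _ = _ := by ring

/-- The cubic splits into the three divisors w − 1 and w − e^{±2iρ}. Each is bounded below by a
distance to 2πℤ, and 648 = 2·18². -/
theorem norm_adPoly_lower {t ρ : ℂ} {a : ℝ} (ha : 1 ≤ a) (ht : ‖t‖ ≤ 2 * a)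
    (h : t = Complex.exp (Complex.I * ρ) + Complex.exp (-(Complex.I * ρ))) (x : ℝ) :
    1 / (648 * a ^ 4) * (distTwoPi (x : ℂ) * (distTwoPi (2 * ρ + x) * distTwoPi (2 * ρ - x))) ≤
      ‖adPoly (t ^ 2 - 2) (Complex.exp (-(Complex.I * x)))‖ := by
  have h1 := norm_exp_I_mul_sub_one_lower (x : ℂ)
  have h2 := norm_exp_two_mul_sub_one_lower ha ht h x
  have h3 := norm_exp_two_mul_sub_one_lower (ρ := -ρ) ha ht (by rw [h]; simp [add_comm]) x
  have e3 : distTwoPi (2 * -ρ + x) = distTwoPi (2 * ρ - x) := by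
    rw [← distTwoPi_neg]; congr 1; ring
  rw [e3] at h3
  simp only [Complex.ofReal_im, neg_zero, Real.exp_zero, min_self, mul_one] at h1
  set w := Complex.exp (-(Complex.I * x)) with hw
  set E := Complex.exp (Complex.I * ρ) with hE
  set E' := Complex.exp (-(Complex.I * ρ)) with hE'
  have hEE : E * E' = 1 := by rw [hE, hE', ← Complex.exp_add]; simp
  have hfac : adPoly (t ^ 2 - 2) w = (w - 1) * ((w - E ^ 2) * (w - E' ^ 2)) := by
    rw [adPoly, h]
    linear_combination (2 * w - 2 * w ^ 2 - (E * E' + 1) * (w - 1)) * hEE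
  have hwn : ‖w‖ = 1 := by
    rw [hw, Complex.norm_exp]; simp
  have n1 : ‖w - 1‖ = ‖Complex.exp (Complex.I * x) - 1‖ := by
    have : w - 1 = -(w * (Complex.exp (Complex.I * x) - 1)) := by
      rw [mul_sub, hw, ← Complex.exp_add]; simp
    rw [this, norm_neg, norm_mul, hwn, one_mul]
  have n2 : ‖w - E ^ 2‖ = ‖Complex.exp (Complex.I * (2 * ρ + x)) - 1‖ := by
    have : w - E ^ 2 = -(w * (Complex.exp (Complex.I * (2 * ρ + x)) - 1)) := by
      rw [mul_sub, hw, hE, ← Complex.exp_add, ← Complex.exp_nat_mul]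
      push_cast; ring_nf
    rw [this, norm_neg, norm_mul, hwn, one_mul]
  have n3 : ‖w - E' ^ 2‖ = ‖Complex.exp (Complex.I * (2 * -ρ + x)) - 1‖ := by
    have : w - E' ^ 2 = -(w * (Complex.exp (Complex.I * (2 * -ρ + x)) - 1)) := by
      rw [mul_sub, hw, hE', ← Complex.exp_add, ← Complex.exp_nat_mul]
      push_cast; ring_nf
    rw [this, norm_neg, norm_mul, hwn, one_mul]
  rw [hfac, norm_mul, norm_mul, n1, n2, n3]
  have d1 := distTwoPi_nonneg (x : ℂ)
  have d2 := distTwoPi_nonneg (2 * ρ + x)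
  have d3 := distTwoPi_nonneg (2 * ρ - x)
  calc _ = (1 / 2 * distTwoPi (x : ℂ)) * ((1 / (18 * a ^ 2) * distTwoPi (2 * ρ + x)) *
        (1 / (18 * a ^ 2) * distTwoPi (2 * ρ - x))) := by field_simp; ring
    _ ≤ _ := mul_le_mul h1 (mul_le_mul h2 h3 (by positivity) (norm_nonneg _)) (by positivity)
        (norm_nonneg _)

end Resolvent

/-! ### Passage between periodic strip functions and real-valued function spaces. -/

section StripAnalytic

variable {d : ℕ}

/-- The Fourier coefficients are integrals over real points and therefore vanish; the Fourier series
represents the function on the whole strip. -/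
theorem StripPer.eqOn_zero_of_real {r : ℝ} {F : (Fin d → ℂ) → ℂ} (hF : StripPer r F) (hr : 0 < r)
    (h : ∀ θ : Fin d → ℝ, F (toCd θ) = 0) {θ : Fin d → ℂ} (hθ : θ ∈ strip d r) : F θ = 0 := by
  have h1 := hF.hasSum_fcoef_scalar hr hθ
  have h2 : ∀ n, fcoef F n = 0 := fun n => by
    simp [fcoef, torusMean, torusLift, slice, h]
  simp only [h2, smul_zero] at h1
  exact h1.unique hasSum_zero

/-- The trace as a continuous linear functional. -/
noncomputable def traceL : CMat →L[ℂ] ℂ :=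
  (Matrix.traceLinearMap (Fin 2) ℂ ℂ).toContinuousLinearMap

theorem traceL_apply (X : CMat) : traceL X = X.trace := rfl

theorem IsStripAnalytic.stripPer {r : ℝ} {S : Set RMat} {F : (Fin d → ℂ) → CMat}
    (h : IsStripAnalytic r (2 * Real.pi) S F) : StripPer r F :=
  ⟨h.analytic, h.periodic, h.bounded⟩

theorem IsStripAnalytic.cj_eq {r L : ℝ} {S : Set RMat} {F : (Fin d → ℂ) → CMat}
    (h : IsStripAnalytic r L S F) (θ : Fin d → ℝ) : cj (F (toCd θ)) = F (toCd θ) := by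
  obtain ⟨X, -, hX⟩ := h.real_valued θ
  rw [hX, cj_toC]

theorem IsStripAnalytic.trace_eq_zero {r : ℝ} (hr : 0 < r) {F : (Fin d → ℂ) → CMat}
    (h : IsStripAnalytic r (2 * Real.pi) sl2R F) {θ : Fin d → ℂ} (hθ : θ ∈ strip d r) :
    (F θ).trace = 0 := by
  refine (h.stripPer.clm_comp traceL).eqOn_zero_of_real hr (fun θ => ?_) hθ
  obtain ⟨X, hX, e⟩ := h.real_valued θ
  have hX' : X.trace = 0 := hX
  rw [traceL_apply, e, trace_toC, hX', Complex.ofReal_zero]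

theorem IsStripAnalytic.norm_le {r L : ℝ} {S : Set RMat} {F : (Fin d → ℂ) → CMat}
    (h : IsStripAnalytic r L S F) {b : ℝ} (hb : stripNorm r F ≤ b) {θ : Fin d → ℂ}
    (hθ : θ ∈ strip d r) : ‖F θ‖ ≤ b := by
  obtain ⟨K, hK⟩ := h.bounded
  refine le_trans ?_ hb
  exact le_ciSup (f := fun θ : strip d r => ‖F θ.1‖)
    ⟨K, by rintro _ ⟨θ, rfl⟩; exact hK θ.1 θ.2⟩ ⟨θ, hθ⟩

theorem stripNorm_le {r : ℝ} (hr : 0 < r) {F : (Fin d → ℂ) → CMat} {b : ℝ}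
    (h : ∀ θ ∈ strip d r, ‖F θ‖ ≤ b) : stripNorm r F ≤ b := by
  have : Nonempty (strip d r) := ⟨⟨toCd 0, toCd_mem_strip hr 0⟩⟩
  exact ciSup_le fun θ => h θ.1 θ.2

theorem realNorm_le {F : (Fin d → ℂ) → CMat} {b : ℝ}
    (h : ∀ θ : Fin d → ℝ, ‖F (toCd θ)‖ ≤ b) : realNorm F ≤ b := ciSup_le h

theorem StripPer.isStripAnalytic {r : ℝ} {F : (Fin d → ℂ) → CMat} (hF : StripPer r F)
    {S : Set RMat} (h : ∀ θ : Fin d → ℝ, ∃ X ∈ S, F (toCd θ) = X.toC) :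
    IsStripAnalytic r (2 * Real.pi) S F :=
  ⟨hF.analytic, hF.bounded, hF.periodic, h⟩

theorem StripPer.isStripAnalytic_double {r : ℝ} {F : (Fin d → ℂ) → CMat} (hF : StripPer r F)
    {S : Set RMat} (h : ∀ θ : Fin d → ℝ, ∃ X ∈ S, F (toCd θ) = X.toC) :
    IsStripAnalytic r (4 * Real.pi) S F := by
  refine ⟨hF.analytic, hF.bounded, fun θ hθ n => ?_, h⟩
  rw [← hF.periodic θ hθ (fun i => 2 * n i)]
  congr 1
  funext i
  push_cast; ring

theorem exists_sl2R_of_cj {X : CMat} (h : cj X = X) (ht : X.trace = 0) :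
    ∃ Y ∈ sl2R, X = Y.toC := by
  obtain ⟨Y, rfl⟩ := exists_toC_of_cj h
  refine ⟨Y, ?_, rfl⟩
  rw [trace_toC] at ht
  exact_mod_cast ht

theorem exists_SL2R_of_cj {X : CMat} (h : cj X = X) (ht : X.det = 1) :
    ∃ Y ∈ SL2R, X = Y.toC := by
  obtain ⟨Y, rfl⟩ := exists_toC_of_cj h
  refine ⟨Y, ?_, rfl⟩
  rw [det_toC] at ht
  exact_mod_cast ht

theorem traceFree_one : traceFree 1 = 0 := by
  simp [traceFree_apply, Matrix.trace_one]

theorem exp_conjL {A : CMat} (hA : A.det = 1) (X : CMat) :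
    A * NormedSpace.exp (conjL A X) = NormedSpace.exp X * A := by
  have hU : IsUnit A := (Matrix.isUnit_iff_isUnit_det A).2 (isUnit_det_of_det hA)
  rw [conjL_apply, Matrix.exp_conj' _ _ hU, ← mul_assoc, ← mul_assoc,
    Matrix.mul_nonsing_inv _ (isUnit_det_of_det hA), one_mul]

theorem norm_toC_SL_ge (A : Matrix.SpecialLinearGroup (Fin 2) ℝ) : 1 ≤ ‖(A : RMat)‖ := by
  rw [← norm_toC]
  exact one_le_norm_of_det (by rw [det_toC, A.2]; simp)

end StripAnalytic

/-! ### The non-resonant conjugation step. -/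

section NonResonant

open NormedSpace

variable {d : ℕ}

/-- The radius for which `exists_splitting` holds. -/
noncomputable def splitRadius : ℝ := exists_splitting.choose

theorem splitRadius_pos : 0 < splitRadius := exists_splitting.choose_spec.1

set_option maxHeartbeats 1000000 in
/-- The conjugation step in the absence of resonances. -/
theorem nonresonant_step {r r' : ℝ} (hr' : 0 < r') (hrr' : r' < r) {N : ℝ} (hN : 1 ≤ N)
    {κ τ : ℝ} (hκ : 0 < κ) (hτ : 0 < τ) {α : Fin d → ℝ} (hα : IsDC κ τ α)
    {A : Matrix.SpecialLinearGroup (Fin 2) ℝ} {ρ : ℂ} (hρ : HasEigenvaluePair (A : RMat) ρ)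
    {f : (Fin d → ℂ) → CMat} (hf : IsStripAnalytic r (2 * Real.pi) sl2R f)
    {ε η a q s γ δ : ℝ} (hε : 0 < ε) (hε1 : ε ≤ 1 / 100) (hη : 0 < η) (ha : a = ‖(A : RMat)‖)
    (hq : q = (3 * N) ^ d)
    (hs : 48 * 648 * a ^ 8 * N ^ τ / (κ * η ^ 2) ≤ s) (hs1 : 1 ≤ s)
    (hfε : ∀ θ ∈ strip d r, ‖f θ‖ ≤ ε)
    (hres : ∀ m : Fin d → ℤ, 0 < l1 m → l1 m ≤ N → η ≤ distTwoPi (2 * ρ - (pairing m α : ℂ)))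
    (hsmall : 432 * (a ^ 2 * q * s) ^ 2 * ε ≤ 1)
    (hδ : 0 < δ) (hδ' : δ ≤ r - r')
    (hγ : 12 * (a ^ 2 * q * s) * ε * (Real.exp (-(N * (r - r' - δ))) * (2 + 2 / δ) ^ d) ≤ γ)
    (hγ' : γ < splitRadius) :
    ∃ (B : (Fin d → ℂ) → CMat) (Ap : Matrix.SpecialLinearGroup (Fin 2) ℝ)
      (fp : (Fin d → ℂ) → CMat),
      IsStripAnalytic r' (4 * Real.pi) SL2R B ∧ IsStripAnalytic r' (2 * Real.pi) sl2R fp ∧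
      (∀ θ ∈ strip d r',
        B (fun i => θ i + (α i : ℂ)) * (RMat.toC A * NormedSpace.exp (f θ)) * (B θ)⁻¹ =
          RMat.toC Ap * NormedSpace.exp (fp θ)) ∧
      stripNorm r' (fun θ => B θ - 1) ≤ 4 * q * s * ε ∧ stripNorm r' fp ≤ 4 * γ ∧
      ‖(Ap : RMat) - (A : RMat)‖ ≤ 2 * ‖(A : RMat)‖ * ε := by
  have hr : 0 < r := hr'.trans hrr'
  set Ac := RMat.toC A with hAc
  have hAdet : Ac.det = 1 := by rw [hAc, det_toC, A.2]; simp
  have hAcj : cj Ac = Ac := cj_toC _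
  have hAn : ‖Ac‖ = a := by rw [hAc, norm_toC, ha]
  have ha1 : 1 ≤ a := by rw [ha]; exact norm_toC_SL_ge A
  have hq1 : 1 ≤ q := by rw [hq]; exact one_le_pow₀ (by linarith)
  have hqc : ((modes d N).card : ℝ) ≤ q := by rw [hq]; exact card_modes_le hN
  set t := Ac.trace with ht
  have htr : t = Complex.exp (Complex.I * ρ) + Complex.exp (-(Complex.I * ρ)) :=
    trace_of_hasEigenvaluePair hρ
  have htn : ‖t‖ ≤ 2 * a := by rw [← hAn]; exact norm_trace_le _
  set p := t ^ 2 - 2 with hp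
  have hpn : ‖p‖ ≤ 6 * a ^ 2 := by
    refine (norm_sub_le _ _).trans ?_
    rw [norm_pow, Complex.norm_ofNat]
    nlinarith [norm_nonneg t]
  have hpr : starRingEnd ℂ p = p := by
    have : starRingEnd ℂ t = t := by rw [ht, ← trace_cj, hAcj]
    rw [hp, map_sub, map_pow, this, Complex.conj_ofNat]
  set w : (Fin d → ℤ) → ℂ := fun n => Complex.exp (-(Complex.I * (pairing n α : ℂ))) with hw
  have hwn : ∀ n, ‖w n‖ = 1 := fun n => by
    simp only [hw]; rw [Complex.norm_exp]; simp
  have hzw : ∀ n, expo n (toCd α) * w n = 1 := fun n => by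
    rw [expo_toCd, hw, ← Complex.exp_add, add_neg_cancel, Complex.exp_zero]
  have hwneg : ∀ n, w (-n) = starRingEnd ℂ (w n) := fun n => by
    simp only [hw]
    rw [← Complex.exp_conj, pairing_neg]
    simp
  have hNτ : 0 < N ^ τ := Real.rpow_pos_of_pos (by linarith) _
  have hPlow : ∀ n ∈ modes d N, n ≠ 0 → κ * η ^ 2 / (648 * a ^ 4 * N ^ τ) ≤ ‖adPoly p (w n)‖ := by
    intro n hn hn0
    rw [mem_modes] at hn
    have h1 := norm_adPoly_lower ha1 htn htr (pairing n α)
    refine le_trans ?_ h1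
    have d1 := (hα.lower hκ hτ hn0 hn).le
    have hpos : 0 < l1 n := by linarith [one_le_l1 hn0]
    have d2 := hres n hpos hn
    have d3 := hres (-n) (by rwa [l1_neg]) (by rwa [l1_neg])
    rw [pairing_neg, Complex.ofReal_neg, sub_neg_eq_add] at d3
    calc κ * η ^ 2 / (648 * a ^ 4 * N ^ τ) = 1 / (648 * a ^ 4) * (κ / N ^ τ * (η * η)) := by
          field_simp
      _ ≤ _ := by
          refine mul_le_mul_of_nonneg_left ?_ (by positivity)
          exact mul_le_mul d1 (mul_le_mul d3 d2 hη.le (distTwoPi_nonneg _)) (by positivity)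
            (distTwoPi_nonneg _)
  -- Mode 0 is kept, because for z = 1 the operator zL − 1 always has a kernel on trace-free
  -- matrices. Every other mode up to N is inverted.
  set S : (Fin d → ℤ) → CMat →L[ℂ] CMat := fun n => if n = 0 then 0 else adSolve Ac p (w n) with hS
  have hS0 : S 0 = 0 := by simp [hS]
  have hSn : ∀ n, n ≠ 0 → S n = adSolve Ac p (w n) := fun n hn => by simp [hS, hn]
  have hcjS : ∀ n X, cj (S n X) = S (-n) (cj X) := fun n X => by
    by_cases hn : n = 0
    · subst hn; simp [hS0]
    · rw [hSn n hn, hSn (-n) (neg_ne_zero.2 hn), cj_adSolve hAdet hAcj hpr, hwneg]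
  have hStr : ∀ n X, (S n X).trace = 0 := fun n X => by
    by_cases hn : n = 0
    · subst hn; simp [hS0]
    · rw [hSn n hn, trace_adSolve hAdet]
  have hSs : ∀ n ∈ modes d N, ∀ X, ‖S n X‖ ≤ s * ‖X‖ := fun n hn X => by
    by_cases hn0 : n = 0
    · subst hn0; simp [hS0]; positivity
    · rw [hSn n hn0]
      refine (norm_adSolve_le hAdet ha1 hAn.le hpn (hwn n) X).trans ?_
      refine mul_le_mul_of_nonneg_right (le_trans ?_ hs) (norm_nonneg _)
      calc 48 * a ^ 4 / ‖adPoly p (w n)‖ ≤ 48 * a ^ 4 / (κ * η ^ 2 / (648 * a ^ 4 * N ^ τ)) :=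
            div_le_div_of_nonneg_left (by positivity) (by positivity) (hPlow n hn hn0)
        _ = _ := by field_simp
  have hspec : ∀ n ∈ modes d N, n ≠ 0 → ∀ X,
      expo n (toCd α) • conjL Ac (S n X) - S n X = traceFree X := fun n hn hn0 X => by
    rw [hSn n hn0]
    refine adSolve_spec hAdet rfl (hzw n) ?_ X
    have h1 := hPlow n hn hn0
    rw [← norm_pos_iff]
    exact lt_of_lt_of_le (by positivity) h1
  have hLa : ∀ X, ‖conjL Ac X‖ ≤ a ^ 2 * ‖X‖ := fun X => by
    rw [← hAn]; exact norm_conjL_le hAdet X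
  obtain ⟨Y, W, hYtr, hYcj, hYn, hhn, hWn, hhW⟩ := exists_elimination hr (N := N) α hf.stripPer
    hf.cj_eq (fun X => cj_conjL hAdet hAcj X) hcjS hStr (one_le_pow₀ ha1) hqc hq1 hs1 hε hLa hSs hfε
    (by nlinarith [sq_nonneg (a ^ 2 * q * s)])
  set k := a ^ 2 * q * s with hk
  have hk1 : 1 ≤ k := by
    have := one_le_pow₀ ha1 (n := 2)
    have : 1 ≤ a ^ 2 * q := by nlinarith
    nlinarith
  have hkε : k * ε ≤ 1 / 100 := by
    have h1 : (k * ε) ^ 2 ≤ (1 / 100) ^ 2 := by nlinarith [mul_nonneg (sq_nonneg k) hε.le]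
    exact le_of_sq_le_sq h1 (by norm_num)
  set h : (Fin d → ℂ) → CMat := fun θ =>
    exp (conjL Ac (trig N Y (θ + toCd α))) * exp (f θ) * exp (-trig N Y θ) - 1 with hh
  have hhper : StripPer r h := stripPer_conjugation hf.stripPer _ α N Y
  have hYtrig : ∀ θ, (trig N Y θ).trace = 0 := trace_trig hYtr
  have hYreal : ∀ θ : Fin d → ℝ, cj (trig N Y (toCd θ)) = trig N Y (toCd θ) := fun θ => by
    rw [cj_trig_real]; simp only [hYcj]
  have hadd : ∀ θ : Fin d → ℝ, toCd θ + toCd α = toCd (θ + α) := fun θ => by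
    funext i; simp [toCd]
  have hhcj : ∀ θ : Fin d → ℝ, cj (h (toCd θ)) = h (toCd θ) := fun θ => by
    simp only [hh, map_sub, map_mul, map_one, cj_exp, map_neg, cj_conjL hAdet hAcj, hadd, hYreal,
      hf.cj_eq]
  have hHdet : ∀ θ ∈ strip d r, (1 + h θ).det = 1 := fun θ hθ => by
    simp only [hh, add_sub_cancel]
    rw [Matrix.det_mul, Matrix.det_mul, det_exp_of_trace_zero, det_exp_of_trace_zero,
      det_exp_of_trace_zero]
    · simp
    · rw [Matrix.trace_neg, hYtrig, neg_zero]
    · exact hf.trace_eq_zero hr hθ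
    · rw [trace_conjL hAdet, hYtrig]
  -- the constant part
  set C := traceFree (fcoef h 0) with hC
  have h0mem : (0 : Fin d → ℤ) ∈ modes d N := by rw [mem_modes]; simp [l1]; linarith
  have hCcj : cj C = C := by
    have h1 := hhper.fcoef_conj (G := h) hr (fun θ => (hhcj θ).symm) 0
    rw [neg_zero] at h1
    rw [hC, cj_traceFree, ← h1]
  have hCtr : C.trace = 0 := trace_traceFree _
  have hCn : ‖C‖ ≤ 3 / 2 * ε := by
    have h1 := hhW 0 h0mem
    rw [hS0] at h1
    simp only [zero_apply, neg_zero, smul_zero, map_zero, add_zero] at h1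
    -- The mean of the new cocycle is that of f up to an error quadratic in ε; the factor 2 lost to
    -- `traceFree` is why 432 appears in the smallness assumption.
    have h2 : C = traceFree (W 0 - fcoef f 0) + fcoef f 0 := by
      have h3 : traceFree (fcoef f 0) = fcoef f 0 := by
        refine traceFree_of_trace_zero ?_
        rw [← traceL_apply, ← hf.stripPer.fcoef_clm hr]
        have : ∀ θ : Fin d → ℝ, traceL (f (toCd θ)) = 0 := fun θ =>
          hf.trace_eq_zero hr (toCd_mem_strip hr θ)
        simp [fcoef, torusMean, torusLift, slice, this]
      rw [map_sub, h3, sub_add_cancel, hC, h1]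
    have h3 := hWn 0
    have h4 := hf.stripPer.norm_fcoef_le hr hfε 0
    have hl0 : l1 (0 : Fin d → ℤ) = 0 := by simp [l1]
    rw [hl0, zero_mul, neg_zero, Real.exp_zero, mul_one] at h3 h4
    rw [h2]
    refine (norm_add_le _ _).trans ?_
    have h5 := (norm_traceFree_le (W 0 - fcoef f 0)).trans
      (mul_le_mul_of_nonneg_left h3 two_pos.le)
    nlinarith
  obtain ⟨Cr, hCr⟩ := exists_toC_of_cj hCcj
  have hCrdet : C.det = (Cr.det : ℂ) := by rw [hCr, det_toC]
  have hΔ : |Cr.det| ≤ ‖C‖ ^ 2 := by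
    have := norm_det_le_of_trace_zero hCtr
    rwa [hCrdet, Complex.norm_real, Real.norm_eq_abs] at this
  have hC100 : ‖C‖ ≤ 3 / 200 := by linarith
  have hF : StripPer r (fun θ => traceFree (h θ)) := hhper.clm_comp traceFree
  have hFb : ∀ θ ∈ strip d r, ‖traceFree (h θ)‖ ≤ 12 * k * ε := fun θ hθ =>
    (norm_traceFree_le _).trans (by linarith [hhn θ hθ])
  have hgap : ∀ θ ∈ strip d r', ‖traceFree (1 + h θ) - C‖ ≤ γ := fun θ hθ => by
    have h1 := hF.norm_sub_truncation_le hr hFb hrr' hδ hδ' (N := N) hθ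
    -- On each nonzero mode the homological equation leaves only a scalar matrix, so the truncated
    -- trace-free part is the constant C and the whole discrepancy is a Fourier tail.
    have h2 : ∑ n ∈ modes d N, expo n θ • fcoef (fun θ => traceFree (h θ)) n = C := by
      rw [Finset.sum_eq_single_of_mem 0 h0mem]
      · rw [expo_zero_left, one_smul, hhper.fcoef_clm hr]
      · intro n hn hn0
        rw [hhper.fcoef_clm hr, hhW n hn]
        have h3 := hspec n hn hn0 (W n)
        have h4 : W n + (expo n (toCd α) • conjL Ac (-S n (W n)) + S n (W n)) =
            W n - traceFree (W n) := by
          rw [← h3, map_neg, smul_neg]; abel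
        rw [h4, map_sub, traceFree_of_trace_zero (trace_traceFree _), sub_self, smul_zero]
    rw [h2] at h1
    rw [map_add, traceFree_one, zero_add]
    exact h1.trans hγ
  have hH : StripPer r' (fun θ => 1 + h θ) := ((StripPer.const r 1).add hhper).mono hrr'.le
  obtain ⟨u, φ, hu, hu1, hφ, hφcj, hφtr, hφeq, hφn⟩ := exists_splitting.choose_spec.2.2 d r' γ
    Cr.det (fun θ => 1 + h θ) (fun _ => C) hH (StripPer.const r' C)
    (fun θ => by rw [map_add, map_one, hhcj]) (fun _ => hCcj)
    (fun θ hθ => hHdet θ (strip_mono hrr'.le hθ)) (fun _ _ => hCtr) (fun _ _ => hCrdet)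
    (hΔ.trans (by nlinarith [norm_nonneg C])) (fun _ _ => by linarith)
    (fun θ hθ => by
      rw [add_sub_cancel_left]
      have := hhn θ (strip_mono hrr'.le hθ)
      linarith) hgap hγ' hr'
  have hudet : (u • (1 : RMat) + Cr).det = 1 := by
    have h1 : (u • (1 : RMat) + Cr).toC = (u : ℂ) • 1 + C := by
      rw [toC_add, toC_smul, toC_one, hCr]
    have h2 := det_smul_one_add hCtr (u : ℂ)
    rw [← h1, det_toC, hCrdet] at h2
    have h3 : (u • (1 : RMat) + Cr).det = u ^ 2 + Cr.det := by exact_mod_cast h2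
    rw [h3, hu]; ring
  obtain ⟨U, hU⟩ : ∃ U : Matrix.SpecialLinearGroup (Fin 2) ℝ, (U : RMat) = u • (1 : RMat) + Cr :=
    ⟨⟨_, hudet⟩, rfl⟩
  refine ⟨fun θ => exp (trig N Y θ), A * U, φ, ?_, ?_, ?_, ?_, ?_, ?_⟩
  · refine StripPer.isStripAnalytic_double (stripPer_trig r' N Y).exp fun θ => ?_
    refine exists_SL2R_of_cj ?_ (det_exp_of_trace_zero (hYtrig _))
    rw [cj_exp, hYreal]
  · exact hφ.isStripAnalytic fun θ =>
      exists_sl2R_of_cj (hφcj θ) (hφtr _ (toCd_mem_strip hr' θ))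
  · intro θ hθ
    have h1 := hφeq θ hθ
    have h2 : (fun i => θ i + (α i : ℂ)) = θ + toCd α := rfl
    rw [h2, ← Matrix.exp_neg]
    have h3 : RMat.toC (A * U : Matrix.SpecialLinearGroup (Fin 2) ℝ) =
        Ac * ((u : ℂ) • 1 + C) := by
      rw [Matrix.SpecialLinearGroup.coe_mul, hU, toC_mul, toC_add, toC_smul, toC_one, hCr]
    rw [h3, mul_assoc Ac, h1]
    simp only [hh, add_sub_cancel]
    rw [← mul_assoc, ← exp_conjL hAdet]
    simp only [mul_assoc]
  · refine stripNorm_le hr' fun θ hθ => ?_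
    have h1 := hYn θ (strip_mono hrr'.le hθ)
    have h2 : q * s ≤ k := by
      rw [hk, mul_assoc]; exact le_mul_of_one_le_left (by positivity) (one_le_pow₀ ha1)
    have h3 : 2 * q * s * ε ≤ 1 := by nlinarith
    have h4 := norm_exp_sub_one_le (trig N Y θ)
    have h5 := real_exp_sub_one_le (norm_nonneg _) (h1.trans h3)
    linarith
  · exact stripNorm_le hr' hφn
  · have h1 : ((A * U : Matrix.SpecialLinearGroup (Fin 2) ℝ) : RMat) -
        (A : RMat) = (A : RMat) * ((u - 1) • (1 : RMat) + Cr) := by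
      rw [Matrix.SpecialLinearGroup.coe_mul, hU]
      simp only [mul_add, sub_smul, mul_sub, one_smul, mul_one]
      abel
    rw [h1]
    refine (norm_mul_le _ _).trans ?_
    have h2 : ‖(u - 1) • (1 : RMat) + Cr‖ ≤ ‖C‖ ^ 2 + ‖C‖ := by
      refine (norm_add_le _ _).trans ?_
      rw [norm_smul, norm_one, mul_one, Real.norm_eq_abs, hCr, norm_toC, ← norm_toC Cr, ← hCr]
      linarith [hu1.trans hΔ]
    have h3 : ‖C‖ ^ 2 + ‖C‖ ≤ 2 * ε := by nlinarith [norm_nonneg C]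
    calc _ ≤ ‖(A : RMat)‖ * (2 * ε) := mul_le_mul_of_nonneg_left (h2.trans h3) (norm_nonneg _)
      _ = _ := by ring

end NonResonant

/-! ### Rotations by complex angles. -/

section Rotation

/-- The rotation matrix, for a complex angle. -/
noncomputable def rot (φ : ℂ) : CMat :=
  !![Complex.cos φ, Complex.sin φ; -Complex.sin φ, Complex.cos φ]

theorem rot_add (x y : ℂ) : rot (x + y) = rot x * rot y := by
  ext i j
  fin_cases i <;> fin_cases j <;>
    simp [rot, Matrix.mul_apply, Fin.sum_univ_two, Complex.cos_add, Complex.sin_add] <;> ring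

theorem rot_zero : rot 0 = 1 := by
  ext i j; fin_cases i <;> fin_cases j <;> simp [rot]

theorem det_rot (x : ℂ) : (rot x).det = 1 := by
  rw [rot, Matrix.det_fin_two_of]
  linear_combination Complex.sin_sq_add_cos_sq x

theorem rot_neg_mul (x : ℂ) : rot (-x) * rot x = 1 := by rw [← rot_add, neg_add_cancel, rot_zero]

theorem rot_mul_neg (x : ℂ) : rot x * rot (-x) = 1 := by rw [← rot_add, add_neg_cancel, rot_zero]

theorem rot_inv (x : ℂ) : (rot x)⁻¹ = rot (-x) := Matrix.inv_eq_left_inv (rot_neg_mul x)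

theorem cj_rot (x : ℂ) : cj (rot x) = rot (starRingEnd ℂ x) := by
  ext i j
  fin_cases i <;> fin_cases j <;> simp [rot, cj_apply, Complex.cos_conj, Complex.sin_conj]

theorem cj_rot_ofReal (x : ℝ) : cj (rot x) = rot x := by rw [cj_rot, Complex.conj_ofReal]

theorem conjTranspose_rot_ofReal (x : ℝ) : (rot x).conjTranspose = rot (-x) := by
  ext i j
  fin_cases i <;> fin_cases j <;>
    simp [rot, Matrix.conjTranspose_apply, ← Complex.cos_conj, ← Complex.sin_conj]

theorem norm_rot_ofReal (x : ℝ) : ‖rot (x : ℂ)‖ = 1 := by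
  have h : ‖rot (x : ℂ)‖ * ‖rot (x : ℂ)‖ = 1 := by
    rw [← CStarRing.norm_self_mul_star, Matrix.star_eq_conjTranspose, conjTranspose_rot_ofReal,
      rot_mul_neg, norm_one]
  nlinarith [norm_nonneg (rot (x : ℂ))]

theorem norm_rot_ofReal_sub_one_le (x : ℝ) : ‖rot (x : ℂ) - 1‖ ≤ |x| := by
  refine le_of_sq_le_sq ?_ (abs_nonneg x)
  have h1 : (rot (x : ℂ) - 1) * star (rot (x : ℂ) - 1) =
      ((2 * (1 - Real.cos x) : ℝ) : ℂ) • (1 : CMat) := by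
    rw [star_sub, star_one, Matrix.star_eq_conjTranspose, conjTranspose_rot_ofReal, mul_sub,
      sub_mul, sub_mul, rot_mul_neg]
    ext i j
    fin_cases i <;> fin_cases j <;> simp [rot] <;> ring
  rw [sq, ← CStarRing.norm_self_mul_star, h1, norm_smul, norm_one, mul_one, Complex.norm_real,
    Real.norm_eq_abs, abs_of_nonneg (by linarith [Real.cos_le_one x]), sq_abs]
  linarith [Real.one_sub_sq_div_two_le_cos (x := x)]

theorem norm_rot_ofReal_mul_I_le (y : ℝ) : ‖rot ((y : ℂ) * Complex.I)‖ ≤ Real.exp |y| := by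
  have h : rot ((y : ℂ) * Complex.I) =
      (Real.cosh y : ℂ) • (1 : CMat) + ((Real.sinh y : ℂ) * Complex.I) • rotJ := by
    ext i j
    fin_cases i <;> fin_cases j <;>
      simp [rot, rotJ, Complex.cos_mul_I, Complex.sin_mul_I]
  rw [h]
  refine (norm_add_le _ _).trans ?_
  rw [norm_smul, norm_smul, norm_one, norm_mul, Complex.norm_I, Complex.norm_real,
    Complex.norm_real, Real.norm_eq_abs, Real.norm_eq_abs, abs_of_pos (Real.cosh_pos _),
    Real.abs_sinh, ← Real.cosh_add_sinh |y|, Real.cosh_abs]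
  have h1 := norm_rotJ_le
  have h4 : 0 ≤ Real.sinh |y| := Real.sinh_nonneg_iff.2 (abs_nonneg y)
  nlinarith

theorem norm_rot_le (x : ℂ) : ‖rot x‖ ≤ Real.exp |x.im| := by
  rw [← Complex.re_add_im x, rot_add]
  refine (norm_mul_le _ _).trans ?_
  rw [norm_rot_ofReal, one_mul]
  simpa using norm_rot_ofReal_mul_I_le x.im

theorem rot_int_mul_pi (j : ℤ) : rot (j * Real.pi) = (-1 : ℂ) ^ j • 1 := by
  have h1 : Complex.cos (j * Real.pi) = (-1) ^ j := by
    rw [← Complex.ofReal_intCast, ← Complex.ofReal_mul, ← Complex.ofReal_cos, Real.cos_int_mul_pi]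
    push_cast; rfl
  ext i k
  fin_cases i <;> fin_cases k <;> simp [rot, h1, Complex.sin_int_mul_pi]

theorem rot_add_int_mul_pi (x : ℂ) (j : ℤ) :
    rot (x + j * Real.pi) = (-1 : ℂ) ^ j • rot x := by
  rw [rot_add, rot_int_mul_pi, mul_smul_comm, mul_one]

end Rotation

/-! ### Coordinates that diagonalise conjugation by rotations. -/

section Circular

/-- The component of a matrix along the rotation generator. -/
noncomputable def coefJ : CMat →L[ℂ] ℂ := (1 / 2 : ℂ) • (entryL 0 1 - entryL 1 0)

/-- The upper right entry in the coordinates given by `cayleyM`. -/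
noncomputable def coefP : CMat →L[ℂ] ℂ :=
  (1 / 2 : ℂ) • (entryL 0 0 - entryL 1 1) - (Complex.I / 2) • (entryL 0 1 + entryL 1 0)

/-- The lower left entry in the coordinates given by `cayleyM`. -/
noncomputable def coefM : CMat →L[ℂ] ℂ :=
  (1 / 2 : ℂ) • (entryL 0 0 - entryL 1 1) + (Complex.I / 2) • (entryL 0 1 + entryL 1 0)

theorem coefJ_apply (X : CMat) : coefJ X = 1 / 2 * (X 0 1 - X 1 0) := rfl

theorem coefP_apply (X : CMat) :
    coefP X = 1 / 2 * (X 0 0 - X 1 1) - Complex.I / 2 * (X 0 1 + X 1 0) := rfl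

theorem coefM_apply (X : CMat) :
    coefM X = 1 / 2 * (X 0 0 - X 1 1) + Complex.I / 2 * (X 0 1 + X 1 0) := rfl

/-- The matrix with coordinates `E₁₂` in the basis given by `cayleyM`. -/
noncomputable def circP : CMat := !![1 / 2, Complex.I / 2; Complex.I / 2, -1 / 2]

/-- The matrix with coordinates `E₂₁` in the basis given by `cayleyM`. -/
noncomputable def circM : CMat := !![1 / 2, -Complex.I / 2; -Complex.I / 2, -1 / 2]

theorem circ_decomp (X : CMat) :
    traceFree X = coefJ X • rotJ + coefP X • circP + coefM X • circM := by
  rw [traceFree_apply]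
  ext i j
  fin_cases i <;> fin_cases j <;>
    simp [coefJ_apply, coefP_apply, coefM_apply, rotJ, circP, circM, Matrix.trace_fin_two] <;>
    ring_nf <;> simp [Complex.I_sq] <;> ring

theorem cayley_const_sq : (1 / (1 + Complex.I)) * starRingEnd ℂ (1 / (1 + Complex.I)) = 1 / 2 := by
  have h1 : (1 + Complex.I) ≠ 0 := fun h => by simpa using congrArg Complex.re h
  have h2 : (1 - Complex.I) ≠ 0 := fun h => by simpa using congrArg Complex.re h
  have h3 : starRingEnd ℂ (1 / (1 + Complex.I)) = 1 / (1 - Complex.I) := by simp [sub_eq_add_neg]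
  rw [h3]
  field_simp
  linear_combination Complex.I_sq

theorem conjTranspose_cayley : (!![1, -Complex.I; 1, Complex.I] : CMat).conjTranspose =
    !![1, 1; Complex.I, -Complex.I] := by
  ext i j; fin_cases i <;> fin_cases j <;> simp [Matrix.conjTranspose_apply]

theorem cayleyM_mul_conjTranspose : cayleyM * cayleyM.conjTranspose = 1 := by
  have h := cayley_const_sq
  rw [cayleyM, Matrix.conjTranspose_smul, Matrix.smul_mul, Matrix.mul_smul, smul_smul,
    ← starRingEnd_apply, h,
    conjTranspose_cayley]
  ext i j
  fin_cases i <;> fin_cases j <;> simp <;> norm_num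

theorem cayleyM_inv : cayleyM⁻¹ = cayleyM.conjTranspose :=
  Matrix.inv_eq_right_inv cayleyM_mul_conjTranspose

theorem norm_cayleyM : ‖cayleyM‖ = 1 := by
  have h : ‖cayleyM‖ * ‖cayleyM‖ = 1 := by
    rw [← CStarRing.norm_self_mul_star, Matrix.star_eq_conjTranspose, cayleyM_mul_conjTranspose,
      norm_one]
  nlinarith [norm_nonneg cayleyM]

/-- The conjugating matrix is unitary, so the entries on the right are bounded by ‖X‖. For real
trace-free X they supply the numbers t (`coefJ`) and v (`coefP`) of the normal form. -/
theorem cayleyM_conj (X : CMat) : cayleyM * X * cayleyM⁻¹ =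
    !![X.trace / 2 + Complex.I * coefJ X, coefP X; coefM X, X.trace / 2 - Complex.I * coefJ X] := by
  have h := cayley_const_sq
  rw [cayleyM_inv, cayleyM, Matrix.conjTranspose_smul, Matrix.smul_mul, Matrix.smul_mul,
    Matrix.mul_smul, smul_smul, ← starRingEnd_apply, h,
    conjTranspose_cayley, Matrix.eta_fin_two X]
  ext i j
  fin_cases i <;> fin_cases j <;>
    simp [coefJ_apply, coefP_apply, coefM_apply, Matrix.trace_fin_two] <;>
    ring_nf <;> simp [Complex.I_sq] <;> ring

theorem norm_cayleyM_conj_le (X : CMat) : ‖cayleyM * X * cayleyM⁻¹‖ ≤ ‖X‖ := by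
  have h : ‖cayleyM⁻¹‖ = 1 := by
    rw [cayleyM_inv, ← Matrix.star_eq_conjTranspose, norm_star, norm_cayleyM]
  calc _ ≤ ‖cayleyM‖ * ‖X‖ * ‖cayleyM⁻¹‖ :=
        (norm_mul_le _ _).trans (mul_le_mul_of_nonneg_right (norm_mul_le _ _) (norm_nonneg _))
    _ = _ := by rw [norm_cayleyM, h]; ring

theorem norm_coefP_le (X : CMat) : ‖coefP X‖ ≤ ‖X‖ := by
  have h := (norm_entry_le (cayleyM * X * cayleyM⁻¹) 0 1).trans (norm_cayleyM_conj_le X)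
  rwa [cayleyM_conj] at h

theorem norm_coefM_le (X : CMat) : ‖coefM X‖ ≤ ‖X‖ := by
  have h := (norm_entry_le (cayleyM * X * cayleyM⁻¹) 1 0).trans (norm_cayleyM_conj_le X)
  rwa [cayleyM_conj] at h

theorem norm_coefJ_le (X : CMat) : ‖coefJ X‖ ≤ ‖X‖ := by
  rw [coefJ_apply, norm_mul]
  have h1 := norm_entry_le X 0 1
  have h2 := norm_entry_le X 1 0
  have h3 := norm_sub_le (X 0 1) (X 1 0)
  norm_num
  linarith

theorem norm_circP_le : ‖circP‖ ≤ 2 := by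
  refine (norm_le_sum_entries _).trans ?_
  simp [circP]; norm_num

theorem norm_circM_le : ‖circM‖ ≤ 2 := by
  refine (norm_le_sum_entries _).trans ?_
  simp [circM]; norm_num

theorem cj_circP : cj circP = circM := by
  ext i j; fin_cases i <;> fin_cases j <;> simp [circP, circM, cj_apply, Complex.conj_ofNat]

theorem cj_circM : cj circM = circP := by
  ext i j; fin_cases i <;> fin_cases j <;> simp [circP, circM, cj_apply, Complex.conj_ofNat]

theorem cj_rotJ : cj rotJ = rotJ := by
  ext i j; fin_cases i <;> fin_cases j <;> simp [rotJ, cj_apply]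

theorem coefJ_cj (X : CMat) : coefJ (cj X) = starRingEnd ℂ (coefJ X) := by
  simp [coefJ_apply, cj_apply, Complex.conj_ofNat]

theorem coefP_cj (X : CMat) : coefP (cj X) = starRingEnd ℂ (coefM X) := by
  simp [coefP_apply, coefM_apply, cj_apply, Complex.conj_ofNat]; ring

theorem coefM_cj (X : CMat) : coefM (cj X) = starRingEnd ℂ (coefP X) := by
  simp [coefP_apply, coefM_apply, cj_apply, Complex.conj_ofNat]; ring

theorem det_circ (t v w : ℂ) : (t • rotJ + v • circP + w • circM).det = t ^ 2 - v * w := by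
  simp [Matrix.det_fin_two, rotJ, circP, circM]
  ring_nf; simp [Complex.I_sq]; ring

theorem trace_circ (t v w : ℂ) : (t • rotJ + v • circP + w • circM).trace = 0 := by
  simp [Matrix.trace_fin_two, rotJ, circP, circM]; ring

theorem coefP_circ (t v w : ℂ) : coefP (t • rotJ + v • circP + w • circM) = v := by
  simp [coefP_apply, rotJ, circP, circM]
  ring_nf; simp [Complex.I_sq]; ring

theorem exp_I_mul_eq (x : ℂ) : Complex.exp (Complex.I * x) = Complex.cos x + Complex.sin x * Complex.I := by
  rw [mul_comm, Complex.exp_mul_I]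

theorem rot_mul_rotJ (x : ℂ) : rot x * rotJ = rotJ * rot x := by
  ext i j
  fin_cases i <;> fin_cases j <;> simp [rot, rotJ, Matrix.mul_apply, Fin.sum_univ_two]

theorem exp_neg_I_mul_eq (x : ℂ) :
    Complex.exp (-(Complex.I * x)) = Complex.cos x - Complex.sin x * Complex.I := by
  rw [← mul_neg, exp_I_mul_eq, Complex.cos_neg, Complex.sin_neg]; ring

theorem rot_mul_circP (x : ℂ) : rot x * circP = Complex.exp (Complex.I * x) • circP := by
  rw [exp_I_mul_eq]
  ext i j
  fin_cases i <;> fin_cases j <;> simp [rot, circP] <;> ring_nf <;> simp [Complex.I_sq] <;> ring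

theorem circP_mul_rot (x : ℂ) : circP * rot x = Complex.exp (-(Complex.I * x)) • circP := by
  rw [exp_neg_I_mul_eq]
  ext i j
  fin_cases i <;> fin_cases j <;> simp [rot, circP] <;> ring_nf <;> simp [Complex.I_sq] <;> ring

theorem rot_mul_circM (x : ℂ) : rot x * circM = Complex.exp (-(Complex.I * x)) • circM := by
  rw [exp_neg_I_mul_eq]
  ext i j
  fin_cases i <;> fin_cases j <;> simp [rot, circM] <;> ring_nf <;> simp [Complex.I_sq] <;> ring

theorem circM_mul_rot (x : ℂ) : circM * rot x = Complex.exp (Complex.I * x) • circM := by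
  rw [exp_I_mul_eq]
  ext i j
  fin_cases i <;> fin_cases j <;> simp [rot, circM] <;> ring_nf <;> simp [Complex.I_sq] <;> ring

/-- A rotation by a real angle only changes the phase of the off-diagonal coefficient, so its
smallness survives multiplication by the rotation part of A₊. -/
theorem coefP_rot_mul (x : ℂ) {X : CMat} (u : ℂ) (hX : X.trace = 0) :
    coefP (rot x * (u • 1 + X)) = Complex.exp (Complex.I * x) * coefP X := by
  rw [← traceFree_of_trace_zero hX, circ_decomp, mul_add, mul_add, mul_add, mul_smul_comm,
    mul_smul_comm, mul_smul_comm, mul_smul_comm, mul_one, rot_mul_circP, rot_mul_circM,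
    coefP_circ]
  simp only [map_add, map_smul, smul_eq_mul]
  have h1 : coefP (rot x) = 0 := by simp [coefP_apply, rot]
  have h2 : coefP (rot x * rotJ) = 0 := by simp [coefP_apply, rot, rotJ]
  have h3 : coefP circP = 1 := by simpa using coefP_circ 0 1 0
  have h4 : coefP circM = 0 := by simpa using coefP_circ 0 0 1
  rw [h1, h2, h3, h4]; ring

end Circular

/-! ### Elimination of all modes except the resonant ones. -/

section ResonantNormalForm

open NormedSpace

variable {d : ℕ}

/-- The operator that multiplies the three components of `circ_decomp`. -/
noncomputable def circDiag (a b c : ℂ) : CMat →L[ℂ] CMat :=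
  (a • coefJ).smulRight rotJ + (b • coefP).smulRight circP + (c • coefM).smulRight circM

theorem circDiag_apply (a b c : ℂ) (X : CMat) : circDiag a b c X =
    (a * coefJ X) • rotJ + (b * coefP X) • circP + (c * coefM X) • circM := rfl

theorem trace_circDiag (a b c : ℂ) (X : CMat) : (circDiag a b c X).trace = 0 := by
  rw [circDiag_apply, trace_circ]

theorem cj_circDiag (a b c : ℂ) (X : CMat) : cj (circDiag a b c X) =
    circDiag (starRingEnd ℂ a) (starRingEnd ℂ c) (starRingEnd ℂ b) (cj X) := by
  simp only [circDiag_apply, map_add, cj_smul, map_mul, cj_circP, cj_circM, cj_rotJ, coefJ_cj,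
    coefP_cj, coefM_cj]
  abel

theorem norm_circDiag_le {a b c : ℂ} {s : ℝ} (ha : ‖a‖ ≤ s) (hb : ‖b‖ ≤ s) (hc : ‖c‖ ≤ s)
    (X : CMat) : ‖circDiag a b c X‖ ≤ 5 * s * ‖X‖ := by
  have hs : 0 ≤ s := (norm_nonneg _).trans ha
  have key : ∀ (x y : ℂ) (E : CMat) (k : ℝ), ‖x‖ ≤ s → ‖y‖ ≤ ‖X‖ → ‖E‖ ≤ k →
      ‖(x * y) • E‖ ≤ s * ‖X‖ * k := fun x y E k hx hy hE => by
    rw [norm_smul, norm_mul]; gcongr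
  rw [circDiag_apply]
  refine (norm_add₃_le).trans ?_
  have h1 := key a (coefJ X) rotJ 1 ha (norm_coefJ_le X) norm_rotJ_le
  have h2 := key b (coefP X) circP 2 hb (norm_coefP_le X) norm_circP_le
  have h3 := key c (coefM X) circM 2 hc (norm_coefM_le X) norm_circM_le
  linarith

/-- The three basis matrices are eigenvectors of conjugation by a rotation. Hence the homological
equation decouples into scalar equations, and each component of each mode can be kept or removed
separately. -/
theorem conjL_rot_circ (x t v w : ℂ) : conjL (rot x) (t • rotJ + v • circP + w • circM) =
    t • rotJ + (Complex.exp (-(2 * Complex.I * x)) * v) • circP +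
      (Complex.exp (2 * Complex.I * x) * w) • circM := by
  have e1 : Complex.exp (-(2 * Complex.I * x)) =
      Complex.exp (Complex.I * (-x)) * Complex.exp (-(Complex.I * x)) := by
    rw [← Complex.exp_add]; ring_nf
  have e2 : Complex.exp (2 * Complex.I * x) =
      Complex.exp (-(Complex.I * (-x))) * Complex.exp (Complex.I * x) := by
    rw [← Complex.exp_add]; ring_nf
  rw [e1, e2, conjL_apply, rot_inv]
  simp only [mul_add, add_mul, mul_smul_comm, smul_mul_assoc, rot_mul_rotJ, rot_mul_circP,
    rot_mul_circM, mul_assoc, rot_neg_mul, mul_one, circP_mul_rot, circM_mul_rot, smul_smul]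
  module

theorem conjL_rot_circDiag (x a b c : ℂ) (X : CMat) : conjL (rot x) (circDiag a b c X) =
    circDiag a (Complex.exp (-(2 * Complex.I * x)) * b) (Complex.exp (2 * Complex.I * x) * c) X := by
  simp only [circDiag_apply, conjL_rot_circ, mul_assoc]

theorem traceFree_eq_circDiag (X : CMat) : traceFree X = circDiag 1 1 1 X := by
  rw [circ_decomp, circDiag_apply]; simp only [one_mul]

theorem circDiag_sub (a b c a' b' c' : ℂ) (X : CMat) :
    circDiag a b c X - circDiag a' b' c' X = circDiag (a - a') (b - b') (c - c') X := by
  simp only [circDiag_apply, sub_mul, sub_smul]; abel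

theorem smul_circDiag (z a b c : ℂ) (X : CMat) :
    z • circDiag a b c X = circDiag (z * a) (z * b) (z * c) X := by
  simp only [circDiag_apply, smul_add, smul_smul, mul_assoc]

theorem coefJ_traceFree (X : CMat) : coefJ (traceFree X) = coefJ X := by
  rw [traceFree_apply]; simp [coefJ_apply]

theorem coefP_traceFree (X : CMat) : coefP (traceFree X) = coefP X := by
  rw [traceFree_apply]; simp [coefP_apply]

theorem coefJ_circ (t v w : ℂ) : coefJ (t • rotJ + v • circP + w • circM) = t := by
  simp [coefJ_apply, rotJ, circP, circM]; ring

theorem coefM_circ (t v w : ℂ) : coefM (t • rotJ + v • circP + w • circM) = w := by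
  simp [coefM_apply, rotJ, circP, circM]
  ring_nf; simp [Complex.I_sq]; ring

theorem coefM_traceFree (X : CMat) : coefM (traceFree X) = coefM X := by
  rw [traceFree_apply]; simp [coefM_apply]

/-- The solution operators of the linearized equation away from the resonances `0`, `m`, `-m`. -/
noncomputable def resSolve (m : Fin d → ℤ) (α : Fin d → ℝ) (ρ : ℝ) (n : Fin d → ℤ) :
    CMat →L[ℂ] CMat :=
  circDiag (if n = 0 then 0 else (expo n (toCd α) - 1)⁻¹)
    (if n = m then 0 else (expo n (toCd α) * Complex.exp (-(2 * Complex.I * ρ)) - 1)⁻¹)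
    (if n = -m then 0 else (expo n (toCd α) * Complex.exp (2 * Complex.I * ρ) - 1)⁻¹)

theorem conj_exp_two_I (ρ : ℝ) : starRingEnd ℂ (Complex.exp (2 * Complex.I * ρ)) =
    Complex.exp (-(2 * Complex.I * ρ)) := by
  rw [← Complex.exp_conj]; simp [Complex.conj_ofNat]

theorem conj_exp_neg_two_I (ρ : ℝ) : starRingEnd ℂ (Complex.exp (-(2 * Complex.I * ρ))) =
    Complex.exp (2 * Complex.I * ρ) := by
  rw [← conj_exp_two_I, Complex.conj_conj]

theorem cj_resSolve (m : Fin d → ℤ) (α : Fin d → ℝ) (ρ : ℝ) (n : Fin d → ℤ) (X : CMat) :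
    cj (resSolve m α ρ n X) = resSolve m α ρ (-n) (cj X) := by
  rw [resSolve, resSolve, cj_circDiag]
  congr 1
  simp only [apply_ite (starRingEnd ℂ), map_zero, map_inv₀, map_sub, map_mul, map_one,
    conj_expo_real, conj_exp_two_I, conj_exp_neg_two_I, neg_eq_iff_eq_neg, neg_zero, neg_neg]

/-- Applied to W_n, the left side is the trace-free part that remains in mode n: the diagonal
component for n = 0 and one off-diagonal component for each of n = m and n = −m. -/
theorem resSolve_spec {m : Fin d → ℤ} {α : Fin d → ℝ} {ρ : ℝ} {n : Fin d → ℤ}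
    (h0 : n ≠ 0 → expo n (toCd α) - 1 ≠ 0)
    (h1 : n ≠ m → expo n (toCd α) * Complex.exp (-(2 * Complex.I * ρ)) - 1 ≠ 0)
    (h2 : n ≠ -m → expo n (toCd α) * Complex.exp (2 * Complex.I * ρ) - 1 ≠ 0) (X : CMat) :
    traceFree X - (expo n (toCd α) • conjL (rot ρ) (resSolve m α ρ n X) - resSolve m α ρ n X) =
      circDiag (if n = 0 then 1 else 0) (if n = m then 1 else 0) (if n = -m then 1 else 0) X := by
  rw [resSolve, conjL_rot_circDiag, smul_circDiag, circDiag_sub, traceFree_eq_circDiag,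
    circDiag_sub]
  congr 2
  · split_ifs with h
    · simp
    · have := h0 h; field_simp; ring
  · split_ifs with h
    · simp
    · have := h1 h; field_simp; ring
  · split_ifs with h
    · simp
    · have := h2 h; field_simp; ring

set_option maxHeartbeats 1000000 in
/-- Removal of all non-resonant modes when the resonances are `0`, `m` and `-m`. -/
theorem exists_resonant_normal_form {r r' : ℝ} (hr' : 0 < r') (hrr' : r' < r) {N : ℝ}
    {α : Fin d → ℝ} {g : (Fin d → ℂ) → CMat} (hg : StripPer r g)
    (hgcj : ∀ θ : Fin d → ℝ, cj (g (toCd θ)) = g (toCd θ))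
    (hgtr : ∀ θ ∈ strip d r, (g θ).trace = 0) {m : Fin d → ℤ} (hm0 : m ≠ 0) (hm : l1 m ≤ N)
    (ρ : ℝ) {e q s k γ δ : ℝ} (he : 0 < e) (he1 : e ≤ 1 / 100) (hge : ∀ θ ∈ strip d r, ‖g θ‖ ≤ e)
    (hs : 1 ≤ s) (hq : q = (3 * N) ^ d) (hk : k = q * (5 * s))
    (hz : ∀ n ∈ modes d N, n ≠ 0 → 1 / s ≤ ‖expo n (toCd α) - 1‖)
    (hρ : ∀ n ∈ modes d N, n ≠ m →
      1 / s ≤ ‖expo n (toCd α) * Complex.exp (-(2 * Complex.I * ρ)) - 1‖)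
    (hsmall : 216 * k ^ 2 * e ≤ 1) (hδ : 0 < δ) (hδ' : δ ≤ r - r')
    (hγ : 12 * k * e * (Real.exp (-(N * (r - r' - δ))) * (2 + 2 / δ) ^ d) ≤ γ)
    (hγ' : γ < splitRadius) :
    ∃ (Y : (Fin d → ℤ) → CMat) (u t : ℝ) (w : ℂ) (φ : (Fin d → ℂ) → CMat),
      (∀ n, (Y n).trace = 0) ∧ (∀ n, cj (Y (-n)) = Y n) ∧
      (∀ θ ∈ strip d r, ‖trig N Y θ‖ ≤ 2 * k * e) ∧
      u ^ 2 = 1 - (t ^ 2 - ‖w‖ ^ 2) ∧ |u - 1| ≤ |t ^ 2 - ‖w‖ ^ 2| ∧ |t| ≤ 3 / 2 * e ∧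
      ‖w‖ ≤ 3 / 2 * e * Real.exp (-(l1 m * r)) ∧ StripPer r' φ ∧
      (∀ θ : Fin d → ℝ, cj (φ (toCd θ)) = φ (toCd θ)) ∧ (∀ θ ∈ strip d r', (φ θ).trace = 0) ∧
      (∀ θ ∈ strip d r', ‖φ θ‖ ≤ 4 * γ) ∧
      ∀ θ ∈ strip d r', ((u : ℂ) • 1 + ((t : ℂ) • rotJ + (expo m θ * w) • circP +
          (expo (-m) θ * starRingEnd ℂ w) • circM)) * exp (φ θ) =
        exp (conjL (rot ρ) (trig N Y (θ + toCd α))) * exp (g θ) * exp (-trig N Y θ) := by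
  have hr : 0 < r := hr'.trans hrr'
  have hN : 1 ≤ N := (one_le_l1 hm0).trans hm
  have hq1 : 1 ≤ q := by rw [hq]; exact one_le_pow₀ (by linarith)
  have hqc : ((modes d N).card : ℝ) ≤ q := by rw [hq]; exact card_modes_le hN
  have hs0 : 0 < s := by linarith
  have hk1 : 1 ≤ k := by rw [hk]; nlinarith
  set S := resSolve m α ρ with hS
  -- The third family of divisors is the complex conjugate of the second one at −n.
  have hρ' : ∀ n ∈ modes d N, n ≠ -m →
      1 / s ≤ ‖expo n (toCd α) * Complex.exp (2 * Complex.I * ρ) - 1‖ := fun n hn hnm => by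
    have h1 := hρ (-n) (neg_mem_modes.2 hn) (fun h => hnm (by rw [← h, neg_neg]))
    rw [← RCLike.norm_conj, map_sub, map_mul, map_one, conj_expo_real, conj_exp_neg_two_I,
      neg_neg] at h1
    exact h1
  have hinv : ∀ x : ℂ, 1 / s ≤ ‖x‖ → ‖x⁻¹‖ ≤ s := fun x hx => by
    rw [norm_inv]
    exact inv_le_of_inv_le₀ hs0 (by rwa [← one_div])
  have hne : ∀ x : ℂ, 1 / s ≤ ‖x‖ → x ≠ 0 := fun x hx => by
    rw [← norm_pos_iff]; exact lt_of_lt_of_le (by positivity) hx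
  have hSs : ∀ n ∈ modes d N, ∀ X, ‖S n X‖ ≤ 5 * s * ‖X‖ := fun n hn X => by
    refine norm_circDiag_le ?_ ?_ ?_ X
    · split_ifs with h
      · simpa using hs0.le
      · exact hinv _ (hz n hn h)
    · split_ifs with h
      · simpa using hs0.le
      · exact hinv _ (hρ n hn h)
    · split_ifs with h
      · simpa using hs0.le
      · exact hinv _ (hρ' n hn h)
  have hLa : ∀ X, ‖conjL (rot ρ) X‖ ≤ 1 * ‖X‖ := fun X => by
    refine (norm_conjL_le (det_rot _) X).trans ?_
    rw [norm_rot_ofReal]; simp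
  obtain ⟨Y, W, hYtr, hYcj, hYn, hhn, hWn, hhW⟩ := exists_elimination hr (N := N) α hg hgcj
    (fun X => cj_conjL (det_rot _) (cj_rot_ofReal ρ) X) (cj_resSolve m α ρ)
    (fun n X => trace_circDiag _ _ _ X) le_rfl hqc hq1 (by linarith : (1 : ℝ) ≤ 5 * s) he hLa hSs hge
    (by rw [one_mul, ← hk]; nlinarith [sq_nonneg k])
  rw [one_mul, ← hk] at hhn
  simp only [one_mul, ← hk] at hWn
  have hYn' : ∀ θ ∈ strip d r, ‖trig N Y θ‖ ≤ 2 * k * e := fun θ hθ => by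
    rw [hk, ← mul_assoc]; exact hYn θ hθ
  set h : (Fin d → ℂ) → CMat := fun θ =>
    exp (conjL (rot ρ) (trig N Y (θ + toCd α))) * exp (g θ) * exp (-trig N Y θ) - 1 with hh
  have hke : k * e ≤ 1 / 100 := by
    have h1 : (k * e) ^ 2 ≤ (1 / 100) ^ 2 := by nlinarith [mul_nonneg (sq_nonneg k) he.le]
    exact le_of_sq_le_sq h1 (by norm_num)
  have hhper : StripPer r h := stripPer_conjugation hg _ α N Y
  have hYtrig : ∀ θ, (trig N Y θ).trace = 0 := trace_trig hYtr
  have hYreal : ∀ θ : Fin d → ℝ, cj (trig N Y (toCd θ)) = trig N Y (toCd θ) := fun θ => by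
    rw [cj_trig_real]; simp only [hYcj]
  have hadd : ∀ θ : Fin d → ℝ, toCd θ + toCd α = toCd (θ + α) := fun θ => by
    funext i; simp [toCd]
  have hhcj : ∀ θ : Fin d → ℝ, cj (h (toCd θ)) = h (toCd θ) := fun θ => by
    simp only [hh, map_sub, map_mul, map_one, cj_exp, map_neg,
      cj_conjL (det_rot _) (cj_rot_ofReal ρ), hadd, hYreal, hgcj]
  have hHdet : ∀ θ ∈ strip d r, (1 + h θ).det = 1 := fun θ hθ => by
    simp only [hh, add_sub_cancel]
    rw [Matrix.det_mul, Matrix.det_mul, det_exp_of_trace_zero, det_exp_of_trace_zero,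
      det_exp_of_trace_zero]
    · simp
    · rw [Matrix.trace_neg, hYtrig, neg_zero]
    · exact hgtr θ hθ
    · rw [trace_conjL (det_rot _), hYtrig]
  have hcoef : ∀ n ∈ modes d N, traceFree (fcoef h n) = circDiag (if n = 0 then 1 else 0)
      (if n = m then 1 else 0) (if n = -m then 1 else 0) (W n) := fun n hn => by
    rw [hhW n hn, ← resSolve_spec (α := α) (ρ := ρ) (fun h => hne _ (hz n hn h))
      (fun h => hne _ (hρ n hn h)) (fun h => hne _ (hρ' n hn h))]
    rw [map_add, map_add, map_neg, smul_neg, map_neg, ← hS]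
    rw [traceFree_of_trace_zero (X := S n (W n)) (trace_circDiag _ _ _ _),
      traceFree_of_trace_zero (X := expo n (toCd α) • conjL (rot ρ) (S n (W n)))]
    · abel
    · rw [Matrix.trace_smul, trace_conjL (det_rot _), hS, resSolve, trace_circDiag, smul_zero]
  have hreal : ∀ n, cj (fcoef h (-n)) = fcoef h n := fun n =>
    (hhper.fcoef_conj (G := h) hr (fun θ => (hhcj θ).symm) n).symm
  have h0mem : (0 : Fin d → ℤ) ∈ modes d N := by rw [mem_modes]; simp [l1]; linarith
  have hmmem : m ∈ modes d N := mem_modes.2 hm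
  have hnmem : -m ∈ modes d N := neg_mem_modes.2 hmmem
  have hJ : coefJ (fcoef h 0) = coefJ (W 0) := by
    rw [← coefJ_traceFree, hcoef 0 h0mem, circDiag_apply, coefJ_circ]; simp
  have hP : coefP (fcoef h m) = coefP (W m) := by
    rw [← coefP_traceFree, hcoef m hmmem, circDiag_apply, coefP_circ]; simp
  have hM : coefM (fcoef h (-m)) = coefM (W (-m)) := by
    rw [← coefM_traceFree, hcoef (-m) hnmem, circDiag_apply, coefM_circ]; simp
  obtain ⟨t, ht⟩ : ∃ t : ℝ, coefJ (W 0) = (t : ℂ) := by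
    refine ⟨_, (Complex.conj_eq_iff_re.1 ?_).symm⟩
    rw [← hJ, ← coefJ_cj]
    have := hreal 0
    rw [neg_zero] at this
    rw [this]
  set w := coefP (W m) with hw
  have hw' : coefM (W (-m)) = starRingEnd ℂ w := by
    rw [← hM, ← hP, ← coefM_cj]
    have := hreal (-m)
    rw [neg_neg] at this
    rw [this]
  have hWb : ∀ n, ‖W n‖ ≤ 3 / 2 * e * Real.exp (-(l1 n * r)) := fun n => by
    have h1 := hWn n
    have h2 := hg.norm_fcoef_le hr hge n
    have h3 : ‖W n‖ ≤ ‖W n - fcoef g n‖ + ‖fcoef g n‖ := by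
      simpa using norm_add_le (W n - fcoef g n) (fcoef g n)
    have h4 : 108 * k ^ 2 * e ^ 2 ≤ 1 / 2 * e := by nlinarith
    have h5 := mul_le_mul_of_nonneg_right h4 (Real.exp_pos (-(l1 n * r))).le
    linarith
  have htb : |t| ≤ 3 / 2 * e := by
    have h1 := (norm_coefJ_le (W 0)).trans (hWb 0)
    rw [ht, Complex.norm_real, Real.norm_eq_abs] at h1
    simpa [l1] using h1
  have hwb : ‖w‖ ≤ 3 / 2 * e * Real.exp (-(l1 m * r)) := (norm_coefP_le _).trans (hWb m)
  set c : (Fin d → ℂ) → CMat := fun θ => (t : ℂ) • rotJ + (expo m θ * w) • circP +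
    (expo (-m) θ * starRingEnd ℂ w) • circM with hc
  have hcper : StripPer r' c :=
    ((StripPer.const r' _).add ((((StripPer.expo r' m).mul (StripPer.const r' w))).smul
      (StripPer.const r' circP))).add (((StripPer.expo r' (-m)).mul
        (StripPer.const r' (starRingEnd ℂ w))).smul (StripPer.const r' circM))
  have hccj : ∀ θ : Fin d → ℝ, cj (c (toCd θ)) = c (toCd θ) := fun θ => by
    simp only [hc, map_add, cj_smul, map_mul, Complex.conj_conj, Complex.conj_ofReal, cj_circP,
      cj_circM, cj_rotJ, conj_expo_real, neg_neg]
    abel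
  -- The phases of the two off-diagonal terms are inverse to each other, so the determinant is
  -- constant, as `exists_splitting` requires.
  have hcdet : ∀ θ ∈ strip d r', (c θ).det = ((t ^ 2 - ‖w‖ ^ 2 : ℝ) : ℂ) := fun θ _ => by
    simp only [hc]
    rw [det_circ]
    have h1 := expo_neg_mul m θ
    have h2 := Complex.mul_conj' w
    push_cast
    linear_combination (-w * starRingEnd ℂ w) * h1 - h2
  -- On the smaller strip the growth e^{|m|r'} of the character is outweighed by the decay e^{-|m|r}
  -- of the coefficient.
  have hexpo : ∀ n : Fin d → ℤ, l1 n = l1 m → ∀ x : ℂ, ‖x‖ = ‖w‖ → ∀ θ ∈ strip d r',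
      ‖expo n θ * x‖ ≤ 3 / 2 * e := fun n hn x hx θ hθ => by
    rw [norm_mul, hx]
    have h1 := norm_expo_le n (r := r') fun i => (hθ i).le
    rw [hn] at h1
    calc _ ≤ Real.exp (l1 m * r') * (3 / 2 * e * Real.exp (-(l1 m * r))) := by gcongr
      _ = 3 / 2 * e * Real.exp (-(l1 m * (r - r'))) := by
          rw [mul_comm, mul_assoc, ← Real.exp_add]; ring_nf
      _ ≤ 3 / 2 * e * 1 := by
          refine mul_le_mul_of_nonneg_left (Real.exp_le_one_iff.2 ?_) (by positivity)
          have := mul_nonneg (l1_nonneg m) (sub_nonneg.2 hrr'.le)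
          linarith
      _ = _ := mul_one _
  have hcn : ∀ θ ∈ strip d r', ‖c θ‖ ≤ 15 / 2 * e := fun θ hθ => by
    have h1 := hexpo m rfl w rfl θ hθ
    have h2 := hexpo (-m) (l1_neg m) (starRingEnd ℂ w) (RCLike.norm_conj w) θ hθ
    refine norm_add₃_le.trans ?_
    rw [norm_smul, norm_smul, norm_smul, Complex.norm_real, Real.norm_eq_abs]
    have h3 : |t| * ‖rotJ‖ ≤ 3 / 2 * e * 1 := mul_le_mul htb norm_rotJ_le (norm_nonneg _) (by positivity)
    have h4 := mul_le_mul h1 norm_circP_le (norm_nonneg _) (by positivity)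
    have h5 := mul_le_mul h2 norm_circM_le (norm_nonneg _) (by positivity)
    linarith
  have hΔ : |t ^ 2 - ‖w‖ ^ 2| ≤ 1 / 10 := by
    have h1 : ‖w‖ ≤ 3 / 2 * e := hwb.trans (mul_le_of_le_one_right (by positivity)
      (Real.exp_le_one_iff.2 (by have := mul_nonneg (l1_nonneg m) hr.le; linarith)))
    have h2 : t ^ 2 ≤ (3 / 200) ^ 2 := by
      rw [← sq_abs]; exact pow_le_pow_left₀ (abs_nonneg _) (by linarith) 2
    have h3 : ‖w‖ ^ 2 ≤ (3 / 200) ^ 2 := pow_le_pow_left₀ (norm_nonneg _) (by linarith) 2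
    rw [abs_le]
    constructor <;> nlinarith [sq_nonneg t, sq_nonneg ‖w‖]
  -- Only three terms survive elimination, and together they are the function c.
  have hsum : ∀ θ, ∑ n ∈ modes d N, expo n θ • fcoef (fun θ => traceFree (h θ)) n = c θ := fun θ => by
    have h1 : ∀ n ∈ modes d N, expo n θ • fcoef (fun θ => traceFree (h θ)) n =
        (if n = 0 then (t : ℂ) • rotJ else 0) + (if n = m then (expo m θ * w) • circP else 0) +
          (if n = -m then (expo (-m) θ * starRingEnd ℂ w) • circM else 0) := fun n hn => by
      rw [hhper.fcoef_clm hr, hcoef n hn, circDiag_apply, smul_add, smul_add]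
      congr 1
      · congr 1
        · split_ifs with h
          · rw [h, ht, expo_zero_left, one_smul, one_mul]
          · simp
        · split_ifs with h
          · rw [h, smul_smul, one_mul]
          · simp
      · split_ifs with h
        · rw [h, smul_smul, one_mul, hw']
        · simp
    rw [Finset.sum_congr rfl h1, Finset.sum_add_distrib, Finset.sum_add_distrib,
      Finset.sum_ite_eq' _ _ fun _ => (t : ℂ) • rotJ,
      Finset.sum_ite_eq' _ _ fun _ => (expo m θ * w) • circP,
      Finset.sum_ite_eq' _ _ fun _ => (expo (-m) θ * starRingEnd ℂ w) • circM,
      if_pos h0mem, if_pos hmmem, if_pos hnmem]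
  have hgap : ∀ θ ∈ strip d r', ‖traceFree (1 + h θ) - c θ‖ ≤ γ := fun θ hθ => by
    have h1 := (hhper.clm_comp traceFree).norm_sub_truncation_le hr
      (fun θ hθ => (norm_traceFree_le _).trans
        (by linarith [hhn θ hθ] : 2 * ‖h θ‖ ≤ 12 * k * e)) hrr' hδ hδ' (N := N) hθ
    rw [hsum] at h1
    rw [map_add, traceFree_one, zero_add]
    exact h1.trans hγ
  obtain ⟨u, φ, hu, hu1, hφ, hφcj, hφtr, hφeq, hφn⟩ := exists_splitting.choose_spec.2.2 d r' γ
    (t ^ 2 - ‖w‖ ^ 2) (fun θ => 1 + h θ) c (((StripPer.const r 1).add hhper).mono hrr'.le) hcper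
    (fun θ => by rw [map_add, map_one, hhcj]) hccj
    (fun θ hθ => hHdet θ (strip_mono hrr'.le hθ)) (fun θ _ => trace_circ _ _ _) hcdet hΔ
    (fun θ hθ => by linarith [hcn θ hθ])
    (fun θ hθ => by
      rw [add_sub_cancel_left]
      have := hhn θ (strip_mono hrr'.le hθ)
      linarith) hgap hγ' hr'
  refine ⟨Y, u, t, w, φ, hYtr, hYcj, hYn', hu, hu1, htb, hwb, hφ, hφcj, hφtr, hφn, fun θ hθ => ?_⟩
  have h1 := hφeq θ hθ
  simp only [hh, add_sub_cancel] at h1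
  exact h1

end ResonantNormalForm

/-! ### Conjugation of an elliptic matrix to a rotation with a norm bound. -/

section EllipticNormalForm

/-- A matrix in `SL(2,ℝ)` with trace `2 cos ρ`, `sin ρ ≠ 0`, is conjugate to a rotation. -/
theorem exists_elliptic_normal_form {A : RMat} (hA : A.det = 1) {ρ : ℝ}
    (htr : A.trace = 2 * Real.cos ρ) (hsin : Real.sin ρ ≠ 0) :
    ∃ (P : CMat) (ρ' : ℝ), (ρ' = ρ ∨ ρ' = -ρ) ∧ cj P = P ∧ P.det = 1 ∧
      A.toC * P = P * rot ρ' ∧ ‖P‖ ^ 2 ≤ ‖A‖ / |Real.sin ρ| := by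
  -- The sign of the angle is chosen so that y = A₀₁/sin ρ' is nonnegative; the conjugating matrix
  -- contains √y.
  obtain ⟨ρ', hρ', hpos⟩ : ∃ ρ' : ℝ, (ρ' = ρ ∨ ρ' = -ρ) ∧ 0 ≤ A 0 1 / Real.sin ρ' := by
    rcases le_total 0 (A 0 1 / Real.sin ρ) with h | h
    · exact ⟨ρ, Or.inl rfl, h⟩
    · exact ⟨-ρ, Or.inr rfl, by rw [Real.sin_neg, div_neg]; linarith⟩
  have hcos : Real.cos ρ' = Real.cos ρ := by rcases hρ' with rfl | rfl <;> simp
  have habs : |Real.sin ρ'| = |Real.sin ρ| := by rcases hρ' with rfl | rfl <;> simp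
  have hsin' : Real.sin ρ' ≠ 0 := by rw [← abs_pos, habs, abs_pos]; exact hsin
  rw [← hcos] at htr
  rw [← habs]
  set s := Real.sin ρ' with hs
  set c := Real.cos ρ' with hc
  have hsc : s ^ 2 + c ^ 2 = 1 := Real.sin_sq_add_cos_sq ρ'
  rw [Matrix.det_fin_two] at hA
  rw [Matrix.trace_fin_two] at htr
  set x := (A 0 0 - c) / s with hx
  set y := A 0 1 / s with hy
  set z := A 1 0 / s with hz
  have a00 : A 0 0 = c + s * x := by rw [hx]; field_simp; ring
  have a11 : A 1 1 = c - s * x := by linarith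
  have a01 : A 0 1 = s * y := by rw [hy]; field_simp
  have a10 : A 1 0 = s * z := by rw [hz]; field_simp
  -- This says that A = cos ρ' + sin ρ'·J with J² = −1.
  have hxyz : x ^ 2 + y * z = -1 := by
    rw [a00, a11, a01, a10] at hA
    have : s ^ 2 * (x ^ 2 + y * z + 1) = 0 := by linear_combination -hA + hsc
    rcases mul_eq_zero.1 this with h | h
    · exact absurd (pow_eq_zero_iff two_ne_zero |>.1 h) hsin'
    · linarith
  have hy0 : 0 < y := lt_of_le_of_ne hpos fun h => by rw [← h] at hxyz; nlinarith
  set q := Real.sqrt y with hq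
  have hq0 : 0 < q := Real.sqrt_pos.2 hy0
  have hqq : q * q = y := Real.mul_self_sqrt hy0.le
  have hz' : z = -(1 + x ^ 2) / y := by field_simp; linarith
  set P : RMat := !![q, 0; -x / q, 1 / q] with hP
  set R : RMat := !![c, s; -s, c] with hR
  have hRc : R.toC = rot ρ' := by
    ext i j; fin_cases i <;> fin_cases j <;> simp [hR, rot, toC_apply, hs, hc]
  refine ⟨P.toC, ρ', hρ', cj_toC P, ?_, ?_, ?_⟩
  · rw [det_toC]
    have : P.det = 1 := by rw [hP, Matrix.det_fin_two_of]; field_simp; simp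
    rw [this, Complex.ofReal_one]
  · rw [← hRc, ← toC_mul, ← toC_mul]
    congr 1
    rw [Matrix.eta_fin_two A, a00, a11, a01, a10, hz', ← hqq]
    ext i j
    fin_cases i <;> fin_cases j <;> simp [hP, hR] <;> field_simp <;> ring
  · set J : RMat := !![x, y; z, -x] with hJ
    set J₀ : RMat := !![0, -1; 1, 0] with hJ₀
    -- By the C*-identity ‖P‖² = ‖PP*‖, so P is as large as the complex structure J, and J is read
    -- off from A − adj A = 2 sin ρ'·J.
    have hPP : P * star P = J * J₀ := by
      rw [hz'] at hJ
      ext i j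
      fin_cases i <;> fin_cases j <;>
        simp [hP, hJ, hJ₀, Matrix.mul_apply, Fin.sum_univ_two, Matrix.star_apply] <;>
        (try rw [← hqq]) <;> (field_simp; try ring)
    have hJ₀n : ‖J₀‖ ≤ 1 := by
      have h : J₀ * star J₀ = 1 := by
        ext i j
        fin_cases i <;> fin_cases j <;>
          simp [hJ₀, Matrix.mul_apply, Fin.sum_univ_two, Matrix.star_apply]
      have h1 : ‖J₀‖ * ‖J₀‖ = 1 := by rw [← CStarRing.norm_self_mul_star, h, norm_one]
      nlinarith [norm_nonneg J₀]
    have hJA : (2 * s : ℂ) • J.toC = A.toC - A.toC.adjugate := by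
      ext i j
      fin_cases i <;> fin_cases j <;>
        simp [hJ, toC_apply, Matrix.adjugate_fin_two, a00, a11, a01, a10] <;> ring
    have hJn : ‖J‖ ≤ ‖A‖ / |s| := by
      rw [le_div_iff₀ (abs_pos.2 hsin')]
      have h1 := congrArg norm hJA
      have h2 := norm_sub_le A.toC A.toC.adjugate
      have h3 := norm_adjugate_le A.toC
      rw [norm_smul, norm_mul, Complex.norm_ofNat, Complex.norm_real, Real.norm_eq_abs, norm_toC] at h1
      rw [norm_toC] at h2 h3
      linarith
    rw [norm_toC, sq, ← CStarRing.norm_self_mul_star, hPP]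
    calc _ ≤ ‖J‖ * ‖J₀‖ := norm_mul_le _ _
      _ ≤ ‖J‖ * 1 := by gcongr
      _ ≤ _ := by rw [mul_one]; exact hJn

end EllipticNormalForm

/-! ### The half-angle rotation that removes a resonance. -/

section HalfTurn

variable {d : ℕ}

/-- The angle `-⟨m, θ⟩ / 2` of the rotation that removes the resonance `m`. -/
noncomputable def halfAngle (m : Fin d → ℤ) (θ : Fin d → ℂ) : ℂ := -(∑ i, (m i : ℂ) * θ i) / 2

theorem halfAngle_add (m : Fin d → ℤ) (θ : Fin d → ℂ) (α : Fin d → ℝ) :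
    halfAngle m (fun i => θ i + (α i : ℂ)) = halfAngle m θ - (pairing m α : ℂ) / 2 := by
  simp only [halfAngle, pairing, mul_add, Finset.sum_add_distrib]
  push_cast; ring

theorem exp_halfAngle (m : Fin d → ℤ) (θ : Fin d → ℂ) :
    Complex.exp (-(2 * Complex.I * halfAngle m θ)) = expo m θ := by
  rw [halfAngle, expo]; congr 1; ring

theorem exp_neg_halfAngle (m : Fin d → ℤ) (θ : Fin d → ℂ) :
    Complex.exp (2 * Complex.I * halfAngle m θ) = expo (-m) θ := by
  rw [halfAngle, expo]; congr 1
  simp; ring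

theorem halfAngle_toCd (m : Fin d → ℤ) (θ : Fin d → ℝ) :
    halfAngle m (toCd θ) = ((-(pairing m θ) / 2 : ℝ) : ℂ) := by
  simp only [halfAngle, pairing, toCd]; push_cast; ring

/-- A period 2π moves the half angle by an integer multiple of π, so the rotation may change sign.
This is why the conjugacy lives on the doubled torus. -/
theorem halfAngle_shift (m : Fin d → ℤ) (θ : Fin d → ℂ) (n : Fin d → ℤ) :
    halfAngle m (fun i => θ i + (n i : ℂ) * ((2 * Real.pi : ℝ) : ℂ)) =
      halfAngle m θ + ((-∑ i, m i * n i : ℤ) : ℂ) * Real.pi := by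
  simp only [halfAngle, mul_add, Finset.sum_add_distrib]
  push_cast
  have h : ∑ i, (m i : ℂ) * ((n i : ℂ) * (2 * (Real.pi : ℂ))) =
      (∑ i, (m i : ℂ) * (n i : ℂ)) * (2 * Real.pi) := by
    rw [Finset.sum_mul]; exact Finset.sum_congr rfl fun i _ => by ring
  rw [h]; ring

theorem abs_im_halfAngle_le (m : Fin d → ℤ) {θ : Fin d → ℂ} {r : ℝ} (hθ : θ ∈ strip d r) :
    |(halfAngle m θ).im| ≤ l1 m * r / 2 := by
  have h : (halfAngle m θ).im = -(∑ i, (m i : ℝ) * (θ i).im) / 2 := by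
    simp [halfAngle]
  rw [h, abs_div, abs_neg, abs_two]
  refine div_le_div_of_nonneg_right ?_ two_pos.le
  rw [l1, Finset.sum_mul]
  refine (Finset.abs_sum_le_sum_abs _ _).trans (Finset.sum_le_sum fun i _ => ?_)
  rw [abs_mul]
  exact mul_le_mul_of_nonneg_left (hθ i).le (abs_nonneg _)

theorem analyticAt_halfAngle (m : Fin d → ℤ) (θ : Fin d → ℂ) : AnalyticAt ℂ (halfAngle m) θ := by
  unfold halfAngle
  refine AnalyticAt.div (AnalyticAt.neg ?_) analyticAt_const two_ne_zero
  refine Finset.analyticAt_fun_sum _ fun i _ => analyticAt_const.mul ?_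
  exact (ContinuousLinearMap.proj (R := ℂ) (φ := fun _ : Fin d => ℂ) i).analyticAt θ

theorem analyticAt_rot (x : ℂ) : AnalyticAt ℂ rot x := by
  have h : rot = fun x => Complex.cos x • (1 : CMat) + Complex.sin x • rotJ := by
    funext x; ext i j; fin_cases i <;> fin_cases j <;> simp [rot, rotJ]
  rw [h]
  exact (Complex.analyticAt_cos.smul analyticAt_const).add
    (Complex.analyticAt_sin.smul analyticAt_const)

theorem analyticAt_rot_halfAngle (m : Fin d → ℤ) (θ : Fin d → ℂ) :
    AnalyticAt ℂ (fun θ => rot (halfAngle m θ)) θ :=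
  (analyticAt_rot _).comp (analyticAt_halfAngle m θ)

theorem analyticAt_rot_neg_halfAngle (m : Fin d → ℤ) (θ : Fin d → ℂ) :
    AnalyticAt ℂ (fun θ => rot (-halfAngle m θ)) θ :=
  (analyticAt_rot _).comp (analyticAt_halfAngle m θ).neg

theorem norm_rot_halfAngle_le (m : Fin d → ℤ) {θ : Fin d → ℂ} {r : ℝ} (hθ : θ ∈ strip d r) :
    ‖rot (halfAngle m θ)‖ ≤ Real.exp (l1 m * r / 2) :=
  (norm_rot_le _).trans (Real.exp_le_exp.2 (abs_im_halfAngle_le m hθ))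

theorem norm_rot_neg_halfAngle_le (m : Fin d → ℤ) {θ : Fin d → ℂ} {r : ℝ} (hθ : θ ∈ strip d r) :
    ‖rot (-halfAngle m θ)‖ ≤ Real.exp (l1 m * r / 2) := by
  refine (norm_rot_le _).trans (Real.exp_le_exp.2 ?_)
  rw [Complex.neg_im, abs_neg]; exact abs_im_halfAngle_le m hθ

theorem rot_halfAngle_shift (m : Fin d → ℤ) (θ : Fin d → ℂ) (n : Fin d → ℤ) :
    rot (halfAngle m (fun i => θ i + (n i : ℂ) * ((4 * Real.pi : ℝ) : ℂ))) = rot (halfAngle m θ) := by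
  have h : (fun i => θ i + (n i : ℂ) * ((4 * Real.pi : ℝ) : ℂ)) =
      fun i => θ i + ((2 * n i : ℤ) : ℂ) * ((2 * Real.pi : ℝ) : ℂ) := by
    funext i; push_cast; ring
  have h2 := halfAngle_shift m θ (fun i => 2 * n i)
  rw [h, h2, rot_add_int_mul_pi]
  have h1 : (-∑ i, m i * (2 * n i)) = 2 * (-∑ i, m i * n i) := by
    rw [mul_neg, Finset.mul_sum]; congr 1; exact Finset.sum_congr rfl fun i _ => by ring
  rw [h1, zpow_mul]; norm_num

/-- Conjugation by the rotation by `halfAngle m`. -/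
theorem StripPer.rot_conj {r : ℝ} {F : (Fin d → ℂ) → CMat} (hF : StripPer r F) (m : Fin d → ℤ) :
    StripPer r (fun θ => rot (halfAngle m θ) * F θ * rot (-halfAngle m θ)) := by
  obtain ⟨K, hK⟩ := hF.bounded
  refine ⟨fun θ hθ => ((analyticAt_rot_halfAngle m θ).mul (hF.analytic θ hθ)).mul
    (analyticAt_rot_neg_halfAngle m θ), fun θ hθ n => ?_,
    Real.exp (l1 m * r / 2) * K * Real.exp (l1 m * r / 2), fun θ hθ => ?_⟩
  · have h := halfAngle_shift m θ n
    have hF' := hF.periodic θ hθ n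
    rw [h, hF', neg_add, ← neg_mul, ← Int.cast_neg, rot_add_int_mul_pi, rot_add_int_mul_pi]
    simp only [smul_mul_assoc, mul_smul_comm, smul_smul]
    -- The signs of the rotation and of its inverse cancel, so the conjugated function keeps period
    -- 2π.
    rw [← zpow_add₀ (by norm_num), neg_add_cancel, zpow_zero, one_smul]
  · calc _ ≤ ‖rot (halfAngle m θ)‖ * ‖F θ‖ * ‖rot (-halfAngle m θ)‖ :=
          (norm_mul_le _ _).trans (mul_le_mul_of_nonneg_right (norm_mul_le _ _) (norm_nonneg _))
      _ ≤ _ := by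
          have h0 := hK θ hθ
          have h1 := norm_rot_halfAngle_le m hθ
          have h2 := norm_rot_neg_halfAngle_le m hθ
          have h3 : 0 ≤ K := (norm_nonneg _).trans h0
          gcongr

end HalfTurn

/-! ### Conjugation of a rotation cocycle at a resonance. -/

section ResonantConjugation

open NormedSpace

variable {d : ℕ}

/-- The conjugation step at a resonance `m`, for a matrix that is conjugate to a rotation. -/
theorem resonant_conjugation {r r' : ℝ} (hr' : 0 < r') (hrr' : r' < r) {N : ℝ}
    {α : Fin d → ℝ} {A P : CMat} (hP : cj P = P)
    (hPdet : P.det = 1) {ρ : ℝ} (hAP : A * P = P * rot ρ)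
    {f : (Fin d → ℂ) → CMat} (hf : IsStripAnalytic r (2 * Real.pi) sl2R f)
    {m : Fin d → ℤ} (hm0 : m ≠ 0) (hm : l1 m ≤ N) {ε p e q s k γ δ : ℝ}
    (hfε : ∀ θ ∈ strip d r, ‖f θ‖ ≤ ε) (hp : ‖P‖ ^ 2 ≤ p) (hpe : e = p * ε)
    (he : 0 < e) (he1 : e ≤ 1 / 100) (hs : 1 ≤ s) (hq : q = (3 * N) ^ d) (hk : k = q * (5 * s))
    (hz : ∀ n ∈ modes d N, n ≠ 0 → 1 / s ≤ ‖expo n (toCd α) - 1‖)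
    (hρ : ∀ n ∈ modes d N, n ≠ m →
      1 / s ≤ ‖expo n (toCd α) * Complex.exp (-(2 * Complex.I * ρ)) - 1‖)
    (hsmall : 216 * k ^ 2 * e ≤ 1) (hδ : 0 < δ) (hδ' : δ ≤ r - r')
    (hγ : 12 * k * e * (Real.exp (-(N * (r - r' - δ))) * (2 + 2 / δ) ^ d) ≤ γ)
    (hγ' : γ < splitRadius) :
    ∃ (B : (Fin d → ℂ) → CMat) (C : CMat) (u : ℝ) (fp : (Fin d → ℂ) → CMat),
      IsStripAnalytic r' (4 * Real.pi) SL2R B ∧ IsStripAnalytic r' (2 * Real.pi) sl2R fp ∧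
      (∀ θ ∈ strip d r',
        B (fun i => θ i + (α i : ℂ)) * (A * NormedSpace.exp (f θ)) * (B θ)⁻¹ =
          rot (ρ - (pairing m α : ℂ) / 2) * ((u : ℂ) • 1 + C) * NormedSpace.exp (fp θ)) ∧
      (∀ θ ∈ strip d r', ‖B θ‖ ≤ 11 / 10 * ‖P‖ * Real.exp (l1 m * r' / 2)) ∧
      (∀ θ : Fin d → ℝ, ‖B (toCd θ)‖ ≤ 11 / 10 * ‖P‖) ∧
      (∀ θ ∈ strip d r', ‖fp θ‖ ≤ 4 * γ * Real.exp (l1 m * r')) ∧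
      cj C = C ∧ C.trace = 0 ∧ ((u : ℂ) • 1 + C).det = 1 ∧ ‖C‖ ≤ 15 / 2 * e ∧ |u - 1| ≤ e ∧
      ‖coefP C‖ ≤ 3 / 2 * e * Real.exp (-(l1 m * r)) := by
  have hr : 0 < r := hr'.trans hrr'
  have hPu := isUnit_det_of_det hPdet
  have hgn : ∀ θ ∈ strip d r, ‖conjL P (f θ)‖ ≤ e := fun θ hθ => by
    refine (norm_conjL_le hPdet _).trans ?_
    rw [hpe]
    have := hfε θ hθ
    have hp0 : 0 ≤ p := (sq_nonneg _).trans hp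
    gcongr
  obtain ⟨Y, u, t, w, φ, hYtr, hYcj, hYn, hu, hu1, ht, hw, hφ, hφcj, hφtr, hφn, hφeq⟩ :=
    exists_resonant_normal_form hr' hrr' (hf.stripPer.clm_comp (conjL P))
    (fun θ => by rw [cj_conjL hPdet hP, hf.cj_eq])
    (fun θ hθ => by rw [trace_conjL hPdet, hf.trace_eq_zero hr hθ]) hm0 hm ρ he he1 hgn hs hq hk hz
    hρ hsmall hδ hδ' hγ hγ'
  have hN : 1 ≤ N := (one_le_l1 hm0).trans hm
  have hk1 : 1 ≤ k := by
    have hq1 : 1 ≤ q := by rw [hq]; exact one_le_pow₀ (by linarith)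
    rw [hk]; nlinarith
  have hke : k * e ≤ 1 / 100 := by
    have h1 : (k * e) ^ 2 ≤ (1 / 100) ^ 2 := by nlinarith [mul_nonneg (sq_nonneg k) he.le]
    exact le_of_sq_le_sq h1 (by norm_num)
  have hYe : ∀ θ ∈ strip d r', ‖exp (trig N Y θ)‖ ≤ 11 / 10 := fun θ hθ => by
    have h1 := hYn θ (strip_mono hrr'.le hθ)
    have h2 := norm_exp_sub_one_le (trig N Y θ)
    have h3 := real_exp_sub_one_le (norm_nonneg (trig N Y θ)) (by linarith)
    have h4 : ‖exp (trig N Y θ)‖ ≤ ‖exp (trig N Y θ) - 1‖ + ‖(1 : CMat)‖ := by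
      simpa using norm_add_le (exp (trig N Y θ) - 1) 1
    rw [norm_one] at h4
    linarith
  have hYtrig : ∀ θ, (trig N Y θ).trace = 0 := trace_trig hYtr
  have hYreal : ∀ θ : Fin d → ℝ, cj (trig N Y (toCd θ)) = trig N Y (toCd θ) := fun θ => by
    rw [cj_trig_real]; simp only [hYcj]
  have hPi : ‖P⁻¹‖ ≤ ‖P‖ := norm_inv_le_of_det hPdet
  have hPicj : cj P⁻¹ = P⁻¹ := by
    symm
    refine Matrix.inv_eq_left_inv ?_
    calc cj P⁻¹ * P = cj P⁻¹ * cj P := by rw [hP]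
      _ = 1 := by rw [← map_mul, Matrix.nonsing_inv_mul _ hPu, map_one]
  have hPidet : P⁻¹.det = 1 := by rw [inv_eq_adjugate hPdet, Matrix.det_adjugate, hPdet]; simp
  set C : CMat := (t : ℂ) • rotJ + w • circP + starRingEnd ℂ w • circM with hC
  have hExp : StripPer r' (fun θ => exp (trig N Y θ)) := (stripPer_trig r' N Y).exp
  -- The three factors, from right to left: P⁻¹ makes A a rotation, e^Y removes the non-resonant
  -- modes, and the half-angle rotation makes the resonant modes constant.
  set B : (Fin d → ℂ) → CMat := fun θ => rot (halfAngle m θ) * exp (trig N Y θ) * P⁻¹ with hB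
  have hBdet : ∀ θ, (B θ).det = 1 := fun θ => by
    simp only [hB, Matrix.det_mul, det_rot, det_exp_of_trace_zero (hYtrig _), hPidet, mul_one]
  have hBn : ∀ θ ∈ strip d r', ‖B θ‖ ≤ ‖rot (halfAngle m θ)‖ * (11 / 10) * ‖P‖ := fun θ hθ => by
    have h1 := hYe θ hθ
    calc _ ≤ ‖rot (halfAngle m θ)‖ * ‖exp (trig N Y θ)‖ * ‖P⁻¹‖ :=
          (norm_mul_le _ _).trans (mul_le_mul_of_nonneg_right (norm_mul_le _ _) (norm_nonneg _))
      _ ≤ _ := by gcongr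
  have hBn' : ∀ θ ∈ strip d r', ‖B θ‖ ≤ 11 / 10 * ‖P‖ * Real.exp (l1 m * r' / 2) := fun θ hθ => by
    refine (hBn θ hθ).trans ?_
    have h1 := norm_rot_halfAngle_le m hθ
    calc _ ≤ Real.exp (l1 m * r' / 2) * (11 / 10) * ‖P‖ := by gcongr
      _ = _ := by ring
  have hw1 : ‖w‖ ≤ 3 / 2 * e := hw.trans (mul_le_of_le_one_right (by positivity)
      (Real.exp_le_one_iff.2 (by have := mul_nonneg (l1_nonneg m) hr.le; linarith)))
  refine ⟨B, C, u, fun θ => rot (halfAngle m θ) * φ θ * rot (-halfAngle m θ), ?_, ?_, ?_, hBn', ?_,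
    ?_, ?_, trace_circ _ _ _, ?_, ?_, ?_, ?_⟩
  · refine ⟨fun θ hθ => ((analyticAt_rot_halfAngle m θ).mul (hExp.analytic θ hθ)).mul
      analyticAt_const, ⟨_, hBn'⟩, fun θ hθ n => ?_, fun θ => ?_⟩
    · have h1 := hExp.periodic θ hθ (fun i => 2 * n i)
      have h2 : (fun i => θ i + (n i : ℂ) * ((4 * Real.pi : ℝ) : ℂ)) =
          fun i => θ i + ((2 * n i : ℤ) : ℂ) * ((2 * Real.pi : ℝ) : ℂ) := by
        funext i; push_cast; ring
      simp only [hB]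
      rw [rot_halfAngle_shift, h2, h1]
    · refine exists_SL2R_of_cj ?_ (hBdet _)
      simp only [hB]
      rw [map_mul, map_mul, halfAngle_toCd, cj_rot_ofReal, cj_exp, hYreal, hPicj]
  · refine (hφ.rot_conj m).isStripAnalytic fun θ => exists_sl2R_of_cj ?_ ?_
    · rw [map_mul, map_mul, halfAngle_toCd, ← Complex.ofReal_neg, cj_rot_ofReal, cj_rot_ofReal, hφcj]
    · rw [Matrix.trace_mul_comm, ← mul_assoc, rot_neg_mul, one_mul, hφtr _ (toCd_mem_strip hr' θ)]
  · intro θ hθ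
    set x := halfAngle m θ with hx
    have hBi : (B θ)⁻¹ = P * exp (-trig N Y θ) * rot (-x) := by
      refine Matrix.inv_eq_right_inv ?_
      simp only [hB]
      have h1 : exp (trig N Y θ) * exp (-trig N Y θ) = 1 := by
        rw [Matrix.exp_neg, Matrix.mul_nonsing_inv _ (isUnit_det_of_det
          (det_exp_of_trace_zero (hYtrig _)))]
      calc _ = rot x * (exp (trig N Y θ) * (P⁻¹ * P) * exp (-trig N Y θ)) * rot (-x) := by
            simp only [mul_assoc, hx]
        _ = 1 := by
            rw [Matrix.nonsing_inv_mul _ hPu, mul_one, h1, mul_one, rot_mul_neg]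
    have hPA : P⁻¹ * A = rot ρ * P⁻¹ := by
      calc P⁻¹ * A = P⁻¹ * (A * P) * P⁻¹ := by
            rw [mul_assoc, mul_assoc, Matrix.mul_nonsing_inv _ hPu, mul_one]
        _ = _ := by rw [hAP, ← mul_assoc, Matrix.nonsing_inv_mul _ hPu, one_mul]
    have hPf : P⁻¹ * (exp (f θ) * P) = exp (conjL P (f θ)) := by
      rw [← exp_conjL hPdet, ← mul_assoc, Matrix.nonsing_inv_mul _ hPu, one_mul]
    have hYr : exp (trig N Y (θ + toCd α)) * rot ρ =
        rot ρ * exp (conjL (rot ρ) (trig N Y (θ + toCd α))) := (exp_conjL (det_rot _) _).symm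
    -- Conjugation by the half-angle rotation strips the phases e^{±i⟨m,θ⟩} from the normal form.
    have hCx : rot x * ((u : ℂ) • 1 + ((t : ℂ) • rotJ + (expo m θ * w) • circP +
          (expo (-m) θ * starRingEnd ℂ w) • circM)) = ((u : ℂ) • 1 + C) * rot x := by
      have h1 := conjL_rot_circ x t w (starRingEnd ℂ w)
      rw [exp_halfAngle, exp_neg_halfAngle] at h1
      rw [← h1, ← hC, conjL_apply, mul_add, add_mul, ← mul_assoc, ← mul_assoc,
        Matrix.mul_nonsing_inv _ (isUnit_det_of_det (det_rot x)), one_mul, mul_smul_comm, mul_one,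
        smul_mul_assoc, one_mul]
    have hfp : rot (-x) * exp (rot x * φ θ * rot (-x)) = exp (φ θ) * rot (-x) := by
      have h1 := exp_conjL (det_rot (-x)) (φ θ)
      rwa [conjL_apply, rot_inv, neg_neg] at h1
    have hBα : B (fun i => θ i + (α i : ℂ)) =
        rot (x - (pairing m α : ℂ) / 2) * exp (trig N Y (θ + toCd α)) * P⁻¹ := by
      simp only [hB]
      rw [halfAngle_add]
      rfl
    -- Rotations commute, and the translation by α of the half angle turns ρ into ρ − ⟨m,α⟩/2.
    have e1 : rot (x - (pairing m α : ℂ) / 2) * rot ρ = rot (ρ - (pairing m α : ℂ) / 2) * rot x := by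
      rw [← rot_add, ← rot_add]; ring_nf
    calc B (fun i => θ i + (α i : ℂ)) * (A * exp (f θ)) * (B θ)⁻¹
        = rot (x - (pairing m α : ℂ) / 2) * exp (trig N Y (θ + toCd α)) * (P⁻¹ * A) *
            (exp (f θ) * P) * exp (-trig N Y θ) * rot (-x) := by
          rw [hBi, hBα]; simp only [mul_assoc]
      _ = rot (x - (pairing m α : ℂ) / 2) * (exp (trig N Y (θ + toCd α)) * rot ρ) *
            (P⁻¹ * (exp (f θ) * P)) * exp (-trig N Y θ) * rot (-x) := by
          rw [hPA]; simp only [mul_assoc]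
      _ = (rot (x - (pairing m α : ℂ) / 2) * rot ρ) *
            (exp (conjL (rot ρ) (trig N Y (θ + toCd α))) * exp (conjL P (f θ)) *
              exp (-trig N Y θ)) * rot (-x) := by
          rw [hYr, hPf]; simp only [mul_assoc]
      _ = rot (ρ - (pairing m α : ℂ) / 2) * (rot x * ((u : ℂ) • 1 + ((t : ℂ) • rotJ +
            (expo m θ * w) • circP + (expo (-m) θ * starRingEnd ℂ w) • circM))) *
            (exp (φ θ) * rot (-x)) := by
          rw [← hφeq θ hθ, e1]; simp only [mul_assoc]
      _ = rot (ρ - (pairing m α : ℂ) / 2) * ((u : ℂ) • 1 + C) * (rot x * rot (-x)) *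
            exp (rot x * φ θ * rot (-x)) := by
          rw [hCx, ← hfp]; simp only [mul_assoc]
      _ = _ := by rw [rot_mul_neg, mul_one]
  · intro θ
    have h1 := hBn _ (toCd_mem_strip hr' θ)
    rw [halfAngle_toCd, norm_rot_ofReal, one_mul] at h1
    exact h1
  · intro θ hθ
    have h0 := hφn θ hθ
    have h1 := norm_rot_halfAngle_le m hθ
    have h2 := norm_rot_neg_halfAngle_le m hθ
    calc _ ≤ ‖rot (halfAngle m θ)‖ * ‖φ θ‖ * ‖rot (-halfAngle m θ)‖ :=
          (norm_mul_le _ _).trans (mul_le_mul_of_nonneg_right (norm_mul_le _ _) (norm_nonneg _))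
      _ ≤ Real.exp (l1 m * r' / 2) * (4 * γ) * Real.exp (l1 m * r' / 2) := by
          have h3 : 0 ≤ 4 * γ := (norm_nonneg _).trans h0
          gcongr
      _ = 4 * γ * (Real.exp (l1 m * r' / 2) * Real.exp (l1 m * r' / 2)) := by ring
      _ = _ := by rw [← Real.exp_add, add_halves]
  · rw [hC, map_add, map_add, cj_smul, cj_smul, cj_smul, cj_rotJ, cj_circP, cj_circM,
      Complex.conj_conj, Complex.conj_ofReal]
    abel
  · rw [det_smul_one_add (trace_circ _ _ _), det_circ, Complex.mul_conj']
    have : (u : ℂ) ^ 2 = 1 - ((t : ℂ) ^ 2 - (‖w‖ : ℂ) ^ 2) := by exact_mod_cast hu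
    rw [this]; ring
  · refine norm_add₃_le.trans ?_
    rw [norm_smul, norm_smul, norm_smul, Complex.norm_real, Real.norm_eq_abs, RCLike.norm_conj]
    have h3 := mul_le_mul ht norm_rotJ_le (norm_nonneg _) (by positivity)
    have h4 := mul_le_mul hw1 norm_circP_le (norm_nonneg _) (by positivity)
    have h5 := mul_le_mul hw1 norm_circM_le (norm_nonneg _) (by positivity)
    linarith
  · refine hu1.trans ?_
    have h2 : t ^ 2 ≤ (3 / 2 * e) ^ 2 := by
      rw [← sq_abs]; exact pow_le_pow_left₀ (abs_nonneg _) ht 2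
    have h3 : ‖w‖ ^ 2 ≤ (3 / 2 * e) ^ 2 := pow_le_pow_left₀ (norm_nonneg _) hw1 2
    rw [abs_le]
    constructor <;> nlinarith [sq_nonneg t, sq_nonneg ‖w‖]
  · rw [hC, coefP_circ]; exact hw

end ResonantConjugation

/-! ### Real logarithms of real unimodular matrices near the identity. -/

section SmallLogarithm

open NormedSpace

/-- Commuting trace-free 2 × 2 matrices are proportional, and this is the proportion measured by the
linear functional `coefP`. -/
theorem coefP_smul_eq_of_commute {X T : CMat} (hX : X.trace = 0) (hT : T.trace = 0)
    (h : X * T = T * X) : coefP X • T = coefP T • X := by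
  rw [Matrix.trace_fin_two] at hX hT
  have x11 : X 1 1 = -X 0 0 := by linear_combination hX
  have t11 : T 1 1 = -T 0 0 := by linear_combination hT
  have h00 := congrFun (congrFun h 0) 0
  have h01 := congrFun (congrFun h 0) 1
  have h10 := congrFun (congrFun h 1) 0
  simp only [Matrix.mul_apply, Fin.sum_univ_two, x11, t11] at h00 h01 h10
  have e1 : X 0 0 * T 0 1 = T 0 0 * X 0 1 := by linear_combination h01 / 2
  have e2 : X 0 0 * T 1 0 = T 0 0 * X 1 0 := by linear_combination -h10 / 2
  have e3 : X 0 1 * T 1 0 = T 0 1 * X 1 0 := by linear_combination h00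
  ext i j
  fin_cases i <;> fin_cases j <;> simp [coefP_apply, x11, t11]
  · linear_combination (Complex.I / 2) * (e1 + e2)
  · linear_combination e1 + (Complex.I / 2) * e3
  · linear_combination e2 - (Complex.I / 2) * e3
  · linear_combination (Complex.I / 2) * (e1 + e2)

/-- X commutes with the trace-free part T of e^X, so the two are proportional; since ‖X‖ ≤ 2‖T‖, a
small off-diagonal entry of e^X forces one of X, however large the diagonal part is in comparison.
-/
theorem norm_coefP_le_exp {X : CMat} (hX : X.trace = 0) (hX8 : ‖X‖ ≤ 1 / 8) :
    ‖coefP X‖ ≤ 2 * ‖coefP (exp X)‖ := by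
  rcases eq_or_ne X 0 with rfl | hX0
  · simp
  set T := traceFree (exp X) with hT
  have hc : X * T = T * X := by
    have h1 : X * exp X = exp X * X := ((Commute.refl X).exp_right).eq
    rw [hT, traceFree_apply, mul_sub, sub_mul, h1, mul_smul_comm, smul_mul_assoc, mul_one, one_mul]
  have h1 := congrArg norm (coefP_smul_eq_of_commute hX (trace_traceFree (exp X)) hc)
  rw [← hT, norm_smul, norm_smul, hT, coefP_traceFree, ← hT] at h1
  have h2 : T - X = traceFree (exp X - 1 - X) := by
    rw [map_sub, map_sub, traceFree_one, sub_zero, traceFree_of_trace_zero hX]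
  have h3 : ‖T - X‖ ≤ 1 / 2 * ‖X‖ := by
    rw [h2]
    refine (norm_traceFree_le _).trans ?_
    have h4 := norm_exp_sub_one_sub_le X
    have h5 := real_exp_sub_one_le (norm_nonneg X) (by linarith)
    have h6 := mul_le_mul_of_nonneg_right h5 (norm_nonneg X)
    nlinarith [norm_nonneg X]
  have h4 : ‖X‖ ≤ 2 * ‖T‖ := by
    have := norm_sub_norm_le X T
    rw [norm_sub_rev] at this
    linarith
  have h5 : 0 < ‖X‖ := norm_pos_iff.2 hX0
  have h6 : ‖coefP X‖ * ‖X‖ ≤ 2 * ‖coefP (exp X)‖ * ‖X‖ := by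
    nlinarith [norm_nonneg (coefP X)]
  exact le_of_mul_le_mul_right h6 h5

/-- A radius on which the exponential of `2 × 2` matrices has an inverse. -/
noncomputable def logRadius : ℝ := (exists_local_log CMat).choose

theorem logRadius_pos : 0 < logRadius := (exists_local_log CMat).choose_spec.1

/-- A real unimodular matrix that is close to the identity has a small real logarithm. -/
theorem exists_sl2R_log {G : CMat} (hG : cj G = G) (hdet : G.det = 1) {η : ℝ} (hη1 : η ≤ 1 / 16)
    (hηl : η ≤ logRadius) (hGη : ‖G - 1‖ ≤ 2 / 3 * η) (hη0 : 0 < η) :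
    ∃ X : RMat, X ∈ sl2R ∧ exp X.toC = G ∧ ‖X‖ ≤ η ∧ ‖coefP X.toC‖ ≤ 2 * ‖coefP G‖ := by
  obtain ⟨-, hδ, ℓ, -, hℓ⟩ := (exists_local_log CMat).choose_spec
  obtain ⟨h1, h2⟩ := hℓ G (by
    rw [mem_ball_iff_norm]
    exact lt_of_le_of_lt hGη (lt_of_lt_of_le (by linarith) hηl))
  set X := ℓ G with hX
  have h3 : ‖X‖ ≤ 4 / 3 * η := by linarith
  have hX12 : ‖X‖ ≤ 1 / 12 := by linarith
  have htr : X.trace = 0 := trace_eq_zero_of_exp (by rw [h1, hdet]) (by linarith)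
  have hcj : cj X = X := exp_injOn_small (by rw [norm_cj]; linarith) (by linarith)
    (by rw [← cj_exp, h1, hG])
  obtain ⟨Y, hY, hXY⟩ := exists_sl2R_of_cj hcj htr
  refine ⟨Y, hY, by rw [← hXY, h1], ?_, ?_⟩
  · rw [← norm_toC, ← hXY]
    have h4 := norm_exp_sub_one_sub_le X
    have h5 := real_exp_sub_one_le (norm_nonneg X) (by linarith)
    have h6 := mul_le_mul_of_nonneg_right h5 (norm_nonneg X)
    rw [h1] at h4
    -- The crude factor 2 of the logarithm is improved: ‖X‖ ≤ 2η/3 + 2‖X‖² and ‖X‖ ≤ 1/12 give ‖X‖ ≤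
    -- η.
    have h7 : ‖X‖ ≤ ‖G - 1‖ + ‖G - 1 - X‖ := by
      rw [norm_sub_rev (G - 1) X]
      simpa using norm_add_le (G - 1) (X - (G - 1))
    nlinarith [norm_nonneg X]
  · rw [← hXY, ← h1]
    exact norm_coefP_le_exp htr (by linarith)

end SmallLogarithm

/-! ### The resonant step: divisors, reality of the angle, and the new constant matrix. -/

section ResonantStep

open NormedSpace

variable {d : ℕ}

theorem cayleyM_conj_of_sl2R {X : RMat} (hX : X ∈ sl2R) : cayleyM * X.toC * cayleyM⁻¹ =
    !![Complex.I * ((coefJ X.toC).re : ℂ), coefP X.toC; (starRingEnd ℂ) (coefP X.toC),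
      -(Complex.I * ((coefJ X.toC).re : ℂ))] := by
  have htr : X.toC.trace = 0 := by
    have : X.trace = 0 := hX
    rw [trace_toC, this, Complex.ofReal_zero]
  have h1 : ((coefJ X.toC).re : ℂ) = coefJ X.toC := by
    refine Complex.conj_eq_iff_re.1 ?_
    rw [← coefJ_cj, cj_toC]
  have h2 : coefM X.toC = starRingEnd ℂ (coefP X.toC) := by
    rw [← coefM_cj, cj_toC]
  rw [cayleyM_conj, htr, h1, h2, zero_div, zero_add, zero_sub]

theorem norm_exp_ofReal_mul_I_sub_one (x : ℝ) :
    1 / 2 * distTwoPi (x : ℂ) ≤ ‖Complex.exp (Complex.I * x) - 1‖ := by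
  have := norm_exp_I_mul_sub_one_lower (x : ℂ)
  simpa using this

/-- The resonant step for a matrix conjugate to a rotation by a real angle. -/
theorem elliptic_resonant_step {r r' : ℝ} (hr' : 0 < r') (hrr' : r' < r) {N N₂ : ℝ} (hN₂ : N ≤ N₂)
    {κ τ : ℝ} (hκ : 0 < κ) (hτ : 0 < τ) {α : Fin d → ℝ} (hα : IsDC κ τ α)
    {A : Matrix.SpecialLinearGroup (Fin 2) ℝ} {P : CMat} (hP : cj P = P)
    (hPdet : P.det = 1) {ρ : ℝ} (hAP : RMat.toC A * P = P * rot ρ)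
    {f : (Fin d → ℂ) → CMat} (hf : IsStripAnalytic r (2 * Real.pi) sl2R f)
    {m : Fin d → ℤ} (hm0 : m ≠ 0) (hm : l1 m ≤ N) {ε η p e q s k γ δ : ℝ}
    (hres : distTwoPi (2 * ρ - (pairing m α : ℂ)) < η)
    (hη0 : 0 < η) (hη1 : η ≤ 1 / 16) (hηl : η ≤ logRadius)
    (hηκ : η ≤ κ / (2 * (N₂ + N) ^ τ))
    (hfε : ∀ θ ∈ strip d r, ‖f θ‖ ≤ ε) (hp : ‖P‖ ^ 2 ≤ p) (hpe : e = p * ε)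
    (he : 0 < e) (heη : e ≤ η / 100) (hs : 1 ≤ s) (hsN : 4 * (N₂ + N) ^ τ / κ ≤ s)
    (hq : q = (3 * N₂) ^ d) (hk : k = q * (5 * s)) (hsmall : 216 * k ^ 2 * e ≤ 1)
    (hδ : 0 < δ) (hδ' : δ ≤ r - r')
    (hγ : 12 * k * e * (Real.exp (-(N₂ * (r - r' - δ))) * (2 + 2 / δ) ^ d) ≤ γ)
    (hγ' : γ < splitRadius) :
    ∃ (B : (Fin d → ℂ) → CMat) (Ap : Matrix.SpecialLinearGroup (Fin 2) ℝ)
      (fp : (Fin d → ℂ) → CMat),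
      IsStripAnalytic r' (4 * Real.pi) SL2R B ∧ IsStripAnalytic r' (2 * Real.pi) sl2R fp ∧
      (∀ θ ∈ strip d r',
        B (fun i => θ i + (α i : ℂ)) * (RMat.toC A * NormedSpace.exp (f θ)) * (B θ)⁻¹ =
          RMat.toC Ap * NormedSpace.exp (fp θ)) ∧
      stripNorm r' B ≤ 11 / 10 * ‖P‖ * Real.exp (l1 m * r' / 2) ∧
      realNorm B ≤ 11 / 10 * ‖P‖ ∧
      stripNorm r' fp ≤ 4 * γ * Real.exp (l1 m * r') ∧
      ∃ (X : RMat) (j : ℤ), X ∈ sl2R ∧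
        ‖2 * (ρ : ℂ) - (pairing m α : ℂ) - 2 * (Real.pi : ℂ) * (j : ℂ)‖ < η ∧
        (Ap : RMat) = (-1 : ℝ) ^ j • NormedSpace.exp X ∧ ‖X‖ ≤ η ∧
        ‖coefP X.toC‖ ≤ 3 * e * Real.exp (-(l1 m * r)) := by
  have hN1 : 1 ≤ N := (one_le_l1 hm0).trans hm
  have hNN : 0 < (N₂ + N) ^ τ := Real.rpow_pos_of_pos (by linarith) _
  have hs0 : 0 < s := by linarith
  have hsκ : 1 / s ≤ κ / (4 * (N₂ + N) ^ τ) := by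
    rw [div_le_iff₀ hκ] at hsN
    rw [div_le_div_iff₀ hs0 (by positivity)]
    linarith
  have hlow : ∀ n : Fin d → ℤ, n ≠ 0 → l1 n ≤ N₂ + N →
      κ / (N₂ + N) ^ τ ≤ distTwoPi (pairing n α : ℂ) := fun n hn0 hn => (hα.lower hκ hτ hn0 hn).le
  have hz : ∀ n ∈ modes d N₂, n ≠ 0 → 1 / s ≤ ‖expo n (toCd α) - 1‖ := fun n hn hn0 => by
    rw [mem_modes] at hn
    have h1 := hlow n hn0 (by linarith)
    have h2 := norm_exp_ofReal_mul_I_sub_one (pairing n α)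
    rw [expo_toCd]
    have h3 : κ / (4 * (N₂ + N) ^ τ) = 1 / 4 * (κ / (N₂ + N) ^ τ) := by field_simp
    have h4 : 0 ≤ κ / (N₂ + N) ^ τ := by positivity
    linarith
  have hz' : ∀ n ∈ modes d N₂, n ≠ m →
      1 / s ≤ ‖expo n (toCd α) * Complex.exp (-(2 * Complex.I * ρ)) - 1‖ := fun n hn hnm => by
    rw [mem_modes] at hn
    -- A second resonance is excluded by comparing n with m: ⟨n − m,α⟩ is at distance at least
    -- κ/(N₂+N)^τ from 2πℤ, and the resonance of m uses up at most half of it.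
    have h1 := hlow (n - m) (sub_ne_zero.2 hnm) ((l1_sub_le n m).trans (by linarith))
    have h2 := norm_exp_ofReal_mul_I_sub_one (pairing n α - 2 * ρ)
    have h3 := distTwoPi_add_le ((pairing n α - 2 * ρ : ℝ) : ℂ) (2 * ρ - (pairing m α : ℂ))
    have h4 : ((pairing n α - 2 * ρ : ℝ) : ℂ) + (2 * ρ - (pairing m α : ℂ)) =
        (pairing (n - m) α : ℂ) := by
      rw [sub_eq_add_neg n m, pairing_add, pairing_neg]; push_cast; ring
    rw [h4] at h3
    have h5 : expo n (toCd α) * Complex.exp (-(2 * Complex.I * ρ)) =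
        Complex.exp (Complex.I * ((pairing n α - 2 * ρ : ℝ) : ℂ)) := by
      rw [expo_toCd, ← Complex.exp_add]; congr 1; push_cast; ring
    rw [h5]
    have h6 : κ / (4 * (N₂ + N) ^ τ) = 1 / 4 * (κ / (N₂ + N) ^ τ) := by field_simp
    have h7 : κ / (2 * (N₂ + N) ^ τ) = 1 / 2 * (κ / (N₂ + N) ^ τ) := by field_simp
    linarith
  obtain ⟨B, C, u, fp, hBan, hfpan, hconj, hBn, hBr, hfpn, hCcj, hCtr, hCdet, hCn, hu, hCP⟩ :=
    resonant_conjugation hr' hrr' hP hPdet hAP hf hm0 (hm.trans hN₂) hfε hp hpe he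
      (by linarith) hs hq hk hz hz' hsmall hδ hδ' hγ hγ'
  obtain ⟨j, hj⟩ := exists_lt_of_distTwoPi_lt hres
  set φ : ℝ := ρ - pairing m α / 2 - Real.pi * j with hφ
  have hφη : |φ| < η / 2 := by
    have h1 : 2 * (ρ : ℂ) - (pairing m α : ℂ) - 2 * (Real.pi : ℂ) * (j : ℂ) = ((2 * φ : ℝ) : ℂ) := by
      rw [hφ]; push_cast; ring
    rw [h1, Complex.norm_real, Real.norm_eq_abs, abs_mul, abs_two] at hj
    linarith
  have hrot : rot (ρ - (pairing m α : ℂ) / 2) = (-1 : ℂ) ^ j • rot φ := by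
    rw [← rot_add_int_mul_pi, hφ]
    congr 1; push_cast; ring
  set G : CMat := rot φ * ((u : ℂ) • 1 + C) with hG
  have hucj : cj ((u : ℂ) • 1 + C) = (u : ℂ) • 1 + C := by
    rw [map_add, cj_smul, map_one, hCcj, Complex.conj_ofReal]
  have hGcj : cj G = G := by rw [hG, map_mul, cj_rot_ofReal, hucj]
  have hGdet : G.det = 1 := by rw [hG, Matrix.det_mul, det_rot, hCdet, mul_one]
  -- The angle φ contributes η/2 and the factor u + C at most 17e/2 ≤ 0.085η.
  have hG1 : ‖G - 1‖ ≤ 2 / 3 * η := by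
    have h1 : ‖(u : ℂ) • 1 + C - 1‖ ≤ 17 / 2 * e := by
      have : (u : ℂ) • 1 + C - 1 = ((u - 1 : ℝ) : ℂ) • 1 + C := by
        push_cast; rw [sub_smul, one_smul]; abel
      rw [this]
      refine (norm_add_le _ _).trans ?_
      rw [norm_smul, norm_one, mul_one, Complex.norm_real, Real.norm_eq_abs]
      linarith
    have h2 : G - 1 = (rot φ - 1) + rot φ * ((u : ℂ) • 1 + C - 1) := by
      rw [hG, mul_sub, mul_one]; abel
    rw [h2]
    refine (norm_add_le _ _).trans ?_
    have h3 := norm_rot_ofReal_sub_one_le φ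
    have h4 := norm_mul_le (rot φ) ((u : ℂ) • 1 + C - 1)
    rw [norm_rot_ofReal, one_mul] at h4
    linarith
  obtain ⟨X, hX, hXG, hXn, hXP⟩ := exists_sl2R_log hGcj hGdet hη1 hηl hG1 hη0
  have hXP' : ‖coefP X.toC‖ ≤ 3 * e * Real.exp (-(l1 m * r)) := by
    rw [hG, coefP_rot_mul _ _ hCtr, norm_mul, mul_comm Complex.I, Complex.norm_exp_ofReal_mul_I,
      one_mul] at hXP
    linarith
  obtain ⟨Y, hY, hYe⟩ : ∃ Y ∈ SL2R, rot (ρ - (pairing m α : ℂ) / 2) * ((u : ℂ) • 1 + C) = Y.toC := by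
    refine exists_SL2R_of_cj ?_ (by rw [Matrix.det_mul, det_rot, hCdet, mul_one])
    have h1 : (ρ : ℂ) - (pairing m α : ℂ) / 2 = ((ρ - pairing m α / 2 : ℝ) : ℂ) := by push_cast; ring
    rw [map_mul, hucj, h1, cj_rot_ofReal]
  refine ⟨B, ⟨Y, hY⟩, fp, hBan, hfpan, fun θ hθ => ?_, stripNorm_le hr' hBn, realNorm_le hBr,
    stripNorm_le hr' hfpn, X, j, hX, hj, ?_, hXn, hXP'⟩
  · rw [hconj θ hθ, hYe]
  · apply toC_injective
    change Y.toC = _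
    rw [← hYe, toC_smul, toC_exp, hXG, hrot, smul_mul_assoc]
    push_cast
    rfl

/-- The conjugation step at a resonance. -/
theorem resonant_step {r r' : ℝ} (hr' : 0 < r') (hrr' : r' < r) {N N₂ : ℝ} (hN₂ : N ≤ N₂)
    {κ τ : ℝ} (hκ : 0 < κ) (hτ : 0 < τ) {α : Fin d → ℝ} (hα : IsDC κ τ α)
    {A : Matrix.SpecialLinearGroup (Fin 2) ℝ} {ρ : ℂ} (hρ : HasEigenvaluePair (A : RMat) ρ)
    {f : (Fin d → ℂ) → CMat} (hf : IsStripAnalytic r (2 * Real.pi) sl2R f)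
    {m : Fin d → ℤ} (hm0 : m ≠ 0) (hm : l1 m ≤ N) {ε η K e q s k γ δ : ℝ}
    (hres : distTwoPi (2 * ρ - (pairing m α : ℂ)) < η)
    (hη0 : 0 < η) (hη1 : η ≤ 1 / 16) (hηl : η ≤ logRadius)
    (hηκ : η ≤ κ / (2 * (N₂ + N) ^ τ)) (hηN : η ≤ κ / (10 * N ^ τ)) (hε : 0 < ε)
    (hfε : ∀ θ ∈ strip d r, ‖f θ‖ ≤ ε) (hK : K = ‖(A : RMat)‖ * N ^ τ / κ) (hpe : e = 5 * K * ε)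
    (heη : e ≤ η / 100) (hs : 1 ≤ s) (hsN : 4 * (N₂ + N) ^ τ / κ ≤ s)
    (hq : q = (3 * N₂) ^ d) (hk : k = q * (5 * s)) (hsmall : 216 * k ^ 2 * e ≤ 1)
    (hδ : 0 < δ) (hδ' : δ ≤ r - r')
    (hγ : 12 * k * e * (Real.exp (-(N₂ * (r - r' - δ))) * (2 + 2 / δ) ^ d) ≤ γ)
    (hγ' : γ < splitRadius) :
    ∃ (B : (Fin d → ℂ) → CMat) (Ap : Matrix.SpecialLinearGroup (Fin 2) ℝ)
      (fp : (Fin d → ℂ) → CMat),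
      IsStripAnalytic r' (4 * Real.pi) SL2R B ∧ IsStripAnalytic r' (2 * Real.pi) sl2R fp ∧
      (∀ θ ∈ strip d r',
        B (fun i => θ i + (α i : ℂ)) * (RMat.toC A * NormedSpace.exp (f θ)) * (B θ)⁻¹ =
          RMat.toC Ap * NormedSpace.exp (fp θ)) ∧
      stripNorm r' B ≤ 11 / 10 * Real.sqrt (5 * K) * Real.exp (l1 m * r' / 2) ∧
      realNorm B ≤ 11 / 10 * Real.sqrt (5 * K) ∧
      stripNorm r' fp ≤ 4 * γ * Real.exp (l1 m * r') ∧
      ∃ (X : RMat) (j : ℤ), X ∈ sl2R ∧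
        ‖2 * ρ - (pairing m α : ℂ) - 2 * (Real.pi : ℂ) * (j : ℂ)‖ < η ∧
        (Ap : RMat) = (-1 : ℝ) ^ j • NormedSpace.exp X ∧ ‖X‖ ≤ η ∧
        ‖coefP X.toC‖ ≤ 3 * e * Real.exp (-(l1 m * r)) := by
  have hN1 : 1 ≤ N := (one_le_l1 hm0).trans hm
  have hNτ : 0 < N ^ τ := Real.rpow_pos_of_pos (by linarith) _
  have hA1 : 1 ≤ ‖(A : RMat)‖ := norm_toC_SL_ge A
  have hK0 : 0 < K := by rw [hK]; positivity
  have hmα := hα.lower hκ hτ hm0 hm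
  have hηN' : κ / (10 * N ^ τ) = 1 / 10 * (κ / N ^ τ) := by field_simp
  have hκN : 0 < κ / N ^ τ := by positivity
  have htr : ((A : RMat).trace : ℂ) = 2 * Complex.cos ρ := by
    have h1 := trace_of_hasEigenvaluePair hρ
    rw [trace_toC] at h1
    rw [h1, Complex.two_cos]
    ring_nf
  -- the rotation number is real
  obtain ⟨x, rfl⟩ : ∃ x : ℝ, ρ = x := by
    refine ⟨ρ.re, ?_⟩
    have him : (Complex.cos ρ).im = 0 := by
      have := congrArg Complex.im htr
      simp at this
      exact this
    -- The trace is real, so either Re ρ ∈ πℤ or ρ is real. In the first case the resonance would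
    -- put ⟨m,α⟩ within η ≤ κ/(10N^τ) of 2πℤ, against the Diophantine condition.
    have h1 : Real.sin ρ.re * Real.sinh ρ.im = 0 := by
      rw [← Complex.re_add_im ρ, Complex.cos_add_mul_I] at him
      simp [← Complex.ofReal_cos, ← Complex.ofReal_sin, ← Complex.ofReal_cosh,
        ← Complex.ofReal_sinh] at him
      simpa using him
    rcases mul_eq_zero.1 h1 with h | h
    · exfalso
      obtain ⟨n, hn⟩ := Real.sin_eq_zero_iff.1 h
      have h2 := distTwoPi_re_le (2 * ρ - (pairing m α : ℂ))
      have h3 : (((2 * ρ - (pairing m α : ℂ)).re : ℝ) : ℂ) =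
          2 * (Real.pi : ℂ) * (n : ℂ) - (pairing m α : ℂ) := by
        simp [← hn]; ring
      rw [h3] at h2
      have h4 := distTwoPi_sub_le (2 * (Real.pi : ℂ) * (n : ℂ))
        (2 * (Real.pi : ℂ) * (n : ℂ) - (pairing m α : ℂ))
      have h5 := distTwoPi_le (2 * (Real.pi : ℂ) * (n : ℂ)) n
      rw [sub_self, norm_zero] at h5
      rw [sub_sub_cancel] at h4
      linarith
    · rw [Real.sinh_eq_zero] at h
      apply Complex.ext <;> simp [h]
  have htr' : (A : RMat).trace = 2 * Real.cos x := by
    rw [← Complex.ofReal_cos] at htr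
    exact_mod_cast htr
  -- Since η costs at most a tenth, 2x has distance at least (9/10)κ/N^τ to 2πℤ, and |e^{2ix} − 1| =
  -- 2|sin x| is at least half of that distance. Hence ‖P‖² ≤ (40/9)K ≤ 5K.
  have hsin : 9 / 40 * (κ / N ^ τ) ≤ |Real.sin x| := by
    have h1 := norm_exp_ofReal_mul_I_sub_one (2 * x)
    have h2 : Complex.exp (Complex.I * ((2 * x : ℝ) : ℂ)) - 1 =
        Complex.exp (Complex.I * x) * (2 * Complex.I * Real.sin x) := by
      have e1 : Complex.exp (Complex.I * ((2 * x : ℝ) : ℂ)) =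
          Complex.exp (Complex.I * x) * Complex.exp (Complex.I * x) := by
        rw [← Complex.exp_add]; congr 1; push_cast; ring
      rw [e1, exp_I_mul_eq, Complex.ofReal_sin]
      linear_combination Complex.sin_sq_add_cos_sq (x : ℂ) - Complex.sin (x : ℂ) ^ 2 * Complex.I_sq
    rw [h2, norm_mul, mul_comm Complex.I, Complex.norm_exp_ofReal_mul_I, one_mul, norm_mul,
      norm_mul, Complex.norm_I, Complex.norm_real, Real.norm_eq_abs, Complex.norm_ofNat] at h1
    have h3 := distTwoPi_sub_le (2 * (x : ℂ)) (2 * x - (pairing m α : ℂ))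
    rw [sub_sub_cancel] at h3
    push_cast at h1
    linarith
  obtain ⟨P, x', hx', hPcj, hPdet, hAP, hPn⟩ := exists_elliptic_normal_form A.2 htr'
    (abs_pos.1 (lt_of_lt_of_le (by positivity) hsin))
  have hPK : ‖P‖ ^ 2 ≤ 5 * K := by
    refine hPn.trans ?_
    rw [div_le_iff₀ (lt_of_lt_of_le (by positivity) hsin)]
    have h1 : K * (κ / N ^ τ) = ‖(A : RMat)‖ := by rw [hK]; field_simp
    have h2 := mul_le_mul_of_nonneg_left hsin (by positivity : 0 ≤ 5 * K)
    change ‖(A : RMat)‖ ≤ _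
    nlinarith
  have hPs : ‖P‖ ≤ Real.sqrt (5 * K) := Real.le_sqrt_of_sq_le hPK
  have he : 0 < e := by rw [hpe]; positivity
  rcases hx' with rfl | rfl
  · obtain ⟨B, Ap, fp, h1, h2, h3, h4, h5, h6, h7⟩ := elliptic_resonant_step hr' hrr' hN₂ hκ hτ hα
      hPcj hPdet hAP hf hm0 hm hres hη0 hη1 hηl hηκ hfε hPK hpe he heη hs hsN hq hk hsmall hδ hδ' hγ
      hγ'
    exact ⟨B, Ap, fp, h1, h2, h3, h4.trans (by gcongr), h5.trans (by gcongr), h6, h7⟩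
  -- When the normal form has angle −x, the step is applied with −m; |m| is unchanged, and j changes
  -- sign, which does not affect (−1)^j.
  · have e1 : ∀ y : ℂ, 2 * ((-x : ℝ) : ℂ) - (pairing (-m) α : ℂ) + y =
        -(2 * (x : ℂ) - (pairing m α : ℂ) - y) := fun y => by rw [pairing_neg]; push_cast; ring
    obtain ⟨B, Ap, fp, h1, h2, h3, h4, h5, h6, X, j, h7, h8, h9, h10, h11⟩ :=
      elliptic_resonant_step hr' hrr' hN₂ hκ hτ hα hPcj hPdet hAP hf (neg_ne_zero.2 hm0)
      (by rwa [l1_neg]) (by have := e1 0; rw [add_zero, sub_zero] at this; rwa [this, distTwoPi_neg])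
      hη0 hη1 hηl hηκ hfε hPK hpe he heη hs hsN hq hk hsmall hδ hδ' hγ hγ'
    rw [l1_neg] at h4 h6 h11
    refine ⟨B, Ap, fp, h1, h2, h3, h4.trans (by gcongr), h5.trans (by gcongr), h6, X, -j, h7, ?_,
      ?_, h10, h11⟩
    · rw [sub_eq_add_neg (2 * ((-x : ℝ) : ℂ) - _), e1, norm_neg] at h8
      rw [Int.cast_neg, mul_neg]
      exact h8
    · rw [h9, zpow_neg, ← inv_zpow]; norm_num

end ResonantStep

/-! ### The scale X = ε^{-σ/100} extracted from the smallness condition. -/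

section Thresholds

open Filter Topology

theorem eventually_log_rpow_le {p μ : ℝ} (hp : 0 < p) (hμ : 0 < μ) :
    ∀ᶠ ε in 𝓝[>] (0 : ℝ), (2 * |Real.log ε|) ^ p ≤ ε ^ (-μ) := by
  have h1 := tendsto_log_mul_rpow_nhdsGT_zero (div_pos hμ hp)
  have h2 := h1.abs
  rw [abs_zero] at h2
  filter_upwards [h2.eventually_le_const (by norm_num : (0 : ℝ) < 1 / 2), self_mem_nhdsWithin]
    with ε hε hε0
  have hε0 : 0 < ε := hε0
  have h3 : 2 * |Real.log ε| ≤ ε ^ (-(μ / p)) := by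
    rw [abs_mul, abs_of_pos (Real.rpow_pos_of_pos hε0 _)] at hε
    rw [Real.rpow_neg hε0.le, ← one_div, le_div_iff₀ (Real.rpow_pos_of_pos hε0 _)]
    linarith
  calc _ ≤ (ε ^ (-(μ / p))) ^ p := Real.rpow_le_rpow (by positivity) h3 hp.le
    _ = ε ^ (-μ) := by
        rw [← Real.rpow_mul hε0.le]; congr 1; field_simp

theorem eventually_le_rpow_neg (T : ℝ) {μ : ℝ} (hμ : 0 < μ) :
    ∀ᶠ ε in 𝓝[>] (0 : ℝ), T ≤ ε ^ (-μ) :=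
  (tendsto_rpow_neg_nhdsGT_zero (neg_neg_of_pos hμ)).eventually_ge_atTop T

theorem eventually_le_abs_log (T : ℝ) : ∀ᶠ ε in 𝓝[>] (0 : ℝ), T ≤ |Real.log ε| := 
  (tendsto_abs_atBot_atTop.comp Real.tendsto_log_nhdsGT_zero).eventually_ge_atTop T

/-- The smallness condition provides a scale `X` that dominates all relevant quantities. -/
theorem exists_threshold {σ τ : ℝ} (hσ : 0 < σ) (hτ : 0 < τ) (T : ℝ) :
    ∃ c : ℝ, 0 < c ∧ ∀ a s ε : ℝ, 1 ≤ a → 0 < s → 0 < ε → ε < 1 →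
      ε ≤ c / a ^ (200 / σ) * s ^ (5 / (2 * σ) * τ) →
      (2 / s * |Real.log ε| < 1 → T ≤ s) ∧
      (1 ≤ 2 / s * |Real.log ε| → ∃ X : ℝ, X = ε ^ (-(σ / 100)) ∧ T ≤ X ∧ a ≤ X ∧
        (2 / s * |Real.log ε|) ^ τ ≤ X ^ 41 ∧ (1 / s) ^ τ ≤ X ^ 40 ∧ 1 ≤ |Real.log ε|) := by
  set D := 5 / (2 * σ) with hD
  have hD0 : 0 < D := by positivity
  have hDτ : 0 < D * τ := by positivity
  have hev := (eventually_log_rpow_le hτ (div_pos hσ (by norm_num : (0 : ℝ) < 100))).and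
    ((eventually_log_rpow_le hDτ one_pos).and
      ((eventually_le_rpow_neg T (div_pos hσ (by norm_num : (0 : ℝ) < 100))).and
        (eventually_le_abs_log (max 1 T))))
  obtain ⟨ε₁, hε₁, hball⟩ := mem_nhdsGT_iff_exists_Ioc_subset.1 hev
  have hε₁ : 0 < ε₁ := hε₁
  set M := 2 * |Real.log ε₁| + |T| + 1 with hM
  have hM0 : 0 < M := by positivity
  refine ⟨min 1 (ε₁ / M ^ (D * τ)), by positivity, ?_⟩
  intro a s ε ha hs hε hε1 hle
  set c := min 1 (ε₁ / M ^ (D * τ)) with hc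
  have hc0 : 0 < c := by positivity
  have hc1 : c ≤ 1 := min_le_left _ _
  have haD : 1 ≤ a ^ (200 / σ) := Real.one_le_rpow ha (by positivity)
  have hsD : 0 < s ^ (D * τ) := Real.rpow_pos_of_pos hs _
  have hle' : ε * a ^ (200 / σ) ≤ c * s ^ (D * τ) := by
    rw [div_mul_eq_mul_div, le_div_iff₀ (by positivity)] at hle
    exact hle
  have hle1 : ε ≤ c * s ^ (D * τ) := (le_mul_of_one_le_right hε.le haD).trans hle'
  have hL0 : |Real.log ε| = -Real.log ε := abs_of_neg (Real.log_neg hε hε1)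
  -- If ε exceeds the range of the asymptotic bounds, the choice of c forces s ≥ M > 2|ln ε|, so
  -- only the first alternative of the conclusion can occur.
  rcases lt_or_ge ε₁ ε with h | h
  · have h1 : M ≤ s := by
      have h2 : M ^ (D * τ) ≤ s ^ (D * τ) := by
        have h3 : c * s ^ (D * τ) ≤ ε₁ / M ^ (D * τ) * s ^ (D * τ) :=
          mul_le_mul_of_nonneg_right (min_le_right _ _) hsD.le
        have h4 : ε₁ ≤ ε₁ / M ^ (D * τ) * s ^ (D * τ) := by linarith
        rw [div_mul_eq_mul_div, le_div_iff₀ (by positivity)] at h4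
        exact le_of_mul_le_mul_left h4 hε₁
      exact (Real.rpow_le_rpow_iff hM0.le hs.le hDτ).1 h2
    have h2 : |Real.log ε| ≤ |Real.log ε₁| := by
      rw [hL0, abs_of_neg (Real.log_neg hε₁ (h.trans hε1))]
      exact neg_le_neg (Real.log_le_log hε₁ h.le)
    have h3 := le_abs_self T
    have h4 := abs_nonneg T
    have h5 := abs_nonneg (Real.log ε₁)
    refine ⟨fun _ => by linarith, fun h6 => ?_⟩
    rw [div_mul_eq_mul_div, le_div_iff₀ hs] at h6
    linarith
  · obtain ⟨h1, h2, h3, h4⟩ := hball ⟨hε, h⟩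
    have h5 : 1 ≤ |Real.log ε| := (le_max_left _ _).trans h4
    have h6 : T ≤ |Real.log ε| := (le_max_right _ _).trans h4
    refine ⟨fun h7 => ?_, fun h7 => ?_⟩
    · rw [div_mul_eq_mul_div, div_lt_iff₀ hs] at h7
      linarith
    · rw [div_mul_eq_mul_div, le_div_iff₀ hs, one_mul] at h7
      have h8 : s ^ (D * τ) ≤ ε ^ (-1 : ℝ) := (Real.rpow_le_rpow hs.le h7 hDτ.le).trans h2
      have hX0 : 0 < ε ^ (-(σ / 100)) := Real.rpow_pos_of_pos hε _
      have hs1 : (1 / s) ^ τ ≤ (ε ^ (-(σ / 100))) ^ 40 := by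
        rw [← Real.rpow_natCast, ← Real.rpow_mul hε.le]
        refine (Real.rpow_le_rpow_iff (by positivity) (by positivity) hD0).1 ?_
        rw [← Real.rpow_mul (by positivity), ← Real.rpow_mul hε.le, mul_comm τ D,
          Real.div_rpow zero_le_one hs.le, Real.one_rpow]
        -- D is such that X^{40D} = ε⁻¹, while the hypothesis gives ε ≤ s^{Dτ}.
        have e1 : -(σ / 100) * ((40 : ℕ) : ℝ) * D = -1 := by rw [hD]; push_cast; field_simp; norm_num
        rw [e1, Real.rpow_neg_one, div_le_iff₀ hsD, inv_mul_eq_div, le_div_iff₀ hε, one_mul]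
        exact hle1.trans (mul_le_of_le_one_left hsD.le hc1)
      refine ⟨_, rfl, h3, ?_, ?_, hs1, h5⟩
      · refine (Real.rpow_le_rpow_iff (by linarith) hX0.le (by positivity : 0 < 200 / σ)).1 ?_
        rw [← Real.rpow_mul hε.le]
        -- Here X^{200/σ} = ε⁻². One factor ε⁻¹ comes from the hypothesis, the other from s^{Dτ} ≤
        -- (2|ln ε|)^{Dτ} ≤ ε⁻¹.
        have e1 : -(σ / 100) * (200 / σ) = (-1) + (-1) := by field_simp; norm_num
        rw [e1, Real.rpow_add hε, Real.rpow_neg_one] at *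
        rw [← mul_le_mul_iff_right₀ hε]
        calc ε * a ^ (200 / σ) ≤ 1 * s ^ (D * τ) := hle'.trans (by gcongr)
          _ ≤ ε⁻¹ := by rw [one_mul]; exact h8
          _ = _ := by field_simp
      · have e1 : 2 / s * |Real.log ε| = (2 * |Real.log ε|) * (1 / s) := by ring
        rw [e1, Real.mul_rpow (by positivity) (by positivity)]
        calc _ ≤ ε ^ (-(σ / 100)) * (ε ^ (-(σ / 100))) ^ 40 := by gcongr
          _ = _ := by ring

end Thresholds

/-! ### The case N < 1: extraction of the mean. -/

section WideStrip

open NormedSpace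

variable {d : ℕ}

/-- The conjugation step when the lost strip width is so large that only the mean value of the
perturbation matters. -/
theorem wide_step {r r' : ℝ} (hr' : 0 < r') (hrr' : r' < r)
    (A : Matrix.SpecialLinearGroup (Fin 2) ℝ)
    {f : (Fin d → ℂ) → CMat} (hf : IsStripAnalytic r (2 * Real.pi) sl2R f) {ε : ℝ} (hε : 0 < ε)
    (hε1 : ε < 1) (hfε : ∀ θ ∈ strip d r, ‖f θ‖ ≤ ε) (hs : 1 ≤ r - r')
    (hsε : Real.exp (-((r - r') / 2)) ≤ ε)
    (h1 : 32 * 14 ^ d * Real.exp (-((r - r') / 4)) ≤ 1)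
    (h2 : 32 * 14 ^ d * Real.exp (-((r - r') / 4)) ≤ logRadius) :
    ∃ (Ap : Matrix.SpecialLinearGroup (Fin 2) ℝ) (fp : (Fin d → ℂ) → CMat),
      IsStripAnalytic r' (2 * Real.pi) sl2R fp ∧
      (∀ θ ∈ strip d r', RMat.toC A * NormedSpace.exp (f θ) = RMat.toC Ap * NormedSpace.exp (fp θ)) ∧
      stripNorm r' fp ≤ ε ^ 2 ∧ ‖(Ap : RMat) - (A : RMat)‖ ≤ 2 * ‖(A : RMat)‖ * ε := by
  have hr : 0 < r := hr'.trans hrr'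
  set C := fcoef f 0 with hC
  have hCn : ‖C‖ ≤ ε := by
    have := hf.stripPer.norm_fcoef_le hr hfε 0
    simpa [l1] using this
  have hCtr : C.trace = 0 := by
    rw [← traceL_apply, hC, ← hf.stripPer.fcoef_clm hr]
    have : ∀ θ : Fin d → ℝ, traceL (f (toCd θ)) = 0 := fun θ =>
      hf.trace_eq_zero hr (toCd_mem_strip hr θ)
    simp [fcoef, torusMean, torusLift, slice, this]
  have hCcj : cj C = C := by
    have h1 := hf.stripPer.fcoef_conj (G := f) hr (fun θ => (hf.cj_eq θ).symm) 0
    rw [neg_zero] at h1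
    exact h1.symm
  set t := Real.exp (-((r - r') / 4)) with ht
  have ht0 : 0 < t := Real.exp_pos _
  set b := ε ^ 2 * (14 ^ d * t) with hb
  have hb0 : 0 ≤ b := by positivity
  -- A cutoff below 1 keeps only the mean. With δ = s/6 for s = r − r', the tail exponent is
  -- (9/10)(5/6)s = 3s/4 = s/2 + s/4: the first part pays for a second factor ε, the other absorbs
  -- constants.
  have hmodes : modes d (9 / 10) = {0} := by
    ext n
    rw [mem_modes, Finset.mem_singleton]
    constructor
    · intro h
      by_contra hn
      linarith [one_le_l1 hn]
    · rintro rfl; simp [l1]; norm_num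
  have hfC : ∀ θ ∈ strip d r', ‖f θ - C‖ ≤ b := fun θ hθ => by
    have h3 := hf.stripPer.norm_sub_truncation_le hr hfε hrr' (N := 9 / 10) (δ := (r - r') / 6)
      (by linarith) (by linarith) hθ
    rw [hmodes, Finset.sum_singleton, expo_zero_left, one_smul] at h3
    refine h3.trans ?_
    have e1 : Real.exp (-(9 / 10 * (r - r' - (r - r') / 6))) = Real.exp (-((r - r') / 2)) * t := by
      rw [ht, ← Real.exp_add]; ring_nf
    have e2 : 2 + 2 / ((r - r') / 6) ≤ 14 := by
      have : 2 / ((r - r') / 6) ≤ 12 := by rw [div_le_iff₀ (by linarith)]; linarith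
      linarith
    have e3 : 0 ≤ 2 + 2 / ((r - r') / 6) := by
      have : 0 < (r - r') / 6 := by linarith
      positivity
    rw [e1]
    calc _ ≤ ε * (ε * t * 14 ^ d) := by gcongr
      _ = b := by rw [hb]; ring
  -- G compares e^f with e^C for the mean C; its logarithm is the new perturbation, and e^C joins A.
  set G : (Fin d → ℂ) → CMat := fun θ => exp (-C) * exp (f θ) with hG
  have hGper : StripPer r' G := (StripPer.const r' _).mul (hf.stripPer.mono hrr'.le).exp
  have hexpC : exp C * exp (-C) = 1 := by
    rw [Matrix.exp_neg, Matrix.mul_nonsing_inv _ (isUnit_det_of_det (det_exp_of_trace_zero hCtr))]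
  have hexpC' : exp (-C) * exp C = 1 := by
    rw [Matrix.exp_neg, Matrix.nonsing_inv_mul _ (isUnit_det_of_det (det_exp_of_trace_zero hCtr))]
  have hG1 : ∀ θ ∈ strip d r', ‖G θ - 1‖ ≤ 8 * b := fun θ hθ => by
    have e1 : G θ - 1 = exp (-C) * (exp (f θ) - exp C) := by rw [mul_sub, hexpC']
    have e2 : ‖exp (-C)‖ ≤ Real.exp 1 := (norm_exp_le' _).trans
      (Real.exp_le_exp.2 (by rw [norm_neg]; linarith))
    have e3 : ‖exp (f θ) - exp C‖ ≤ Real.exp 1 * b := by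
      refine (norm_exp_sub_exp_le (R := 1) ((hfε θ (strip_mono hrr'.le hθ)).trans hε1.le)
        (hCn.trans hε1.le)).trans ?_
      have := hfC θ hθ
      gcongr
    have e4 : Real.exp 1 * Real.exp 1 ≤ 8 := by
      have h5 := Real.exp_one_lt_d9
      have h6 := Real.exp_pos 1
      nlinarith
    rw [e1]
    calc _ ≤ ‖exp (-C)‖ * ‖exp (f θ) - exp C‖ := norm_mul_le _ _
      _ ≤ Real.exp 1 * (Real.exp 1 * b) := by gcongr
      _ = Real.exp 1 * Real.exp 1 * b := by ring
      _ ≤ _ := by gcongr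
  have hε2 : ε ^ 2 ≤ 1 := pow_le_one₀ hε.le hε1.le
  have h14 : 0 < 14 ^ d * t := by positivity
  have hb1 : 32 * b ≤ ε ^ 2 := by rw [hb]; nlinarith [sq_nonneg ε]
  have hbl : 8 * b < logRadius := by
    have : b ≤ 14 ^ d * t := by rw [hb]; exact mul_le_of_le_one_left h14.le hε2
    nlinarith
  obtain ⟨-, hδ, ℓ, hℓan, hℓ⟩ := (exists_local_log CMat).choose_spec
  have hball : ∀ θ ∈ strip d r', G θ ∈ Metric.ball (1 : CMat) logRadius := fun θ hθ => by
    rw [mem_ball_iff_norm]; exact lt_of_le_of_lt (hG1 θ hθ) hbl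
  have hℓn : ∀ θ ∈ strip d r', ‖ℓ (G θ)‖ ≤ 1 / 2 * ε ^ 2 := fun θ hθ => by
    have h3 := (hℓ _ (hball θ hθ)).2
    have h4 := hG1 θ hθ
    linarith
  have hℓ2 : ∀ θ ∈ strip d r', ‖ℓ (G θ)‖ ≤ 1 / 4 := fun θ hθ => by
    have h3 := (hℓ _ (hball θ hθ)).2
    have h4 : 8 * b < 1 / 8 := lt_of_lt_of_le hbl hδ
    linarith [hG1 θ hθ]
  have hGdet : ∀ θ ∈ strip d r', (G θ).det = 1 := fun θ hθ => by
    rw [hG, Matrix.det_mul, det_exp_of_trace_zero (by rw [Matrix.trace_neg, hCtr, neg_zero]),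
      det_exp_of_trace_zero (hf.trace_eq_zero hr (strip_mono hrr'.le hθ)), one_mul]
  have hper : StripPer r' (fun θ => ℓ (G θ)) := by
    refine ⟨fun θ hθ => (hℓan _ (hball θ hθ)).comp (hGper.analytic θ hθ), fun θ hθ n => ?_,
      _, hℓn⟩
    rw [hGper.periodic θ hθ n]
  obtain ⟨Y, hY, hCY⟩ := exists_sl2R_of_cj hCcj hCtr
  have hdet : (exp Y).det = 1 := by
    have h3 : (exp Y).toC.det = 1 := by rw [toC_exp, ← hCY, det_exp_of_trace_zero hCtr]
    rw [det_toC] at h3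
    exact_mod_cast h3
  obtain ⟨U, hU⟩ : ∃ U : Matrix.SpecialLinearGroup (Fin 2) ℝ, (U : RMat) = exp Y := ⟨⟨_, hdet⟩, rfl⟩
  refine ⟨A * U, fun θ => ℓ (G θ), ?_, ?_, ?_, ?_⟩
  · refine hper.isStripAnalytic fun θ => ?_
    have hθ := toCd_mem_strip hr' θ
    refine exists_sl2R_of_cj ?_
      (trace_eq_zero_of_exp (by rw [(hℓ _ (hball _ hθ)).1, hGdet _ hθ]) (hℓ2 _ hθ))
    refine exp_injOn_small (by rw [norm_cj]; exact hℓ2 _ hθ) (hℓ2 _ hθ) ?_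
    rw [← cj_exp, (hℓ _ (hball _ hθ)).1, hG, map_mul, cj_exp, cj_exp, map_neg, hCcj, hf.cj_eq]
  · intro θ hθ
    rw [(hℓ _ (hball θ hθ)).1, Matrix.SpecialLinearGroup.coe_mul, hU, toC_mul, toC_exp, ← hCY,
      mul_assoc, hG, ← mul_assoc (exp C), hexpC, one_mul]
  · exact stripNorm_le hr' fun θ hθ => (hℓn θ hθ).trans (by linarith [sq_nonneg ε])
  · rw [Matrix.SpecialLinearGroup.coe_mul, hU]
    have h3 : (A : RMat) * exp Y - (A : RMat) = (A : RMat) * (exp Y - 1) := by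
      rw [mul_sub, mul_one]
    have h4 : ‖exp Y - 1‖ ≤ 2 * ε := by
      rw [← norm_toC, toC_sub, toC_one, toC_exp, ← hCY]
      refine (norm_exp_sub_one_le C).trans ?_
      linarith [real_exp_sub_one_le (norm_nonneg C) (hCn.trans hε1.le)]
    rw [h3]
    calc _ ≤ ‖(A : RMat)‖ * ‖exp Y - 1‖ := norm_mul_le _ _
      _ ≤ ‖(A : RMat)‖ * (2 * ε) := by gcongr
      _ = _ := by ring

end WideStrip

/-! ### Power counting in the scale X. -/

section Numerics

theorem pow_le_of_rpow_le {d : ℕ} {τ x b : ℝ} (hτ : (d : ℝ) < τ) (hx : 1 ≤ x) (h : x ^ τ ≤ b) :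
    x ^ d ≤ b := by
  rw [← Real.rpow_natCast]
  exact (Real.rpow_le_rpow_of_exponent_le hx hτ.le).trans h

/-- A bound on (1/s)^τ yields one on (1/s)^d only when 1/s ≥ 1; for s ≥ 1 the base is at most 10. -/
theorem strip_const_le {d : ℕ} {τ s X : ℝ} (hτ : (d : ℝ) < τ) (hs : 0 < s) (hX : 1 ≤ X)
    (hd : 600 ^ d ≤ X) (h : (1 / s) ^ τ ≤ X ^ 40) : (2 + 2 / (s / 4)) ^ d ≤ X ^ 41 := by
  have h10 : (10 : ℝ) ^ d ≤ X := (pow_le_pow_left₀ (by norm_num) (by norm_num) d).trans hd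
  have e : 2 / (s / 4) = 8 * (1 / s) := by field_simp; norm_num
  rcases le_total 1 s with h1 | h1
  · have h2 : 1 / s ≤ 1 := by rw [div_le_one hs]; exact h1
    calc (2 + 2 / (s / 4)) ^ d ≤ 10 ^ d := by
          refine pow_le_pow_left₀ (by positivity) ?_ d
          rw [e]; linarith
      _ ≤ X ^ 1 := by rw [pow_one]; exact h10
      _ ≤ X ^ 41 := pow_le_pow_right₀ hX (by norm_num)
  · have h2 : 1 ≤ 1 / s := by rw [le_div_iff₀ hs]; linarith
    calc (2 + 2 / (s / 4)) ^ d ≤ (10 * (1 / s)) ^ d := by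
          refine pow_le_pow_left₀ (by positivity) ?_ d
          rw [e]; linarith
      _ = 10 ^ d * (1 / s) ^ d := mul_pow _ _ _
      _ ≤ X * X ^ 40 := by
          have := pow_le_of_rpow_le hτ h2 h
          gcongr
      _ = _ := by ring

/-- The numerical conditions of `nonresonant_step`. -/
theorem nonresonant_bounds {d : ℕ} {κ τ N s X ε a L : ℝ} (hκ : 0 < κ) (hτ : (d : ℝ) < τ)
    (hs : 0 < s) (hN : 1 ≤ N) (hNs : N * s = 2 * L) (hL : Real.exp (-L) = ε) (ha : 1 ≤ a)
    (haX : a ≤ X) (hNX : N ^ τ ≤ X ^ 41) (hsX : (1 / s) ^ τ ≤ X ^ 40) (hεX : ε * X ^ 600 ≤ 1)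
    (hX : 432 ≤ X) (hXκ : 48 * 648 / κ ≤ X) (hXd : 600 ^ d ≤ X) (hXs : 1 / splitRadius ≤ X) :
    ε ≤ 1 / 100 ∧ 48 * 648 * a ^ 8 * N ^ τ / (κ * ((X ^ 100)⁻¹) ^ 2) ≤ X ^ 250 ∧
    432 * (a ^ 2 * (3 * N) ^ d * X ^ 250) ^ 2 * ε ≤ 1 ∧
    12 * (a ^ 2 * (3 * N) ^ d * X ^ 250) * ε *
      (Real.exp (-(N * (s - s / 4))) * (2 + 2 / (s / 4)) ^ d) ≤ ε ^ 2 * X ^ 320 / 4 ∧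
    ε ^ 2 * X ^ 320 / 4 < splitRadius ∧ 4 * (3 * N) ^ d * X ^ 250 * ε ≤ ε * X ^ 320 := by
  have hX0 : 0 < X := by linarith
  have hX1 : 1 ≤ X := by linarith
  have hε0 : 0 < ε := by rw [← hL]; exact Real.exp_pos _
  have hmono : ∀ {i j : ℕ}, i ≤ j → X ^ i ≤ X ^ j := fun h => pow_le_pow_right₀ hX1 h
  have hεk : ∀ k ≤ 600, ε * X ^ k ≤ 1 := fun k hk =>
    (mul_le_mul_of_nonneg_left (hmono hk) hε0.le).trans hεX
  have hεX1 : ε * X ≤ 1 := by simpa using hεk 1 (by norm_num)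
  have hq : (3 * N) ^ d ≤ X ^ 42 := by
    rw [mul_pow]
    calc _ ≤ X * X ^ 41 := by
          have h1 : (3 : ℝ) ^ d ≤ X := (pow_le_pow_left₀ (by norm_num) (by norm_num) d).trans hXd
          have h2 := pow_le_of_rpow_le hτ hN hNX
          gcongr
      _ = _ := by ring
  have hk : a ^ 2 * (3 * N) ^ d * X ^ 250 ≤ X ^ 294 := by
    calc _ ≤ X ^ 2 * X ^ 42 * X ^ 250 := by gcongr
      _ = _ := by ring
  have hk0 : 0 ≤ a ^ 2 * (3 * N) ^ d * X ^ 250 := by positivity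
  -- Because Ns = 2|ln ε|, the exponential is ε^{3/2}; the spare ε^{1/2} absorbs X^300.
  have hexp : Real.exp (-(N * (s - s / 4))) * X ^ 300 ≤ ε := by
    have e1 : Real.exp (-(N * (s - s / 4))) = ε * Real.exp (-(L / 2)) := by
      rw [← hL, ← Real.exp_add]; congr 1; linear_combination (-3 / 4) * hNs
    have e2 : Real.exp (-(L / 2)) * X ^ 300 ≤ 1 := by
      have : (Real.exp (-(L / 2)) * X ^ 300) ^ 2 ≤ 1 ^ 2 := by
        rw [mul_pow, ← pow_mul, sq (Real.exp _), ← Real.exp_add, ← neg_add, add_halves, hL]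
        simpa using hεX
      exact le_of_sq_le_sq this zero_le_one
    rw [e1, mul_assoc]
    exact mul_le_of_le_one_right hε0.le e2
  refine ⟨by nlinarith, ?_, ?_, ?_, ?_, ?_⟩
  -- The bound X^250 on the solution operators is the count 1 + 8 + 41 + 200, the last coming from η
  -- = X^{-100} squared.
  · have e1 : 48 * 648 * a ^ 8 * N ^ τ / (κ * ((X ^ 100)⁻¹) ^ 2) =
        48 * 648 / κ * a ^ 8 * N ^ τ * X ^ 200 := by field_simp
    rw [e1]
    calc _ ≤ X * X ^ 8 * X ^ 41 * X ^ 200 := by gcongr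
      _ = _ := by ring
  · calc _ ≤ X * (X ^ 294) ^ 2 * ε := by gcongr
      _ = ε * X ^ 589 := by ring
      _ ≤ 1 := hεk _ (by norm_num)
  · have hδ := strip_const_le hτ hs hX1 hXd hsX
    have hE := (Real.exp_pos (-(N * (s - s / 4)))).le
    have h48 : 48 * X ^ 35 ≤ X ^ 320 := by
      calc 48 * X ^ 35 ≤ X * X ^ 35 := by gcongr; linarith
        _ = X ^ 36 := by ring
        _ ≤ _ := hmono (by norm_num)
    calc _ ≤ 12 * X ^ 294 * ε * (Real.exp (-(N * (s - s / 4))) * X ^ 41) := by gcongr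
      _ = 12 * X ^ 35 * ε * (Real.exp (-(N * (s - s / 4))) * X ^ 300) := by ring
      _ ≤ 12 * X ^ 35 * ε * ε := by gcongr
      _ = (48 * X ^ 35) * ε ^ 2 / 4 := by ring
      _ ≤ X ^ 320 * ε ^ 2 / 4 := by gcongr
      _ = _ := by ring
  · have h1 : ε ^ 2 * X ^ 320 ≤ ε := by
      have := mul_le_of_le_one_right hε0.le (hεk 320 (by norm_num))
      rw [← mul_assoc, ← sq] at this
      exact this
    rw [div_le_iff₀ splitRadius_pos] at hXs
    nlinarith [splitRadius_pos]
  · calc _ ≤ X * X ^ 42 * X ^ 250 * ε := by gcongr; linarith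
      _ = ε * X ^ 293 := by ring
      _ ≤ _ := mul_le_mul_of_nonneg_left (hmono (by norm_num)) hε0.le

set_option maxHeartbeats 1600000 in
/-- The numerical conditions of `resonant_step`. -/
theorem resonant_bounds {d : ℕ} {κ τ N s X ε a L K k : ℝ} (hκ : 0 < κ) (hτ0 : 0 < τ)
    (hτ : (d : ℝ) < τ)
    (hs : 0 < s) (hN : 1 ≤ N) (hNs : N * s = 2 * L) (hL : Real.exp (-L) = ε) (hL1 : 1 ≤ L)
    (ha : 1 ≤ a)
    (haX : a ≤ X) (hNX : N ^ τ ≤ X ^ 41) (hsX : (1 / s) ^ τ ≤ X ^ 40) (hεX : ε * X ^ 600 ≤ 1)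
    (hX : 432 ≤ X) (hXκ : 48 * 648 / κ ≤ X) (hXτ : 4 * 201 ^ τ / κ ≤ X) (hXd : 600 ^ d ≤ X)
    (hXs : 1 / splitRadius ≤ X) (hXl : 1 / logRadius ≤ X) (hK : K = a * N ^ τ / κ)
    (hk : k = (3 * (200 * N ^ 2)) ^ d * (5 * X ^ 83)) :
    (X ^ 100)⁻¹ ≤ 1 / 16 ∧ (X ^ 100)⁻¹ ≤ logRadius ∧
    (X ^ 100)⁻¹ ≤ κ / (2 * (200 * N ^ 2 + N) ^ τ) ∧ (X ^ 100)⁻¹ ≤ κ / (10 * N ^ τ) ∧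
    5 * K * ε ≤ (X ^ 100)⁻¹ / 100 ∧ 4 * (200 * N ^ 2 + N) ^ τ / κ ≤ X ^ 83 ∧
    216 * k ^ 2 * (5 * K * ε) ≤ 1 ∧
    12 * k * (5 * K * ε) *
      (Real.exp (-(200 * N ^ 2 * (s - s / 4))) * (2 + 2 / (s / 4)) ^ d) < splitRadius ∧
    4 * (12 * k * (5 * K * ε) *
      (Real.exp (-(200 * N ^ 2 * (s - s / 4))) * (2 + 2 / (s / 4)) ^ d)) ≤
      32 * K * ε * Real.exp (-(100 * N ^ 2 * s)) * (100 * N ^ 2) ^ d ∧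
    ∀ r' ≤ L, 32 * K * ε * Real.exp (-(100 * N ^ 2 * s)) * (100 * N ^ 2) ^ d * Real.exp (N * r') <
      ε ^ 100 := by
  have hX0 : 0 < X := by linarith
  have hX1 : 1 ≤ X := by linarith
  have hε0 : 0 < ε := by rw [← hL]; exact Real.exp_pos _
  have hε1 : ε < 1 := by rw [← hL, Real.exp_lt_one_iff]; linarith
  have hmono : ∀ {i j : ℕ}, i ≤ j → X ^ i ≤ X ^ j := fun h => pow_le_pow_right₀ hX1 h
  have hεk : ∀ k ≤ 600, ε * X ^ k ≤ 1 := fun k hk =>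
    (mul_le_mul_of_nonneg_left (hmono hk) hε0.le).trans hεX
  have hinv : ∀ {y : ℝ}, 0 < y → 1 ≤ y * X ^ 100 → (X ^ 100)⁻¹ ≤ y := fun hy h => by
    rw [inv_le_iff_one_le_mul₀ (by positivity)]; exact h
  have hNτ : 0 < N ^ τ := Real.rpow_pos_of_pos (by linarith) _
  have hκX : 1 / κ ≤ X := by
    refine le_trans ?_ hXκ
    exact div_le_div_of_nonneg_right (by norm_num) hκ.le
  have hκX' : 1 ≤ κ * X := by rwa [div_le_iff₀ hκ, mul_comm] at hκX
  have hKX : K ≤ X ^ 43 := by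
    have e1 : K = 1 / κ * a * N ^ τ := by rw [hK]; field_simp
    rw [e1]
    calc _ ≤ X * X * X ^ 41 := by gcongr
      _ = _ := by ring
  have hK0 : 0 < K := by rw [hK]; positivity
  have hd200 : ∀ c : ℝ, 0 ≤ c → c ≤ 600 → (c * N ^ 2) ^ d ≤ X ^ 83 := fun c hc hc' => by
    have h2 := pow_le_of_rpow_le hτ hN hNX
    rw [mul_pow, ← pow_mul, mul_comm 2 d, pow_mul]
    calc c ^ d * (N ^ d) ^ 2 ≤ X * (X ^ 41) ^ 2 := by
          have h1 : c ^ d ≤ X := (pow_le_pow_left₀ hc hc' d).trans hXd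
          gcongr
      _ = _ := by ring
  have hkX : k ≤ X ^ 167 := by
    have h1 := hd200 600 (by norm_num) le_rfl
    have e1 : 3 * (200 * N ^ 2) = 600 * N ^ 2 := by ring
    rw [hk, e1]
    calc _ ≤ X ^ 83 * (X * X ^ 83) := by gcongr; linarith
      _ = _ := by ring
  have hk0 : 0 ≤ k := by rw [hk]; positivity
  have hN2 : (200 * N ^ 2 + N) ^ τ ≤ 201 ^ τ * X ^ 82 := by
    have h1 : 200 * N ^ 2 + N ≤ 201 * (N * N) := by nlinarith
    calc _ ≤ (201 * (N * N)) ^ τ := Real.rpow_le_rpow (by positivity) h1 hτ0.le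
      _ = 201 ^ τ * (N ^ τ * N ^ τ) := by
          rw [Real.mul_rpow (by norm_num) (by positivity), Real.mul_rpow (by linarith) (by linarith)]
      _ ≤ 201 ^ τ * (X ^ 41 * X ^ 41) := by gcongr
      _ = _ := by ring
  have hs83 : 4 * (200 * N ^ 2 + N) ^ τ / κ ≤ X ^ 83 := by
    calc _ ≤ 4 * (201 ^ τ * X ^ 82) / κ := by gcongr
      _ = 4 * 201 ^ τ / κ * X ^ 82 := by ring
      _ ≤ X * X ^ 82 := by gcongr
      _ = _ := by ring
  have hNN0 : 0 < (200 * N ^ 2 + N) ^ τ := Real.rpow_pos_of_pos (by positivity) _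
  have hδ := strip_const_le hτ hs hX1 hXd hsX
  have hδ0 : 0 ≤ (2 + 2 / (s / 4)) ^ d := by positivity
  -- After the loss s/4 the exponent is 150N²s. Two thirds of it are kept for N' = 100N², and the
  -- remaining 50N²s = 100N|ln ε| yields a factor ε that pays for all constants.
  have hexp : Real.exp (-(200 * N ^ 2 * (s - s / 4))) ≤ Real.exp (-(100 * N ^ 2 * s)) * ε := by
    rw [← hL, ← Real.exp_add, Real.exp_le_exp]
    have e1 : N ^ 2 * s = N * (2 * L) := by rw [← hNs]; ring
    nlinarith
  have hexp1 : Real.exp (-(100 * N ^ 2 * s)) ≤ 1 := Real.exp_le_one_iff.2 (by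
    have : 0 ≤ 100 * N ^ 2 * s := by positivity
    linarith)
  have he44 : 5 * K * ε ≤ X ^ 44 * ε := by
    have : 5 * K ≤ X * X ^ 43 := mul_le_mul (by linarith) hKX hK0.le hX0.le
    calc _ ≤ X * X ^ 43 * ε := by gcongr
      _ = _ := by ring
  have he0 : 0 < 5 * K * ε := by positivity
  refine ⟨?_, ?_, ?_, ?_, ?_, hs83, ?_, ?_, ?_, ?_⟩
  · refine hinv (by norm_num) ?_
    have := hmono (i := 1) (j := 100) (by norm_num)
    rw [pow_one] at this
    linarith
  · refine hinv logRadius_pos ?_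
    rw [div_le_iff₀ logRadius_pos, mul_comm] at hXl
    refine hXl.trans (mul_le_mul_of_nonneg_left ?_ logRadius_pos.le)
    simpa using hmono (i := 1) (j := 100) (by norm_num)
  · refine hinv (by positivity) ?_
    have h1 : 2 * (200 * N ^ 2 + N) ^ τ / κ ≤ X ^ 100 := by
      refine le_trans ?_ (hs83.trans (hmono (by norm_num)))
      gcongr; norm_num
    rw [div_le_iff₀ hκ] at h1
    rw [div_mul_eq_mul_div, le_div_iff₀ (by positivity)]
    linarith
  · refine hinv (by positivity) ?_
    have h1 : 10 * N ^ τ / κ ≤ X ^ 100 := by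
      have e1 : 10 * N ^ τ / κ = 10 * (1 / κ) * N ^ τ := by ring
      rw [e1]
      calc _ ≤ X * X * X ^ 41 := by gcongr; linarith
        _ = X ^ 43 := by ring
        _ ≤ _ := hmono (by norm_num)
    rw [div_le_iff₀ hκ] at h1
    rw [div_mul_eq_mul_div, le_div_iff₀ (by positivity)]
    linarith
  · rw [le_div_iff₀ (by norm_num), le_inv_comm₀ (by positivity) (by positivity), ← one_div,
      le_div_iff₀ (by positivity)]
    calc X ^ 100 * (5 * K * ε * 100) ≤ X ^ 100 * (X ^ 44 * ε * X) := by
          gcongr; linarith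
      _ = ε * X ^ 145 := by ring
      _ ≤ 1 := hεk _ (by norm_num)
  · calc _ ≤ X * (X ^ 167) ^ 2 * (X ^ 44 * ε) := by gcongr; linarith
      _ = ε * X ^ 379 := by ring
      _ ≤ 1 := hεk _ (by norm_num)
  · have hE1 : Real.exp (-(200 * N ^ 2 * (s - s / 4))) ≤ ε :=
      hexp.trans (mul_le_of_le_one_left hε0.le hexp1)
    rw [div_le_iff₀ splitRadius_pos] at hXs
    have h1 : 12 * k * (5 * K * ε) *
        (Real.exp (-(200 * N ^ 2 * (s - s / 4))) * (2 + 2 / (s / 4)) ^ d) ≤ ε := by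
      calc _ ≤ X * X ^ 167 * (X ^ 44 * ε) * (ε * X ^ 41) := by gcongr; linarith
        _ = ε * (ε * X ^ 253) := by ring
        _ ≤ _ := mul_le_of_le_one_right hε0.le (hεk _ (by norm_num))
    have h2 : ε * X ^ 2 ≤ 1 := hεk 2 (by norm_num)
    have h3 : ε * X < 1 := by nlinarith
    nlinarith [splitRadius_pos]
  · have hE0 := (Real.exp_pos (-(100 * N ^ 2 * s))).le
    have h1 : 1 ≤ (100 * N ^ 2) ^ d := one_le_pow₀ (by nlinarith)
    have h2 : 240 * X ^ 167 * X ^ 41 * ε ≤ 32 := by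
      calc _ ≤ X * X ^ 167 * X ^ 41 * ε := by gcongr; linarith
        _ = ε * X ^ 209 := by ring
        _ ≤ 1 := hεk _ (by norm_num)
        _ ≤ 32 := by norm_num
    calc _ ≤ 4 * (12 * X ^ 167 * (5 * K * ε) *
          ((Real.exp (-(100 * N ^ 2 * s)) * ε) * X ^ 41)) := by gcongr
      _ = (240 * X ^ 167 * X ^ 41 * ε) * (K * ε * Real.exp (-(100 * N ^ 2 * s))) := by ring
      _ ≤ 32 * (K * ε * Real.exp (-(100 * N ^ 2 * s))) := by gcongr
      _ = 32 * K * ε * Real.exp (-(100 * N ^ 2 * s)) * 1 := by ring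
      _ ≤ _ := by gcongr
  · intro r' hr'
    have h1 := hd200 100 (by norm_num) (by norm_num)
    -- The exponent is at most −200NL + NL ≤ −101L, since N ≥ 1 and r' ≤ L.
    have h2 : Real.exp (-(100 * N ^ 2 * s)) * Real.exp (N * r') ≤ ε ^ 100 * ε := by
      rw [← hL, ← Real.exp_nat_mul, ← Real.exp_add, ← Real.exp_add, Real.exp_le_exp]
      have e1 : N ^ 2 * s = N * (2 * L) := by rw [← hNs]; ring
      push_cast
      nlinarith
    have h100 : 0 < ε ^ 100 := by positivity
    calc 32 * K * ε * Real.exp (-(100 * N ^ 2 * s)) * (100 * N ^ 2) ^ d * Real.exp (N * r')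
        = 32 * K * ε * (100 * N ^ 2) ^ d *
          (Real.exp (-(100 * N ^ 2 * s)) * Real.exp (N * r')) := by ring
      _ ≤ X * X ^ 43 * ε * X ^ 83 * (ε ^ 100 * ε) := by gcongr; linarith
      _ = (ε * X ^ 127) * (ε ^ 100 * ε) := by ring
      _ ≤ 1 * (ε ^ 100 * ε) := by gcongr; exact hεk _ (by norm_num)
      _ = ε ^ 100 * ε := one_mul _
      _ < ε ^ 100 := mul_lt_of_lt_one_right h100 hε1

end Numerics

/-! ### Uniqueness of the resonance and assembly of the proof. -/

section Main

variable {d : ℕ}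

theorem l1_pos_iff_ne_zero {m : Fin d → ℤ} : 0 < l1 m ↔ m ≠ 0 := by
  refine ⟨fun h => ?_, fun h => by linarith [one_le_l1 h]⟩
  rintro rfl
  simp [l1] at h

theorem isStripAnalytic_one (r : ℝ) :
    IsStripAnalytic r (4 * Real.pi) SL2R (fun _ : Fin d → ℂ => (1 : CMat)) :=
  (StripPer.const r 1).isStripAnalytic_double fun _ => ⟨1, Matrix.det_one, toC_one.symm⟩

/-- At most one mode of size at most `N` is resonant. -/
theorem resonance_unique {κ τ N N₂ η : ℝ} {α : Fin d → ℝ} {ρ : ℂ} (hκ : 0 < κ) (hτ : 0 < τ)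
    (hα : IsDC κ τ α) (hN₂ : N ≤ N₂) (hη : η ≤ κ / (2 * (N₂ + N) ^ τ)) {m n : Fin d → ℤ}
    (hm : l1 m ≤ N) (hn : l1 n ≤ N) (hmη : distTwoPi (2 * ρ - (pairing m α : ℂ)) < η)
    (hnη : distTwoPi (2 * ρ - (pairing n α : ℂ)) < η) : m = n := by
  by_contra hmn
  have h1 := hα.lower hκ hτ (sub_ne_zero.2 hmn) ((l1_sub_le m n).trans (by linarith : _ ≤ N₂ + N))
  have h2 := distTwoPi_sub_le (2 * ρ - (pairing n α : ℂ)) (2 * ρ - (pairing m α : ℂ))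
  have h3 : 2 * ρ - (pairing n α : ℂ) - (2 * ρ - (pairing m α : ℂ)) = (pairing (m - n) α : ℂ) := by
    rw [sub_eq_add_neg m n, pairing_add, pairing_neg]; push_cast; ring
  rw [h3] at h2
  have h4 : κ / (2 * (N₂ + N) ^ τ) = 1 / 2 * (κ / (N₂ + N) ^ τ) := by field_simp
  linarith

theorem exists_wide_threshold (d : ℕ) : ∃ T : ℝ, 1 ≤ T ∧ ∀ s : ℝ, T ≤ s →
    32 * 14 ^ d * Real.exp (-(s / 4)) ≤ 1 ∧ 32 * 14 ^ d * Real.exp (-(s / 4)) ≤ logRadius := by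
  have h1 : Filter.Tendsto (fun s : ℝ => 32 * 14 ^ d * Real.exp (-(s / 4))) Filter.atTop
      (nhds (32 * 14 ^ d * 0)) := by
    refine Filter.Tendsto.const_mul _ (Real.tendsto_exp_neg_atTop_nhds_zero.comp ?_)
    exact Filter.tendsto_id.atTop_div_const (by norm_num)
  rw [mul_zero] at h1
  obtain ⟨T, hT⟩ := Filter.eventually_atTop.1
    ((h1.eventually_le_const one_pos).and (h1.eventually_le_const logRadius_pos))
  exact ⟨max 1 T, le_max_left _ _, fun s hs => hT s ((le_max_right _ _).trans hs)⟩

end Main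

set_option maxHeartbeats 4000000 in
theorem proposition3p1 (σ : ℝ) (hσ0 : 0 < σ) (hσ : σ < 1 / 6) :
    ∃ D Dt : ℝ, 2 / σ < D ∧
    ∀ (d : ℕ) (κ τ : ℝ), 0 < d → 0 < κ → (d : ℝ) < τ →
    ∃ c : ℝ, 0 < c ∧
    ∀ (α : Fin d → ℝ) (r r' ε : ℝ) (A : Matrix.SpecialLinearGroup (Fin 2) ℝ) (ρ : ℂ)
      (f : (Fin d → ℂ) → CMat),
      IsDC κ τ α →
      0 < r' → r' < r →
      HasEigenvaluePair (A : RMat) ρ →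
      IsStripAnalytic r (2 * Real.pi) sl2R f →
      0 < ε → ε < 1 →
      stripNorm r f ≤ ε →
      ε ≤ c / ‖(A : RMat)‖ ^ Dt * (r - r') ^ (D * τ) →
      ∃ (B : (Fin d → ℂ) → CMat) (Ap : Matrix.SpecialLinearGroup (Fin 2) ℝ)
        (fp : (Fin d → ℂ) → CMat),
        IsStripAnalytic r' (4 * Real.pi) SL2R B ∧
        IsStripAnalytic r' (2 * Real.pi) sl2R fp ∧
        (∀ θ ∈ strip d r',
          B (fun i => θ i + (α i : ℂ)) * (RMat.toC A * NormedSpace.exp (f θ)) * (B θ)⁻¹ =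
            RMat.toC Ap * NormedSpace.exp (fp θ)) ∧
        -- the non-resonant case
        ((∀ m : Fin d → ℤ, 0 < l1 m → l1 m ≤ truncN r r' ε →
            ε ^ σ ≤ distTwoPi (2 * ρ - (pairing m α : ℂ))) →
          stripNorm r' (fun θ => B θ - 1) ≤ ε ^ (1 - 8 / D) ∧
          stripNorm r' fp ≤ ε ^ (2 - 8 / D) ∧
          ‖(Ap : RMat) - (A : RMat)‖ ≤ 2 * ‖(A : RMat)‖ * ε) ∧
        -- the resonant case
        (∀ m : Fin d → ℤ, 0 < l1 m → l1 m ≤ truncN r r' ε →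
          distTwoPi (2 * ρ - (pairing m α : ℂ)) < ε ^ σ →
          stripNorm r' B ≤ 8 * (‖(A : RMat)‖ / κ) ^ (1 / 2 : ℝ) *
            (2 / (r - r') * |Real.log ε|) ^ (τ / 2) * ε ^ (-r' / (r - r')) ∧
          realNorm B ≤ 8 * (‖(A : RMat)‖ / κ) ^ (1 / 2 : ℝ) *
            (2 / (r - r') * |Real.log ε|) ^ (τ / 2) ∧
          (∃ N' : ℝ, 2 * truncN r r' ε ^ 2 < N' ∧
            stripNorm r' fp ≤ resonantBound d κ τ r r' ε ‖(A : RMat)‖ N' ∧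
            (r' ≤ max 1 |Real.log ε| →
              resonantBound d κ τ r r' ε ‖(A : RMat)‖ N' < ε ^ 100)) ∧
          ∃ (A'' : RMat) (j : ℤ) (t : ℝ) (v : ℂ),
            A'' ∈ sl2R ∧
            ‖2 * ρ - (pairing m α : ℂ) - 2 * (Real.pi : ℂ) * (j : ℂ)‖ < ε ^ σ ∧
            (Ap : RMat) = (-1 : ℝ) ^ j • NormedSpace.exp A'' ∧
            ‖A''‖ ≤ 2 * ε ^ σ ∧
            cayleyM * A''.toC * cayleyM⁻¹ =
              !![Complex.I * (t : ℂ), v; (starRingEnd ℂ) v, -(Complex.I * (t : ℂ))] ∧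
            |t| ≤ ε ^ σ ∧
            ‖v‖ ≤ 2 ^ (4 + τ) * ‖(A : RMat)‖ * |Real.log ε| ^ τ / (κ * (r - r') ^ τ) * ε *
              Real.exp (-(l1 m * r))) := by
  -- With D = 5/(2σ) the loss ε^{-8/D} is exactly X^320 and X^{40D} = ε⁻¹; with the second exponent,
  -- X^{200/σ} = ε⁻².
  refine ⟨5 / (2 * σ), 200 / σ, ?_, ?_⟩
  · rw [div_lt_div_iff₀ hσ0 (by positivity)]; linarith
  intro d κ τ hd hκ hτ
  have hτ0 : 0 < τ := lt_of_le_of_lt (Nat.cast_nonneg d) hτ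
  obtain ⟨T, hT1, hT⟩ := exists_wide_threshold d
  have hsR := splitRadius_pos
  have hlR := logRadius_pos
  -- All lower bounds required of X are added, so that X ≥ T' implies each of them.
  set T' : ℝ := T + 432 + 48 * 648 / κ + 4 * 201 ^ τ / κ + 600 ^ d + 1 / splitRadius +
    1 / logRadius with hT'
  have p1 : 0 < 48 * 648 / κ := by positivity
  have p2 : 0 < 4 * 201 ^ τ / κ := by positivity
  have p3 : (0 : ℝ) < 600 ^ d := by positivity
  have p4 : 0 < 1 / splitRadius := by positivity
  have p5 : 0 < 1 / logRadius := by positivity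
  obtain ⟨c, hc, hscale⟩ := exists_threshold hσ0 hτ0 T'
  refine ⟨c, hc, ?_⟩
  intro α r r' ε A ρ f hα hr' hrr' hρ hf hε0 hε1 hfn hle
  have hfε : ∀ θ ∈ strip d r, ‖f θ‖ ≤ ε := fun θ hθ => hf.norm_le hfn hθ
  have hs : 0 < r - r' := sub_pos.2 hrr'
  have ha : 1 ≤ ‖(A : RMat)‖ := norm_toC_SL_ge A
  have hLabs : |Real.log ε| = -Real.log ε := abs_of_neg (Real.log_neg hε0 hε1)
  have hL0 : 0 < |Real.log ε| := abs_pos.2 (Real.log_neg hε0 hε1).ne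
  have hexpL : Real.exp (-|Real.log ε|) = ε := by rw [hLabs, neg_neg, Real.exp_log hε0]
  obtain ⟨hsmall, hlarge⟩ := hscale _ _ _ ha hs hε0 hε1 hle
  have hD8 : 8 / (5 / (2 * σ)) = 16 * σ / 5 := by field_simp; norm_num
  set s := r - r' with hsdef
  set L := |Real.log ε| with hLdef
  have htrunc : truncN r r' ε = 2 / s * L := rfl
  rw [htrunc]
  rcases lt_or_ge (2 / s * L) 1 with hN | hN
  · -- the strip loss is so wide that no mode has to be removed
    have hsT : T ≤ s := by linarith [hsmall hN]
    obtain ⟨t1, t2⟩ := hT s hsT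
    have hsL : 2 * L < s := by rwa [div_mul_eq_mul_div, div_lt_one hs] at hN
    obtain ⟨Ap, fp, h1, h2, h3, h4⟩ := wide_step hr' hrr' A hf hε0 hε1 hfε (hT1.trans hsT)
      (by rw [← hexpL, Real.exp_le_exp]; linarith) t1 t2
    refine ⟨fun _ => 1, Ap, fp, isStripAnalytic_one r', h1, fun θ hθ => ?_, fun _ => ⟨?_, ?_, h4⟩,
      fun m hm hmN => ?_⟩
    · rw [inv_one, one_mul, mul_one, h2 θ hθ]
    · refine stripNorm_le hr' fun θ _ => ?_
      rw [sub_self, norm_zero]; positivity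
    · refine h3.trans ?_
      rw [← Real.rpow_natCast]
      refine Real.rpow_le_rpow_of_exponent_ge hε0 hε1.le ?_
      have : 0 ≤ 8 / (5 / (2 * σ)) := by positivity
      push_cast; linarith
    · have := one_le_l1 (l1_pos_iff_ne_zero.1 hm)
      linarith
  obtain ⟨X, hX, hTX, haX, hNX, hsX, hL1⟩ := hlarge hN
  set N := 2 / s * L with hNdef
  have hX1 : 1 ≤ X := by linarith
  have hX0 : 0 < X := by linarith
  have hNs : N * s = 2 * L := by rw [hNdef]; field_simp
  have hXpow : ∀ k : ℕ, X ^ k = ε ^ (-(σ / 100) * k) := fun k => by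
    rw [hX, ← Real.rpow_natCast, ← Real.rpow_mul hε0.le]
  have hη : ε ^ σ = (X ^ 100)⁻¹ := by
    rw [hXpow, ← Real.rpow_neg hε0.le]; congr 1; push_cast; ring
  -- Here σ < 1/6 enters: X^600 = ε^{-6σ}.
  have hεX : ε * X ^ 600 ≤ 1 := by
    rw [hXpow]
    nth_rw 1 [← Real.rpow_one ε]
    rw [← Real.rpow_add hε0]
    refine Real.rpow_le_one hε0.le hε1.le ?_
    push_cast; linarith
  have hX320 : ∀ y : ℝ, ε ^ (y - 8 / (5 / (2 * σ))) = ε ^ y * X ^ 320 := fun y => by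
    rw [hXpow, ← Real.rpow_add hε0, hD8]; congr 1; push_cast; ring
  have hη0 : 0 < ε ^ σ := Real.rpow_pos_of_pos hε0 _
  obtain ⟨u1, u2, u3, u4, u5, u6, u7, u8, u9, u10⟩ := resonant_bounds hκ hτ0 hτ hs hN hNs hexpL hL1
    ha haX hNX hsX hεX (by linarith) (by linarith) (by linarith) (by linarith) (by linarith)
    (by linarith) rfl rfl
  rw [← hη] at u1 u2 u3 u4 u5
  have hN₂ : N ≤ 200 * N ^ 2 := by nlinarith
  by_cases hres : ∃ m : Fin d → ℤ, 0 < l1 m ∧ l1 m ≤ N ∧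
      distTwoPi (2 * ρ - (pairing m α : ℂ)) < ε ^ σ
  · obtain ⟨m, hm0, hmN, hmη⟩ := hres
    obtain ⟨B, Ap, fp, h1, h2, h3, h4, h5, h6, Y, j, h7, h8, h9, h10, h11⟩ :=
      resonant_step hr' hrr' hN₂ hκ hτ0 hα hρ hf (l1_pos_iff_ne_zero.1 hm0) hmN hmη hη0 u1 u2 u3 u4
        hε0 hfε rfl rfl u5 (one_le_pow₀ hX1) u6 rfl rfl u7 (by linarith : 0 < s / 4)
        (by linarith) le_rfl u8
    refine ⟨B, Ap, fp, h1, h2, h3, fun hnr => ?_, fun m' hm0' hmN' hmη' => ?_⟩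
    · exact absurd hmη (not_lt.2 (hnr m hm0 hmN))
    -- The construction was made for one chosen resonance, but the estimates are claimed for every
    -- resonant mode; there is only one.
    obtain rfl := resonance_unique hκ hτ0 hα hN₂ u3 hmN hmN' hmη hmη'
    set a := ‖(A : RMat)‖ with hadef
    set K := a * N ^ τ / κ with hK
    have hK0 : 0 ≤ K := by positivity
    have hsqrt : Real.sqrt K = (a / κ) ^ (1 / 2 : ℝ) * N ^ (τ / 2) := by
      rw [Real.sqrt_eq_rpow]
      have e1 : K = a / κ * N ^ τ := by rw [hK]; ring
      rw [e1, Real.mul_rpow (by positivity) (by positivity), ← Real.rpow_mul (by positivity)]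
      congr 2; ring
    have hsqrt8 : 11 / 10 * Real.sqrt (5 * K) ≤ 8 * (a / κ) ^ (1 / 2 : ℝ) * N ^ (τ / 2) := by
      rw [mul_assoc, ← hsqrt, Real.sqrt_mul (by norm_num)]
      have e1 : Real.sqrt 5 ≤ 3 := by rw [Real.sqrt_le_left (by norm_num)]; norm_num
      have e2 := mul_le_mul_of_nonneg_right e1 (Real.sqrt_nonneg K)
      linarith [Real.sqrt_nonneg K]
    have hKeq : ∀ i : ℝ, 2 ^ (i + τ) * a * L ^ τ / (κ * s ^ τ) = 2 ^ i * K := fun i => by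
      have e1 : N = 2 * (L / s) := by rw [hNdef]; ring
      rw [hK, e1, Real.mul_rpow (by norm_num) (by positivity), Real.div_rpow hL0.le hs.le,
        Real.rpow_add (by norm_num)]
      field_simp
    have hr'm : l1 m * r' ≤ N * r' := mul_le_mul_of_nonneg_right hmN hr'.le
    -- N' = 100N² is half the elimination order 200N²; the other half pays for truncation and
    -- constants.
    refine ⟨?_, h5.trans hsqrt8, ⟨100 * N ^ 2, by nlinarith, ?_, fun hr'L => ?_⟩, Y, j,
      (coefJ Y.toC).re, coefP Y.toC, h7, h8, h9, by linarith, cayleyM_conj_of_sl2R h7, ?_, ?_⟩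
    · refine h4.trans ?_
      -- This power of ε is the bound e^{Nr'/2} for the half-angle rotation on the strip, using |m|
      -- ≤ N.
      have e1 : ε ^ (-r' / s) = Real.exp (N * r' / 2) := by
        rw [Real.rpow_def_of_pos hε0, ← neg_neg (Real.log ε), ← hLabs, hNdef]
        congr 1; field_simp
      rw [e1]
      have e2 : Real.exp (l1 m * r' / 2) ≤ Real.exp (N * r' / 2) :=
        Real.exp_le_exp.2 (by linarith)
      gcongr
    · refine h6.trans ?_
      rw [resonantBound, htrunc, ← hsdef, ← hLdef, hKeq]
      have e1 : (2 : ℝ) ^ (5 : ℝ) = 32 := by norm_num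
      rw [e1]
      exact mul_le_mul u9 (Real.exp_le_exp.2 hr'm) (Real.exp_pos _).le (by positivity)
    · rw [resonantBound, htrunc, ← hsdef, ← hLdef, hKeq]
      have e1 : (2 : ℝ) ^ (5 : ℝ) = 32 := by norm_num
      rw [e1]
      exact u10 r' (hr'L.trans (max_le hL1 le_rfl))
    · refine (Complex.abs_re_le_norm _).trans ((norm_coefJ_le _).trans ?_)
      rw [norm_toC]; exact h10
    · refine h11.trans ?_
      rw [hKeq]
      have e1 : (2 : ℝ) ^ (4 : ℝ) = 16 := by norm_num
      rw [e1]
      refine mul_le_mul_of_nonneg_right ?_ (Real.exp_pos _).le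
      have := mul_nonneg hK0 hε0.le
      linarith
  · push Not at hres
    obtain ⟨v1, v2, v3, v4, v5, v6⟩ := nonresonant_bounds hκ hτ hs hN hNs hexpL ha haX hNX hsX hεX
      (by linarith) (by linarith) (by linarith) (by linarith)
    obtain ⟨B, Ap, fp, h1, h2, h3, h4, h5, h6⟩ := nonresonant_step hr' hrr' hN hκ hτ0 hα hρ hf hε0
      v1 hη0 rfl rfl (by rw [hη]; exact v2) (one_le_pow₀ hX1) hfε hres v3
      (by linarith : 0 < s / 4) (by linarith) v4 v5
    refine ⟨B, Ap, fp, h1, h2, h3, fun _ => ⟨h4.trans ?_, h5.trans ?_, h6⟩,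
      fun m hm0 hmN hmη => absurd hmη (not_lt.2 (hres m hm0 hmN))⟩
    · rw [hX320, Real.rpow_one]; exact v6
    · rw [hX320, Real.rpow_ofNat]; linarith
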